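/- **Environment.** There are $n$ worker pools, hiring days $1,\dots,T$ and an operating day $T+1$. Pool $i$ starts with $s_i\ge 0$ workers; a fraction $\alpha_{it}\in[0,1)$ of its available workers becomes unavailable on day $t$, and $\rho_{it}=\prod_{s\le t}(1-\alpha_{is})$. The platform has a budget $B\in[0,\infty)$, wages $p_{it}\ge 0$ and releasing fees $q_{it}\in[0,\infty]$. There are days $0=t_0<t_1<\dots<t_L=T$ with $L\ge1$ such that on each epoch $\mathcal T_\ell=\{t_{\ell-1}+1,\dots,t_\ell\}$ the fee $q_{it}=q_\ell$ depends neither on the day nor on the pool. Let $\mathcal T_\ell^+=\{t_{\ell-1},\dots,t_\ell\}$. A profile $(x_{it},y_{it})\ge 0$ (hires, releases) is feasible if $\sum_{t\le T}x_{it}/\rho_{it}\le s_i$ for all $i$, $\sum_{i}\sum_{t\le T}(p_{it}x_{it}+q_{it}y_{it})\le B$ (with $\infty\cdot0=0$), and $\sum_{t\le k}y_{it}\le\sum_{t\le k}x_{it}$ for all $i$ and all $k\le T$. With demand $d$ and $N=\sum_{i}\sum_{t\le T}(x_{it}-y_{it})$ its cost is $c((d-N)^+)+C((N-d)^+)$,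 where $c,C:\mathbb R_+\to\mathbb R_+$ are weakly increasing and convex with $c(0)=C(0)=0$ (for instance linear). The initial range is $[L_0,R_0]$ with $0\le L_0\le R_0$. On day $t$ a nonempty interval $[L_t,R_t]\subseteq[L_{t-1},R_{t-1}]$ with $R_t-L_t\le\Delta_t$ is revealed, where $\Delta_0=R_0-L_0\ge\Delta_1\ge\dots\ge\Delta_T\ge0$ is known; finally $d\in[L_T,R_T]$. A feasible online algorithm may be randomized, decides on day $t$ from the intervals of days $0,\dots,t$, and always outputs a feasible profile. Its cost guarantee is the supremum over interval sequences and demands of its expected cost; $\Gamma^*$ is the infimum of the cost guarantees over all feasible online algorithms. **LP-release.** A configuration is $J\in\mathcal J=\prod_{\ell\le L}\mathcal T_\ell^+$. It encodes the intervals $[L_t(J),R_t(J)]$ with $L_0(J)=L_0$, $R_0(J)=R_0$ and, for $t\in\mathcal T_\ell$, $[R_{t-1}(J)-\Delta_t,R_{t-1}(J)]$ if $t\le J_\ell$ and $[L_{t-1}(J),L_{t-1}(J)+\Delta_t]$ if $t>J_\ell$. Given initial hires $u_i$ (here $u_i=0$), LP-release minimizes $\max_J \max\{c(\theta(J)),C(\lambda(J))\}$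 over nonnegative $x_{it}(J),y_{i\ell}(J),\lambda(J),\theta(J)$ such that * $x_{it}(J)=x_{it}(J')$ whenever $J_{1:\ell-1}=J'_{1:\ell-1}$ and $t\le\min(J_\ell,J'_\ell)$, and $y_{i\ell}(J)=y_{i\ell}(J')$ whenever $J_{1:\ell}=J'_{1:\ell}$; * $\sum_t x_{it}(J)/\rho_{it}\le s_i$, $\sum_i(\sum_tp_{it}x_{it}(J)+\sum_\ell q_\ell y_{i\ell}(J))\le B$ and $\sum_{\ell'\le\ell}y_{i\ell'}(J)\le u_i+\sum_{t\le t_\ell}x_{it}(J)$; * $R_T(J)-\theta(J)\le\sum_i(u_i+\sum_tx_{it}(J)-\sum_\ell y_{i\ell}(J))\le L_T(J)+\lambda(J)$. **LP-release Emulator.** First, each revealed interval is enlarged, online, to an interval of length exactly $\Delta_t$, so that the enlarged intervals are again nested (and are unchanged on day $0$); from here on $[L_t,R_t]$ is the enlarged interval. For $\ell=1,\dots,L$: 1. At the end of day $t_{\ell-1}$ find an optimal solution $(x^*,y^*,\lambda^*,\theta^*)$ of LP-release for the epochs $\ell,\dots,L$ (days after $t_{\ell-1}$, configurations $J=(J_\ell,\dots,J_L)$)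 with $u_i=\sum_{t\le t_{\ell-1}}(x_{it}-y_{it})$, supplies $\rho_{it_{\ell-1}}(s_i-\sum_{t\le t_{\ell-1}}x_{it}/\rho_{it})$, rates $\rho_{it}/\rho_{it_{\ell-1}}$, the remaining budget, and initial interval $[R_{t_{\ell-1}}-\Delta_{t_{\ell-1}},R_{t_{\ell-1}}]$. For $k\in\mathcal T_\ell^+$ let $J^{(k)}$ be a configuration with switching day $k$ in epoch $\ell$; put $\tilde x_{it}=x^*_{it}(J^{(t_\ell)})$ and $\tilde y^{(k)}_i=y^*_{i\ell}(J^{(k)})$. 2. On each day $t\in\mathcal T_\ell$ hire $0\le x_{it}\le\tilde x_{it}$ with $$\sum_ix_{it}=\Big(\sum_{s=t_{\ell-1}+1}^{t}\sum_i\tilde x_{is}-\sum_{s=t_{\ell-1}+1}^{t-1}\sum_ix_{is}-(R_{t_{\ell-1}}-R_t)\Big)^+.$$ 3. On day $t_\ell$ let $k\in\mathcal T^+_\ell$ be the largest day with $R_k-\sum_i\sum_{t=t_{\ell-1}+1}^kx_{it}=R_{t_{\ell-1}}-\sum_i\sum_{t=t_{\ell-1}+1}^k\tilde x_{it}$. Release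 some $0\le y_i\le\tilde y^{(k)}_i$ with $$\sum_i\Big(\sum_{t=t_{\ell-1}+1}^k(\tilde x_{it}-x_{it})-(\tilde y^{(k)}_i-y_i)\Big)=R_{t_{\ell-1}}-\Delta_k+\Delta_{t_\ell}-R_{t_\ell}$$ if such $y$ exists, and nobody otherwise. There are no releases on the other days of the epoch. The choices that the algorithm leaves open are made online and obey the following tie-breaking rule, for each epoch $\ell$ and the critical day $k$ of step 3: (a) $\tilde y^{(k)}_i\le u_i+\sum_{t\in\mathcal T_\ell}x_{it}$ for all $i$; (b) if $\tilde y^{(k)}\ne0$, then $x^*_{it}(J^{(k)})=0$ for all $i$ and $k<t\le t_\ell$. **Theorem.** LP-release has an optimal solution and its value equals $\Gamma^*$. The LP-release Emulator can be implemented, and every implementation of it is a feasible online algorithm with cost guarantee $\Gamma^*$, that is, it is minimax optimal. -/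

import Mathlib

open Set MeasureTheory
open scoped ENNReal NNReal

universe u

noncomputable section

/-- An instance of the costly hiring and releasing environment: `n` pools, hiring days
`1, …, T`, and `L` epochs, epoch `j < L` consisting of the days `τ j + 1, …, τ (j + 1)`. -/
structure StaffingInstance where
  n : ℕ
  T : ℕ
  L : ℕ
  /-- initial pool sizes -/
  supply : Fin n → ℝ
  /-- fraction of the available workers of pool `i` that becomes unavailable on day `t` -/
  α : Fin n → ℕ → ℝ
  /-- per-worker wages -/
  wage : Fin n → ℕ → ℝ
  /-- per-worker releasing fees, possibly infinite -/
  fee : Fin n → ℕ → ℝ≥0∞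
  /-- total budget -/
  B : ℝ≥0
  /-- initial demand range `[L₀, R₀]` -/
  L₀ : ℝ
  R₀ : ℝ
  /-- prediction error upper bounds, with the dummy value `Δ 0 = R₀ - L₀` -/
  Δ : ℕ → ℝ
  /-- last days of the epochs -/
  τ : ℕ → ℕ
  /-- understaffing cost function -/
  c : ℝ → ℝ
  /-- overstaffing cost function -/
  C : ℝ → ℝ
  supply_nonneg : ∀ i, 0 ≤ supply i
  α_nonneg : ∀ i t, 0 ≤ α i t
  α_lt_one : ∀ i t, α i t < 1
  wage_nonneg : ∀ i t, 0 ≤ wage i t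
  L₀_nonneg : 0 ≤ L₀
  L₀_le_R₀ : L₀ ≤ R₀
  Δ_zero : Δ 0 = R₀ - L₀
  Δ_nonneg : ∀ t ≤ T, 0 ≤ Δ t
  Δ_succ_le : ∀ t < T, Δ (t + 1) ≤ Δ t
  one_le_L : 1 ≤ L
  τ_zero : τ 0 = 0
  τ_lt : ∀ j < L, τ j < τ (j + 1)
  τ_last : τ L = T
  /-- inside an epoch the releasing fee depends neither on the day nor on the pool -/
  fee_const : ∀ j < L, ∀ t ∈ Ioc (τ j) (τ (j + 1)), ∀ t' ∈ Ioc (τ j) (τ (j + 1)),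
    ∀ i i', fee i t = fee i' t'
  c_zero : c 0 = 0
  C_zero : C 0 = 0
  c_mono : MonotoneOn c (Ici 0)
  C_mono : MonotoneOn C (Ici 0)
  c_convex : ConvexOn ℝ (Ici 0) c
  C_convex : ConvexOn ℝ (Ici 0) C

/-- A sequence of intervals `[lo t, hi t]`; day `0` carries the initial demand range. -/
@[ext]
structure Prediction where
  lo : ℕ → ℝ
  hi : ℕ → ℝ

/-- Two sequences coincide on the days `0, …, t`. -/
def Prediction.AgreeUpTo (t : ℕ) (P P' : Prediction) : Prop :=
  ∀ s ≤ t, P.lo s = P'.lo s ∧ P.hi s = P'.hi s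

/-- A staffing profile: `x i t` workers of pool `i` are hired and `y i t` are released on
day `t`. -/
@[ext]
structure Profile (n : ℕ) where
  x : Fin n → ℕ → ℝ
  y : Fin n → ℕ → ℝ

/-- The state of the system at the end of an epoch. -/
structure StaffingState (n : ℕ) where
  /-- workers hired and not released -/
  hired : Fin n → ℝ
  /-- workers that are still available for hiring -/
  supply : Fin n → ℝ
  /-- remaining budget -/
  budget : ℝ≥0∞
  /-- endpoints of the current prediction interval -/
  lo : ℝ
  hi : ℝ

namespace StaffingInstance

variable (I : StaffingInstance)

/-- Availability rates: the fraction of pool `i` that is available throughout days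
`1, …, t`. -/
def ρ (i : Fin I.n) (t : ℕ) : ℝ := ∏ s ∈ Finset.Icc 1 t, (1 - I.α i s)

/-! ### The online problem -/

/-- Nested nonempty prediction intervals within the initial demand range, of length at most
`Δ t` on day `t`. -/
structure IsPrediction (P : Prediction) : Prop where
  lo_zero : P.lo 0 = I.L₀
  hi_zero : P.hi 0 = I.R₀
  lo_mono : ∀ t < I.T, P.lo t ≤ P.lo (t + 1)
  hi_anti : ∀ t < I.T, P.hi (t + 1) ≤ P.hi t
  lo_le_hi : ∀ t ≤ I.T, P.lo t ≤ P.hi t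
  error : ∀ t ≤ I.T, P.hi t - P.lo t ≤ I.Δ t

/-- Money spent on the days `1, …, t` (with `∞ * 0 = 0`). -/
def spent (a : Profile I.n) (t : ℕ) : ℝ≥0∞ :=
  ∑ i, ∑ s ∈ Finset.Icc 1 t,
    (ENNReal.ofReal (I.wage i s * a.x i s) + I.fee i s * ENNReal.ofReal (a.y i s))

/-- Workers of pool `i` hired and not released on the days `1, …, t`. -/
def net (a : Profile I.n) (i : Fin I.n) (t : ℕ) : ℝ :=
  ∑ s ∈ Finset.Icc 1 t, (a.x i s - a.y i s)

/-- Feasible staffing profiles. -/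
structure IsFeasible (a : Profile I.n) : Prop where
  x_nonneg : ∀ i, ∀ t ∈ Icc 1 I.T, 0 ≤ a.x i t
  y_nonneg : ∀ i, ∀ t ∈ Icc 1 I.T, 0 ≤ a.y i t
  supply : ∀ i, ∑ t ∈ Finset.Icc 1 I.T, 1 / I.ρ i t * a.x i t ≤ I.supply i
  budget : I.spent a I.T ≤ I.B
  release : ∀ i, ∀ k ∈ Icc 1 I.T,
    ∑ t ∈ Finset.Icc 1 k, a.y i t ≤ ∑ t ∈ Finset.Icc 1 k, a.x i t

/-- The staffing cost of a profile when the demand is `d`. -/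
def cost (a : Profile I.n) (d : ℝ) : ℝ :=
  I.c (max 0 (d - ∑ i, I.net a i I.T)) + I.C (max 0 ((∑ i, I.net a i I.T) - d))

/-- `A` is a feasible, possibly randomized, online algorithm: the decisions of day `t` depend
only on the random seed and on the predictions revealed up to day `t`, and the resulting
profile is feasible for every prediction sequence and every seed. -/
structure IsOnlineAlgorithm {Ω : Type u} [MeasurableSpace Ω]
    (A : Ω → Prediction → Profile I.n) : Prop where
  measurable_x : ∀ P, I.IsPrediction P → ∀ i, ∀ t ∈ Icc 1 I.T,
    Measurable fun ω => (A ω P).x i t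
  measurable_y : ∀ P, I.IsPrediction P → ∀ i, ∀ t ∈ Icc 1 I.T,
    Measurable fun ω => (A ω P).y i t
  online : ∀ ω P P', I.IsPrediction P → I.IsPrediction P' → ∀ t ∈ Icc 1 I.T,
    P.AgreeUpTo t P' → ∀ i, (A ω P).x i t = (A ω P').x i t ∧ (A ω P).y i t = (A ω P').y i t
  feasible : ∀ ω P, I.IsPrediction P → I.IsFeasible (A ω P)

/-- The cost guarantee: expected staffing cost against worst-case predictions and demand. -/
def costGuarantee {Ω : Type u} [MeasurableSpace Ω] (μ : Measure Ω)
    (A : Ω → Prediction → Profile I.n) : ℝ≥0∞ :=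
  ⨆ (P : Prediction) (_ : I.IsPrediction P) (d : ℝ) (_ : d ∈ Icc (P.lo I.T) (P.hi I.T)),
    ∫⁻ ω, ENNReal.ofReal (I.cost (A ω P) d) ∂μ

/-- The optimal minimax cost `Γ*` over all feasible, possibly randomized, online
algorithms. -/
def minimaxCost : ℝ≥0∞ :=
  ⨅ (Ω : Type u) (_ : MeasurableSpace Ω) (μ : Measure Ω) (_ : IsProbabilityMeasure μ)
    (A : Ω → Prediction → Profile I.n) (_ : I.IsOnlineAlgorithm A), I.costGuarantee μ A

/-! ### The configuration linear program, started at the end of day `τ m` -/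

/-- Configurations for the epochs `m, …, L - 1`: one switching day in `[τ j, τ (j + 1)]` for
each epoch `j`. -/
abbrev Config (m : ℕ) : Type :=
  (j : Ico m I.L) → Icc (I.τ j) (I.τ (j + 1))

/-- Day `t` lies in an epoch `j`, not after the switching day of that epoch. -/
def BeforeSwitch {m : ℕ} (J : I.Config m) (t : ℕ) : Prop :=
  ∃ j : Ico m I.L, I.τ j < t ∧ t ≤ J j

open Classical in
/-- The interval `(lo, hi)` of day `t` in the multi-switch prediction sequence of the
configuration `J`, started from the interval of the state `S` on day `τ m`. -/
def configInterval {m : ℕ} (S : StaffingState I.n) (J : I.Config m) : ℕ → ℝ × ℝ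
  | 0 => (S.lo, S.hi)
  | t + 1 =>
    if t + 1 ≤ I.τ m then (S.lo, S.hi)
    else if I.BeforeSwitch J (t + 1) then
      ((configInterval S J t).2 - I.Δ (t + 1), (configInterval S J t).2)
    else
      ((configInterval S J t).1, (configInterval S J t).1 + I.Δ (t + 1))

/-- The variables of the linear program: hires `x J i t` on the days `t ∈ (τ m, T]`, releases
`y J i j` in the epochs `j ∈ [m, L)`, overstaffing `lam J` and understaffing `θ J`. -/
structure LPVars (m : ℕ) where
  x : I.Config m → Fin I.n → ℕ → ℝ
  y : I.Config m → Fin I.n → ℕ → ℝ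
  lam : I.Config m → ℝ
  θ : I.Config m → ℝ

variable {I}

/-- The final number of hired workers under the configuration `J`. -/
def LPVars.final {m : ℕ} (S : StaffingState I.n) (z : I.LPVars m) (J : I.Config m) : ℝ :=
  ∑ i, (S.hired i + ∑ t ∈ Finset.Ioc (I.τ m) I.T, z.x J i t
    - ∑ j ∈ Finset.Ico m I.L, z.y J i j)

/-- The constraints of the linear program with initial state `S`. -/
structure LPVars.IsFeasible {m : ℕ} (S : StaffingState I.n) (z : I.LPVars m) : Prop where
  x_nonneg : ∀ J i, ∀ t ∈ Ioc (I.τ m) I.T, 0 ≤ z.x J i t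
  y_nonneg : ∀ J i, ∀ j ∈ Ico m I.L, 0 ≤ z.y J i j
  lam_nonneg : ∀ J, 0 ≤ z.lam J
  θ_nonneg : ∀ J, 0 ≤ z.θ J
  x_identical : ∀ (ℓ : Ico m I.L) (J J' : I.Config m),
    (∀ j : Ico m I.L, (j : ℕ) < ℓ → J j = J' j) →
    ∀ i, ∀ t ∈ Ioc (I.τ m) (min (J ℓ : ℕ) (J' ℓ)), z.x J i t = z.x J' i t
  y_identical : ∀ (ℓ : Ico m I.L) (J J' : I.Config m),
    (∀ j : Ico m I.L, (j : ℕ) ≤ ℓ → J j = J' j) → ∀ i, z.y J i ℓ = z.y J' i ℓ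
  supply : ∀ J i, ∑ t ∈ Finset.Ioc (I.τ m) I.T, 1 / (I.ρ i t / I.ρ i (I.τ m)) * z.x J i t
    ≤ S.supply i
  budget : ∀ J, ∑ i, (∑ t ∈ Finset.Ioc (I.τ m) I.T, ENNReal.ofReal (I.wage i t * z.x J i t)
    + ∑ j ∈ Finset.Ico m I.L, I.fee i (I.τ (j + 1)) * ENNReal.ofReal (z.y J i j)) ≤ S.budget
  release : ∀ J i, ∀ ℓ ∈ Ico m I.L, ∑ j ∈ Finset.Icc m ℓ, z.y J i j
    ≤ S.hired i + ∑ t ∈ Finset.Ioc (I.τ m) (I.τ (ℓ + 1)), z.x J i t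
  overstaffing : ∀ J, z.final S J ≤ (I.configInterval S J I.T).1 + z.lam J
  understaffing : ∀ J, (I.configInterval S J I.T).2 - z.θ J ≤ z.final S J

/-- The objective (a maximum over the finitely many configurations). -/
def LPVars.objective {m : ℕ} (z : I.LPVars m) : ℝ :=
  ⨆ J : I.Config m, max (I.c (z.θ J)) (I.C (z.lam J))

/-- Optimal solutions of the linear program with initial state `S`. -/
def LPVars.IsOptimal {m : ℕ} (S : StaffingState I.n) (z : I.LPVars m) : Prop :=
  z.IsFeasible S ∧ ∀ z' : I.LPVars m, z'.IsFeasible S → z.objective ≤ z'.objective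

variable (I)

/-- The state before day `1`. -/
def initialState : StaffingState I.n where
  hired := fun _ => 0
  supply := I.supply
  budget := I.B
  lo := I.L₀
  hi := I.R₀

/-- The value of the configuration linear program for the whole horizon. -/
def lpValue : ℝ :=
  sInf {v : ℝ | ∃ z : I.LPVars 0, z.IsFeasible I.initialState ∧ z.objective = v}

/-! ### The emulator -/

/-- The state at the end of day `τ m`, after the decisions `a` under the predictions `P`. -/
def stateAt (P : Prediction) (a : Profile I.n) (m : ℕ) : StaffingState I.n where
  hired := fun i => I.net a i (I.τ m)
  supply := fun i => I.ρ i (I.τ m) *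
    (I.supply i - ∑ t ∈ Finset.Icc 1 (I.τ m), 1 / I.ρ i t * a.x i t)
  budget := I.B - I.spent a (I.τ m)
  lo := P.hi (I.τ m) - I.Δ (I.τ m)
  hi := P.hi (I.τ m)

open Classical in
/-- A configuration for the epochs `m, …, L - 1` with switching day `k` in epoch `m`. -/
def switchAt (m : ℕ) (k : Icc (I.τ m) (I.τ (m + 1))) : I.Config m := fun j =>
  if h : (j : ℕ) = m then ⟨k, by rw [h]; exact k.2⟩
  else ⟨I.τ j, le_rfl, (I.τ_lt j j.2.2).le⟩

variable {I}

/-- The canonical hires of epoch `m`: those of the configurations that switch on the last day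
of the epoch. -/
def LPVars.canonicalHire {m : ℕ} (z : I.LPVars m) (hm : m < I.L) : Fin I.n → ℕ → ℝ :=
  z.x (I.switchAt m ⟨I.τ (m + 1), (I.τ_lt m hm).le, le_rfl⟩)

/-- The canonical releases of epoch `m` for the switching day `k`. -/
def LPVars.canonicalRelease {m : ℕ} (z : I.LPVars m) (k : Icc (I.τ m) (I.τ (m + 1)))
    (i : Fin I.n) : ℝ :=
  z.y (I.switchAt m k) i m

/-- The emulator oracle in epoch `m`, with canonical hires `xt`: on each day `t` of the epoch
the hires are at most the canonical ones and have the prescribed sum. -/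
def FollowsOracle (P : Prediction) (a : Profile I.n) (m : ℕ) (xt : Fin I.n → ℕ → ℝ) : Prop :=
  ∀ t ∈ Ioc (I.τ m) (I.τ (m + 1)),
    (∀ i, 0 ≤ a.x i t ∧ a.x i t ≤ xt i t) ∧
    ∑ i, a.x i t = max 0 (∑ s ∈ Finset.Ioc (I.τ m) t, ∑ i, xt i s
      - ∑ s ∈ Finset.Ioo (I.τ m) t, ∑ i, a.x i s - (P.hi (I.τ m) - P.hi t))

/-- `k` is the critical day of epoch `m`. -/
def IsCritical (P : Prediction) (a : Profile I.n) (m : ℕ) (xt : Fin I.n → ℕ → ℝ)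
    (k : Icc (I.τ m) (I.τ (m + 1))) : Prop :=
  IsGreatest {k : Icc (I.τ m) (I.τ (m + 1)) |
    P.hi k - ∑ i, ∑ t ∈ Finset.Ioc (I.τ m) k, a.x i t
      = P.hi (I.τ m) - ∑ i, ∑ t ∈ Finset.Ioc (I.τ m) k, xt i t} k

/-- The condition on the releases `w` at the end of epoch `m`, with canonical hires `xt`,
critical day `k` and canonical releases `yt` for the switching day `k`. -/
def ReleaseCondition (P : Prediction) (a : Profile I.n) (m : ℕ) (xt : Fin I.n → ℕ → ℝ)
    (k : Icc (I.τ m) (I.τ (m + 1))) (yt : Fin I.n → ℝ) (w : Fin I.n → ℝ) : Prop :=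
  (∀ i, 0 ≤ w i ∧ w i ≤ yt i) ∧
  ∑ i, (∑ t ∈ Finset.Ioc (I.τ m) k, (xt i t - a.x i t) - (yt i - w i))
    = (P.hi (I.τ m) - I.Δ k + I.Δ (I.τ (m + 1))) - P.hi (I.τ (m + 1))

variable (I)

/-- An implementation of the emulator, that is, an online way of making all the choices that
the algorithm leaves open. The fields `no_waste` and `implementable` are the tie-breaking
rule. -/
structure Emulator where
  /-- intervals shorter than `Δ t` are enlarged to length `Δ t` -/
  pad : Prediction → Prediction
  /-- the optimal solution selected at the beginning of epoch `m` -/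
  sol : Prediction → (m : ℕ) → I.LPVars m
  /-- the staffing decisions -/
  act : Prediction → Profile I.n
  pad_isPrediction : ∀ P, I.IsPrediction P → I.IsPrediction (pad P)
  pad_length : ∀ P, I.IsPrediction P → ∀ t ≤ I.T, (pad P).hi t - (pad P).lo t = I.Δ t
  pad_contains : ∀ P, I.IsPrediction P → ∀ t ≤ I.T,
    Icc (P.lo t) (P.hi t) ⊆ Icc ((pad P).lo t) ((pad P).hi t)
  pad_online : ∀ P P', I.IsPrediction P → I.IsPrediction P' → ∀ t ≤ I.T,
    P.AgreeUpTo t P' → (pad P).AgreeUpTo t (pad P')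
  sol_online : ∀ P P', I.IsPrediction P → I.IsPrediction P' → ∀ m < I.L,
    P.AgreeUpTo (I.τ m) P' → sol P m = sol P' m
  act_online : ∀ P P', I.IsPrediction P → I.IsPrediction P' → ∀ t ∈ Icc 1 I.T,
    P.AgreeUpTo t P' →
    ∀ i, (act P).x i t = (act P').x i t ∧ (act P).y i t = (act P').y i t
  /-- at the beginning of each epoch the linear program is solved for the current state -/
  resolve : ∀ P, I.IsPrediction P → ∀ m < I.L,
    (sol P m).IsOptimal (I.stateAt (pad P) (act P) m)
  /-- hires follow the emulator oracle -/
  hire : ∀ P, I.IsPrediction P → ∀ m, ∀ hm : m < I.L,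
    FollowsOracle (pad P) (act P) m ((sol P m).canonicalHire hm)
  /-- nobody is released before the last day of an epoch -/
  no_release : ∀ P, I.IsPrediction P → ∀ m < I.L, ∀ t ∈ Ioo (I.τ m) (I.τ (m + 1)),
    ∀ i, (act P).y i t = 0
  /-- releases on the last day of an epoch -/
  release : ∀ P, I.IsPrediction P → ∀ m, ∀ hm : m < I.L, ∀ k,
    IsCritical (pad P) (act P) m ((sol P m).canonicalHire hm) k →
    ReleaseCondition (pad P) (act P) m ((sol P m).canonicalHire hm) k
        ((sol P m).canonicalRelease k) (fun i => (act P).y i (I.τ (m + 1))) ∨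
      (∀ i, (act P).y i (I.τ (m + 1)) = 0) ∧
        ¬ ∃ w, ReleaseCondition (pad P) (act P) m ((sol P m).canonicalHire hm) k
          ((sol P m).canonicalRelease k) w
  /-- if the selected plan for the critical day `k` releases workers in the epoch, then it does
  not hire in the same epoch after day `k` -/
  no_waste : ∀ P, I.IsPrediction P → ∀ m, ∀ hm : m < I.L, ∀ k,
    IsCritical (pad P) (act P) m ((sol P m).canonicalHire hm) k →
    (∃ i, (sol P m).canonicalRelease k i ≠ 0) →
    ∀ i, ∀ t ∈ Ioc (k : ℕ) (I.τ (m + 1)), (sol P m).x (I.switchAt m k) i t = 0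
  /-- the canonical releases for the critical day do not exceed the workers that have been
  hired and not released so far -/
  implementable : ∀ P, I.IsPrediction P → ∀ m, ∀ hm : m < I.L, ∀ k,
    IsCritical (pad P) (act P) m ((sol P m).canonicalHire hm) k →
    ∀ i, (sol P m).canonicalRelease k i
      ≤ I.net (act P) i (I.τ m)
        + ∑ t ∈ Finset.Ioc (I.τ m) (I.τ (m + 1)), (act P).x i t

end StaffingInstance

end

namespace StaffingInstance

variable {I : StaffingInstance}

/-! ### Epochs, rates and fees -/

/-! Both bounds pass through the linear program.

Lower bound. Run a randomized algorithm on the interval sequence of every configuration.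
Configurations that are indistinguishable up to day `t` (`Indist`) show the same intervals up to
`t`, so expected hires and expected epoch totals of releases satisfy the nonanticipativity
constraints. The remaining constraints are linear and survive averaging (`meanVars_isFeasible`).
Taking the demand to be the last upper or lower endpoint, Jensen's inequality bounds the cost of the
averaged solution by the cost guarantee (`lpValue_le_costGuarantee`).

Upper bound. The invariant is that at the end of every epoch the program of the current state has a
solution of value at most `lpValue`; with no epoch left it bounds the actual cost. Staffing errors
depend only on the gap `g` between the upper endpoint and the number of workers, because a
configuration prescribes how much the upper endpoint drops from its current value. Inside an epoch
the oracle cancels planned hires as the upper endpoint falls. On the critical day `k` the cancelled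
hires equal the fall so far, and nobody is hired afterwards. Hence the actual gap at the end of the
epoch can be compared with the gap of the planned branch that switches on day `k`. If the release
rule brings the two together, the tail of that branch is reused. Otherwise nobody is released, and
the actual gap lies between those of the branch `k` and of the branch that switches on the last day.
The two tails start from different gaps but fit the same remaining supply and budget, and their
convex combination has exactly the actual gap; convexity of the costs keeps its value bounded
(`EpochRun.exists_next`).

Such a tail need not be a solution of the program: the pools hold other numbers of workers than
planned, and the total may even become negative. This is why the argument runs on aggregated plans
(`Plan`). Fees are equal across pools within an epoch, so only total releases matter for money. A
plan is repaired by keeping the total, after the first switching day, above a nonnegative level not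
exceeding the final lower endpoint, which creates no overstaffing (`Plan.IsFeasible.repair`).
Releases are then distributed over the pools in proportion to available workers
(`Plan.IsFeasible.exists_distribution`). The same repair yields the tie-breaking rule
(`Plan.IsFeasible.exists_tieBroken`), hence an implementation. -/

lemma τ_mono {a b : ℕ} (hab : a ≤ b) (hb : b ≤ I.L) : I.τ a ≤ I.τ b := by
  induction b, hab using Nat.le_induction with
  | base => exact le_rfl
  | succ k hk ih => exact (ih (by omega)).trans (I.τ_lt k (by omega)).le

lemma τ_le_T {j : ℕ} (hj : j ≤ I.L) : I.τ j ≤ I.T := I.τ_last ▸ τ_mono hj le_rfl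

lemma exists_epoch {m t : ℕ} (hm : m ≤ I.L) (ht : t ∈ Ioc (I.τ m) I.T) :
    ∃ j ∈ Ico m I.L, t ∈ Ioc (I.τ j) (I.τ (j + 1)) := by
  rw [← I.τ_last] at ht
  have key : ∀ b, m ≤ b → b ≤ I.L → t ≤ I.τ b →
      ∃ j ∈ Ico m I.L, t ∈ Ioc (I.τ j) (I.τ (j + 1)) := by
    intro b hb
    induction b, hb using Nat.le_induction with
    | base => intro _ h; exact absurd ht.1 (not_lt.2 h)
    | succ k hk ih =>
      intro hkL h
      rcases le_or_gt t (I.τ k) with h' | h'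
      · exact ih (by omega) h'
      · exact ⟨k, ⟨hk, by omega⟩, h', h⟩
  exact key _ hm le_rfl ht.2

lemma epoch_unique {i j t : ℕ} (hi : i < I.L) (hj : j < I.L)
    (h : t ∈ Ioc (I.τ i) (I.τ (i + 1))) (h' : t ∈ Ioc (I.τ j) (I.τ (j + 1))) : i = j := by
  rcases lt_trichotomy i j with hij | hij | hij
  · have := τ_mono (I := I) (show i + 1 ≤ j by omega) hj.le
    exact absurd (h.2.trans this) (not_le.2 h'.1)
  · exact hij
  · have := τ_mono (I := I) (show j + 1 ≤ i by omega) hi.le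
    exact absurd (h'.2.trans this) (not_le.2 h.1)

lemma Δ_anti {s t : ℕ} (hst : s ≤ t) (ht : t ≤ I.T) : I.Δ t ≤ I.Δ s := by
  induction t, hst using Nat.le_induction with
  | base => exact le_rfl
  | succ k hk ih => exact (I.Δ_succ_le k (by omega)).trans (ih (by omega))

lemma ρ_pos (i : Fin I.n) (t : ℕ) : 0 < I.ρ i t :=
  Finset.prod_pos fun s _ => by linarith [I.α_lt_one i s]

/-- The fee of epoch `j`, common to all pools and days of the epoch. -/
noncomputable def epochFee (I : StaffingInstance) (j : ℕ) : ℝ≥0∞ := ⨆ i, I.fee i (I.τ (j + 1))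

lemma fee_eq {j t : ℕ} (hj : j < I.L) (ht : t ∈ Ioc (I.τ j) (I.τ (j + 1))) (i : Fin I.n) :
    I.fee i t = I.epochFee j := by
  have h1 : I.τ (j + 1) ∈ Ioc (I.τ j) (I.τ (j + 1)) := ⟨I.τ_lt j hj, le_rfl⟩
  apply le_antisymm
  · rw [I.fee_const j hj t ht _ h1 i i]
    exact le_iSup (fun i => I.fee i (I.τ (j + 1))) i
  · exact iSup_le fun i' => (I.fee_const j hj _ h1 t ht i' i).le

lemma fee_last {j : ℕ} (hj : j < I.L) (i : Fin I.n) : I.fee i (I.τ (j + 1)) = I.epochFee j :=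
  fee_eq hj ⟨I.τ_lt j hj, le_rfl⟩ i

/-! ### Configurations -/

/-- The switching day of `J` in epoch `j`. -/
def Config.day {m : ℕ} (J : I.Config m) (j : ℕ) : ℕ :=
  if h : j ∈ Ico m I.L then J ⟨j, h⟩ else 0

lemma Config.day_eq {m j : ℕ} (J : I.Config m) (h : j ∈ Ico m I.L) :
    Config.day J j = J ⟨j, h⟩ := dif_pos h

lemma Config.le_day {m j : ℕ} (J : I.Config m) (h : j ∈ Ico m I.L) : I.τ j ≤ Config.day J j := by
  rw [Config.day_eq J h]; exact (J ⟨j, h⟩).2.1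

lemma Config.day_le {m j : ℕ} (J : I.Config m) (h : j ∈ Ico m I.L) :
    Config.day J j ≤ I.τ (j + 1) := by
  rw [Config.day_eq J h]; exact (J ⟨j, h⟩).2.2

lemma Config.ext_day {m : ℕ} {J J' : I.Config m}
    (h : ∀ j ∈ Ico m I.L, Config.day J j = Config.day J' j) : J = J' := by
  funext j
  apply Subtype.ext
  have := h j j.2
  rwa [Config.day_eq J j.2, Config.day_eq J' j.2] at this

/-- Two configurations cannot be told apart by the intervals of the days up to `t`. -/
def Indist {m : ℕ} (t : ℕ) (J J' : I.Config m) : Prop :=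
  ∀ j ∈ Ico m I.L, min (Config.day J j) t = min (Config.day J' j) t

lemma Indist.mono {m s t : ℕ} {J J' : I.Config m} (h : Indist t J J') (hst : s ≤ t) :
    Indist s J J' := by
  intro j hj
  have := h j hj
  omega

/-- Configurations with the same switching day `k` in epoch `m` are alike in epoch `m`. -/
lemma indist_of_day_eq {m : ℕ} {J J' : I.Config m}
    (h : Config.day J m = Config.day J' m) : Indist (I.τ (m + 1)) J J' := by
  intro j hj
  rcases eq_or_lt_of_le hj.1 with rfl | hlt
  · rw [h]
  · have h1 := Config.le_day J hj
    have h2 := Config.le_day J' hj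
    have h3 := τ_mono (I := I) (show m + 1 ≤ j by omega) hj.2.le
    rw [min_eq_right (h3.trans h1), min_eq_right (h3.trans h2)]

/-- Before both switching days of the first epoch, configurations are alike. -/
lemma indist_of_le_day {m t : ℕ} {J J' : I.Config m} (hm : m < I.L)
    (h : t ≤ Config.day J m) (h' : t ≤ Config.day J' m) : Indist t J J' := by
  intro j hj
  rcases eq_or_lt_of_le hj.1 with rfl | hlt
  · rw [min_eq_right h, min_eq_right h']
  · have h0 : m ∈ Ico m I.L := ⟨le_rfl, hm⟩
    have h1 := Config.le_day J hj
    have h2 := Config.le_day J' hj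
    have h3 := τ_mono (I := I) (show m + 1 ≤ j by omega) hj.2.le
    have h4 := Config.day_le J h0
    rw [min_eq_right (by omega), min_eq_right (by omega)]

open Classical in
/-- Prepend the switching day `k` of epoch `m` to a configuration for the later epochs. -/
noncomputable def Config.cons {m : ℕ} (k : Icc (I.τ m) (I.τ (m + 1))) (J : I.Config (m + 1)) :
    I.Config m :=
  fun j => if h : (j : ℕ) = m then ⟨k, by rw [h]; exact k.2⟩
    else J ⟨j, by have := j.2.1; exact lt_of_le_of_ne this (Ne.symm h), j.2.2⟩

lemma Config.day_cons_self {m : ℕ} (hm : m < I.L) (k : Icc (I.τ m) (I.τ (m + 1)))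
    (J : I.Config (m + 1)) : Config.day (Config.cons k J) m = k := by
  rw [Config.day_eq _ ⟨le_rfl, hm⟩]; simp [Config.cons]

lemma Config.day_cons {m j : ℕ} (k : Icc (I.τ m) (I.τ (m + 1)))
    (J : I.Config (m + 1)) (hj : j ∈ Ico (m + 1) I.L) :
    Config.day (Config.cons k J) j = Config.day J j := by
  have h : j ≠ m := by have := hj.1; omega
  rw [Config.day_eq _ hj, Config.day_eq _ ⟨by have := hj.1; omega, hj.2⟩]
  simp [Config.cons, h]

lemma Config.day_switchAt {m : ℕ} (hm : m < I.L) (k : Icc (I.τ m) (I.τ (m + 1))) :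
    Config.day (I.switchAt m k) m = k := by
  rw [Config.day_eq _ ⟨le_rfl, hm⟩]; simp [switchAt]

lemma Indist.cons {m t : ℕ} (k : Icc (I.τ m) (I.τ (m + 1))) {J J' : I.Config (m + 1)}
    (h : Indist t J J') : Indist t (Config.cons k J) (Config.cons k J') := by
  intro j hj
  rcases eq_or_lt_of_le hj.1 with rfl | hlt
  · rw [Config.day_cons_self hj.2, Config.day_cons_self hj.2]
  · rw [Config.day_cons k J ⟨hlt, hj.2⟩, Config.day_cons k J' ⟨hlt, hj.2⟩]
    exact h j ⟨hlt, hj.2⟩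

/-! ### The intervals of a configuration -/

lemma configInterval_of_le {m t : ℕ} (S : StaffingState I.n) (J : I.Config m) (ht : t ≤ I.τ m) :
    I.configInterval S J t = (S.lo, S.hi) := by
  cases t with
  | zero => rfl
  | succ t => simp [configInterval, ht]

lemma configInterval_fst {m t : ℕ} {S : StaffingState I.n} (J : I.Config m)
    (hS : S.lo = S.hi - I.Δ (I.τ m)) (ht : I.τ m ≤ t) :
    (I.configInterval S J t).1 = (I.configInterval S J t).2 - I.Δ t := by
  induction t, ht using Nat.le_induction with
  | base => rw [configInterval_of_le S J le_rfl, hS]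
  | succ t ht ih =>
    rw [configInterval, if_neg (by omega)]
    split_ifs <;> simp

lemma beforeSwitch_iff {m j t : ℕ} (J : I.Config m) (hj : j ∈ Ico m I.L)
    (ht : t ∈ Ioc (I.τ j) (I.τ (j + 1))) : I.BeforeSwitch J t ↔ t ≤ Config.day J j := by
  rw [Config.day_eq J hj]
  constructor
  · rintro ⟨j', h1, h2⟩
    have := epoch_unique (I := I) j'.2.2 hj.2 ⟨h1, h2.trans (J j').2.2⟩ ht
    subst this
    exact h2
  · intro h
    exact ⟨⟨j, hj⟩, ht.1, h⟩

/-- Up to the switching day only the lower endpoint moves. Afterwards the lower endpoint is frozen,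
and the upper endpoint follows the shrinking length. -/
lemma configInterval_epoch {m j t : ℕ} {S : StaffingState I.n} (J : I.Config m)
    (hS : S.lo = S.hi - I.Δ (I.τ m)) (hj : j ∈ Ico m I.L)
    (ht : I.τ j ≤ t) (ht' : t ≤ I.τ (j + 1)) :
    (I.configInterval S J t).2 =
      (I.configInterval S J (I.τ j)).2 - (I.Δ (min (Config.day J j) t) - I.Δ t) := by
  have hmj := τ_mono (I := I) hj.1 hj.2.le
  induction t, ht using Nat.le_induction with
  | base => rw [min_eq_right (Config.le_day J hj)]; ring
  | succ t ht ih =>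
    have ih := ih (by omega)
    have h1 := beforeSwitch_iff J hj (t := t + 1) ⟨by omega, ht'⟩
    rw [configInterval, if_neg (by omega)]
    by_cases h : t + 1 ≤ Config.day J j
    · rw [if_pos (h1.2 h)]
      rw [min_eq_right h]
      rw [min_eq_right (by omega)] at ih
      simp only; linarith
    · rw [if_neg (fun h' => h (h1.1 h'))]
      rw [min_eq_left (by omega)] at ih ⊢
      simp only
      rw [configInterval_fst J hS (by omega), ih]; ring

/-- Total decrease of the upper endpoint in the epochs `m, …, ℓ - 1`. -/
noncomputable def drop {m : ℕ} (J : I.Config m) (ℓ : ℕ) : ℝ :=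
  ∑ j ∈ Finset.Ico m ℓ, (I.Δ (Config.day J j) - I.Δ (I.τ (j + 1)))

lemma configInterval_snd_τ {m ℓ : ℕ} {S : StaffingState I.n} (J : I.Config m)
    (hS : S.lo = S.hi - I.Δ (I.τ m)) (hm : m ≤ ℓ) (hℓ : ℓ ≤ I.L) :
    (I.configInterval S J (I.τ ℓ)).2 = S.hi - drop J ℓ := by
  induction ℓ, hm using Nat.le_induction with
  | base => simp [drop, configInterval_of_le]
  | succ j hj ih =>
    have hj' : j ∈ Ico m I.L := ⟨hj, by omega⟩
    rw [configInterval_epoch J hS hj' (I.τ_lt j hj'.2).le le_rfl, ih (by omega),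
      min_eq_left (Config.day_le J hj'), drop, drop, Finset.sum_Ico_succ_top hj]
    ring

lemma configInterval_snd_T {m : ℕ} {S : StaffingState I.n} (J : I.Config m) (hm : m ≤ I.L)
    (hS : S.lo = S.hi - I.Δ (I.τ m)) :
    (I.configInterval S J I.T).2 = S.hi - drop J I.L := by
  have := configInterval_snd_τ J hS hm le_rfl
  rwa [I.τ_last] at this

lemma configInterval_fst_T {m : ℕ} {S : StaffingState I.n} (J : I.Config m) (hm : m ≤ I.L)
    (hS : S.lo = S.hi - I.Δ (I.τ m)) :
    (I.configInterval S J I.T).1 = S.hi - drop J I.L - I.Δ I.T := by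
  rw [configInterval_fst J hS (τ_le_T hm), configInterval_snd_T J hm hS]

lemma drop_cons {m : ℕ} (hm : m < I.L) (k : Icc (I.τ m) (I.τ (m + 1))) (J : I.Config (m + 1)) :
    drop (Config.cons k J) I.L = (I.Δ k - I.Δ (I.τ (m + 1))) + drop J I.L := by
  rw [drop, drop, Finset.sum_eq_sum_Ico_succ_bot hm, Config.day_cons_self hm]
  congr 1
  refine Finset.sum_congr rfl fun j hj => ?_
  rw [Config.day_cons k J (by simpa using hj)]

/-- The lower endpoint does not decrease after the first switching day. -/
lemma drop_add_le {m : ℕ} (hm : m < I.L) (J : I.Config m) :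
    drop J I.L + I.Δ I.T ≤ I.Δ (Config.day J m) := by
  have key : ∀ ℓ, m + 1 ≤ ℓ → ℓ ≤ I.L → drop J ℓ + I.Δ (I.τ ℓ) ≤ I.Δ (Config.day J m) := by
    intro ℓ h
    induction ℓ, h using Nat.le_induction with
    | base => intro _; simp [drop]
    | succ j hj ih =>
      intro hjL
      have hj' : j ∈ Ico m I.L := ⟨by omega, by omega⟩
      have h1 := ih (by omega)
      have h2 := Δ_anti (Config.le_day J hj') ((Config.day_le J hj').trans (τ_le_T hjL))
      rw [drop, Finset.sum_Ico_succ_top (by omega)]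
      rw [drop] at h1
      linarith
  have := key I.L hm le_rfl
  rwa [I.τ_last] at this

/-! ### Splitting the horizon -/

lemma Ioc_union_τ {m : ℕ} (hm : m < I.L) (f : ℕ → ℝ) :
    ∑ t ∈ Finset.Ioc (I.τ m) I.T, f t =
      ∑ t ∈ Finset.Ioc (I.τ m) (I.τ (m + 1)), f t + ∑ t ∈ Finset.Ioc (I.τ (m + 1)) I.T, f t :=
  (Finset.sum_Ioc_consecutive f (I.τ_lt m hm).le (τ_le_T hm)).symm

/-! ### Sums over days -/

lemma sum_Ioc_telescope (F : ℕ → ℝ) {a b : ℕ} (hab : a ≤ b) :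
    ∑ t ∈ Finset.Ioc a b, (F t - F (t - 1)) = F b - F a := by
  induction b, hab using Nat.le_induction with
  | base => simp
  | succ k hk ih => rw [Finset.sum_Ioc_succ_top hk, ih]; simp

lemma sum_Ioc_pred {f : ℕ → ℝ} {a t : ℕ} (hat : a < t) :
    ∑ s ∈ Finset.Ioc a t, f s = ∑ s ∈ Finset.Ioc a (t - 1), f s + f t := by
  obtain ⟨u, rfl⟩ : ∃ u, t = u + 1 := ⟨t - 1, by omega⟩
  rw [Finset.sum_Ioc_succ_top (by omega)]; simp

/-- Stated for additive monoids because it serves both numbers of released workers and fees in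
`ℝ≥0∞`. -/
lemma sum_epoch_ends {M : Type*} [AddCommMonoid M] (f : ℕ → M) {a b : ℕ} (hab : a ≤ b)
    (hb : b ≤ I.L)
    (hf : ∀ j ∈ Ico a b, ∀ t ∈ Ioo (I.τ j) (I.τ (j + 1)), f t = 0) :
    ∑ t ∈ Finset.Ioc (I.τ a) (I.τ b), f t = ∑ j ∈ Finset.Ico a b, f (I.τ (j + 1)) := by
  induction b, hab using Nat.le_induction with
  | base => simp
  | succ k hk ih =>
    rw [← Finset.sum_Ioc_consecutive f (τ_mono hk (by omega)) (I.τ_lt k (by omega)).le,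
      ih (by omega) (fun j hj => hf j ⟨hj.1, by have := hj.2; omega⟩),
      Finset.sum_Ico_succ_top hk]
    congr 1
    refine Finset.sum_eq_single_of_mem _ ?_ ?_
    · simpa using I.τ_lt k (by omega)
    · intro t ht hne
      rw [Finset.mem_Ioc] at ht
      exact hf k ⟨hk, by omega⟩ t ⟨ht.1, lt_of_le_of_ne ht.2 hne⟩

/-! ### Aggregated plans -/

/-- A plan for the epochs `m, …, L - 1` with releases aggregated over the pools. -/
structure Plan (I : StaffingInstance) (m : ℕ) where
  x : I.Config m → Fin I.n → ℕ → ℝ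
  Y : I.Config m → ℕ → ℝ
  lam : I.Config m → ℝ
  θ : I.Config m → ℝ

/-- Total hires of a day. -/
noncomputable def Plan.hires {m : ℕ} (p : I.Plan m) (J : I.Config m) (t : ℕ) : ℝ := ∑ i, p.x J i t

/-- Total hires minus total releases. -/
noncomputable def Plan.net {m : ℕ} (p : I.Plan m) (J : I.Config m) : ℝ :=
  ∑ t ∈ Finset.Ioc (I.τ m) I.T, p.hires J t - ∑ j ∈ Finset.Ico m I.L, p.Y J j

/-- Money spent by a plan, apart from infinite fees. -/
noncomputable def Plan.spend {m : ℕ} (p : I.Plan m) (J : I.Config m) : ℝ :=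
  ∑ i, ∑ t ∈ Finset.Ioc (I.τ m) I.T, I.wage i t * p.x J i t
    + ∑ j ∈ Finset.Ico m I.L, (I.epochFee j).toReal * p.Y J j

/-- Feasibility of an aggregated plan with (normalized) supplies `σ`, budget `b`, and difference
`g` between the upper endpoint of the demand range and the number of workers at the start.
The number of workers is not required to stay nonnegative. -/
structure Plan.IsFeasible {m : ℕ} (p : I.Plan m) (σ : Fin I.n → ℝ) (b g : ℝ) : Prop where
  x_nonneg : ∀ J i, ∀ t ∈ Ioc (I.τ m) I.T, 0 ≤ p.x J i t
  Y_nonneg : ∀ J, ∀ j ∈ Ico m I.L, 0 ≤ p.Y J j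
  lam_nonneg : ∀ J, 0 ≤ p.lam J
  θ_nonneg : ∀ J, 0 ≤ p.θ J
  x_indist : ∀ J J', ∀ t ∈ Ioc (I.τ m) I.T, Indist t J J' → ∀ i, p.x J i t = p.x J' i t
  Y_indist : ∀ J J', ∀ j ∈ Ico m I.L, Indist (I.τ (j + 1)) J J' → p.Y J j = p.Y J' j
  supply : ∀ J i, ∑ t ∈ Finset.Ioc (I.τ m) I.T, 1 / I.ρ i t * p.x J i t ≤ σ i
  prohibited : ∀ J, ∀ j ∈ Ico m I.L, I.epochFee j = ⊤ → p.Y J j = 0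
  budget : ∀ J, p.spend J ≤ b
  overstaffing : ∀ J, p.net J - (g - drop J I.L - I.Δ I.T) ≤ p.lam J
  understaffing : ∀ J, g - drop J I.L - p.net J ≤ p.θ J

/-- The aggregated plan of a solution of the linear program. -/
noncomputable def LPVars.toPlan {m : ℕ} (z : I.LPVars m) : I.Plan m where
  x := z.x
  Y := fun J j => ∑ i, z.y J i j
  lam := z.lam
  θ := z.θ

/-! ### Budgets -/

/-- An infinite fee on a positive amount breaks any finite budget, so infinite fees amount to
prohibitions. In the real inequality they may then be replaced by `toReal`, which gives them the
harmless value zero. -/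
lemma spend_le_iff (s : Finset ℕ) {X : ℝ} (hX : 0 ≤ X) {Y : ℕ → ℝ} (hY : ∀ j ∈ s, 0 ≤ Y j)
    (f : ℕ → ℝ≥0∞) {β : ℝ≥0∞} (hβ : β ≠ ⊤) :
    ENNReal.ofReal X + ∑ j ∈ s, f j * ENNReal.ofReal (Y j) ≤ β ↔
      (∀ j ∈ s, f j = ⊤ → Y j = 0) ∧ X + ∑ j ∈ s, (f j).toReal * Y j ≤ β.toReal := by
  have key : (∀ j ∈ s, f j = ⊤ → Y j = 0) → ENNReal.ofReal X + ∑ j ∈ s, f j * ENNReal.ofReal (Y j)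
      = ENNReal.ofReal (X + ∑ j ∈ s, (f j).toReal * Y j) := by
    intro h
    have h0 : ∀ j ∈ s, 0 ≤ (f j).toReal * Y j :=
      fun j hj => mul_nonneg ENNReal.toReal_nonneg (hY j hj)
    rw [ENNReal.ofReal_add hX (Finset.sum_nonneg h0), ENNReal.ofReal_sum_of_nonneg h0]
    congr 1
    refine Finset.sum_congr rfl fun j hj => ?_
    by_cases hf : f j = ⊤
    · simp [h j hj hf]
    · rw [ENNReal.ofReal_mul ENNReal.toReal_nonneg, ENNReal.ofReal_toReal hf]
  constructor
  · intro h
    have h1 : ∀ j ∈ s, f j = ⊤ → Y j = 0 := by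
      intro j hj hf
      by_contra hne
      have hpos : 0 < Y j := lt_of_le_of_ne (hY j hj) (Ne.symm hne)
      have : (⊤ : ℝ≥0∞) ≤ β := by
        refine le_trans ?_ (le_trans le_add_self h)
        refine le_trans ?_ (Finset.single_le_sum
          (f := fun j => f j * ENNReal.ofReal (Y j)) (fun _ _ => bot_le) hj)
        simp only [hf]
        rw [ENNReal.top_mul]
        simpa using hpos
      exact hβ (top_le_iff.1 this)
    refine ⟨h1, ?_⟩
    rw [key h1] at h
    exact (ENNReal.ofReal_le_iff_le_toReal hβ).1 h
  · rintro ⟨h1, h2⟩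
    rw [key h1]
    exact (ENNReal.ofReal_le_iff_le_toReal hβ).2 h2

/-- Here the fees are used to be the same for all pools in an epoch: the money spent depends on
releases only through their total. -/
lemma sum_spend_eq {m : ℕ} (D : Finset ℕ) {x y : Fin I.n → ℕ → ℝ} (hx : ∀ i, ∀ t ∈ D, 0 ≤ x i t)
    (hy : ∀ i, ∀ j ∈ Ico m I.L, 0 ≤ y i j) :
    ∑ i, (∑ t ∈ D, ENNReal.ofReal (I.wage i t * x i t)
      + ∑ j ∈ Finset.Ico m I.L, I.fee i (I.τ (j + 1)) * ENNReal.ofReal (y i j)) =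
    ENNReal.ofReal (∑ i, ∑ t ∈ D, I.wage i t * x i t)
      + ∑ j ∈ Finset.Ico m I.L, I.epochFee j * ENNReal.ofReal (∑ i, y i j) := by
  have h0 : ∀ i, ∀ t ∈ D, 0 ≤ I.wage i t * x i t :=
    fun i t ht => mul_nonneg (I.wage_nonneg i t) (hx i t ht)
  rw [Finset.sum_add_distrib, ENNReal.ofReal_sum_of_nonneg
    (fun i _ => Finset.sum_nonneg (h0 i))]
  congr 1
  · exact Finset.sum_congr rfl fun i _ => (ENNReal.ofReal_sum_of_nonneg (h0 i)).symm
  · rw [Finset.sum_comm]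
    refine Finset.sum_congr rfl fun j hj => ?_
    rw [Finset.mem_Ico] at hj
    rw [ENNReal.ofReal_sum_of_nonneg fun i _ => hy i j hj, Finset.mul_sum]
    exact Finset.sum_congr rfl fun i _ => by rw [fee_last hj.2]

lemma budget_iff {m : ℕ} {D : Finset ℕ} {x y : Fin I.n → ℕ → ℝ} (hx : ∀ i, ∀ t ∈ D, 0 ≤ x i t)
    (hy : ∀ i, ∀ j ∈ Ico m I.L, 0 ≤ y i j) {β : ℝ≥0∞} (hβ : β ≠ ⊤) :
    ∑ i, (∑ t ∈ D, ENNReal.ofReal (I.wage i t * x i t)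
      + ∑ j ∈ Finset.Ico m I.L, I.fee i (I.τ (j + 1)) * ENNReal.ofReal (y i j)) ≤ β ↔
    (∀ j ∈ Ico m I.L, I.epochFee j = ⊤ → ∑ i, y i j = 0) ∧
      ∑ i, ∑ t ∈ D, I.wage i t * x i t
        + ∑ j ∈ Finset.Ico m I.L, (I.epochFee j).toReal * ∑ i, y i j ≤ β.toReal := by
  rw [sum_spend_eq D hx hy, spend_le_iff _ _ _ _ hβ]
  · simp only [Finset.mem_Ico, mem_Ico]
  · exact Finset.sum_nonneg fun i _ => Finset.sum_nonneg fun t ht =>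
      mul_nonneg (I.wage_nonneg i t) (hx i t ht)
  · intro j hj
    exact Finset.sum_nonneg fun i _ => hy i j (by simpa using hj)

/-- Measuring supplies in workers of day zero removes the starting day from the rates, so that
supplies of successive epochs can be subtracted. -/
lemma supply_iff {m : ℕ} {D : Finset ℕ} {x : ℕ → ℝ} (i : Fin I.n) {s : ℝ} :
    ∑ t ∈ D, 1 / (I.ρ i t / I.ρ i (I.τ m)) * x t ≤ s ↔
      ∑ t ∈ D, 1 / I.ρ i t * x t ≤ s / I.ρ i (I.τ m) := by
  rw [le_div_iff₀ (ρ_pos i _), Finset.sum_mul]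
  have : ∀ t, 1 / (I.ρ i t / I.ρ i (I.τ m)) * x t = 1 / I.ρ i t * x t * I.ρ i (I.τ m) := by
    intro t
    have := (ρ_pos i t).ne'
    have := (ρ_pos i (I.τ m)).ne'
    field_simp
  simp only [this]

/-! ### Nonanticipativity -/

lemma Indist.day_eq {m j t : ℕ} {J J' : I.Config m} (h : Indist t J J') (hj : j ∈ Ico m I.L)
    (ht : I.τ (j + 1) < t) : Config.day J j = Config.day J' j := by
  have h1 := Config.day_le J hj
  have h2 := Config.day_le J' hj
  have := h j hj
  omega

lemma Indist.day_eq' {m j t : ℕ} {J J' : I.Config m} (h : Indist t J J') (hj : j ∈ Ico m I.L)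
    (ht : I.τ (j + 1) ≤ t) : Config.day J j = Config.day J' j := by
  have h1 := Config.day_le J hj
  have h2 := Config.day_le J' hj
  have := h j hj
  omega

/-- The program ties hires together only up to the smaller switching day of an epoch. If `t` lies
after a switching day of its epoch, indistinguishability forces both switching days to coincide, and
the constraint of the next epoch covers `t`. -/
lemma LPVars.IsFeasible.x_indist {m : ℕ} {S : StaffingState I.n} {z : I.LPVars m}
    (hz : z.IsFeasible S) (hm : m ≤ I.L) {J J' : I.Config m} {t : ℕ}
    (ht : t ∈ Ioc (I.τ m) I.T) (h : Indist t J J') (i : Fin I.n) : z.x J i t = z.x J' i t := by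
  obtain ⟨ℓ, hℓ, htℓ⟩ := exists_epoch hm ht
  have hbefore : ∀ j ∈ Ico m I.L, j < ℓ → Config.day J j = Config.day J' j := by
    intro j hj hjℓ
    refine h.day_eq hj (lt_of_le_of_lt (τ_mono ?_ hℓ.2.le) htℓ.1)
    omega
  have conv : ∀ j : Ico m I.L, Config.day J j = Config.day J' j → J j = J' j := by
    intro j hj
    rw [Config.day_eq J j.2, Config.day_eq J' j.2] at hj
    exact Subtype.ext hj
  by_cases hle : t ≤ Config.day J ℓ ∧ t ≤ Config.day J' ℓ
  · refine hz.x_identical ⟨ℓ, hℓ⟩ J J' (fun j hj => conv j (hbefore j j.2 hj)) i t ⟨ht.1, ?_⟩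
    rw [Config.day_eq J hℓ, Config.day_eq J' hℓ] at hle
    exact le_min hle.1 hle.2
  · have heq : Config.day J ℓ = Config.day J' ℓ := by
      have := h ℓ hℓ
      omega
    have hupto : ∀ j ∈ Ico m I.L, j < ℓ + 1 → Config.day J j = Config.day J' j := by
      intro j hj hjℓ
      rcases Nat.lt_succ_iff_lt_or_eq.1 hjℓ with h1 | rfl
      · exact hbefore j hj h1
      · exact heq
    -- Switching days of epoch `ℓ + 1` are at least `τ (ℓ + 1)`, hence not before `t`. In the last
    -- epoch there is no further constraint to use, but then all switching days agree.
    by_cases hlast : ℓ + 1 < I.L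
    · have hmem : ℓ + 1 ∈ Ico m I.L := ⟨by have := hℓ.1; omega, hlast⟩
      refine hz.x_identical ⟨ℓ + 1, hmem⟩ J J' (fun j hj => conv j (hupto j j.2 hj)) i t
        ⟨ht.1, ?_⟩
      exact le_min (htℓ.2.trans (J ⟨ℓ + 1, hmem⟩).2.1) (htℓ.2.trans (J' ⟨ℓ + 1, hmem⟩).2.1)
    · have : J = J' := Config.ext_day fun j hj => hupto j hj (by have := hj.2; omega)
      rw [this]

lemma LPVars.IsFeasible.y_indist {m : ℕ} {S : StaffingState I.n} {z : I.LPVars m}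
    (hz : z.IsFeasible S) {J J' : I.Config m} {ℓ : ℕ} (hℓ : ℓ ∈ Ico m I.L)
    (h : Indist (I.τ (ℓ + 1)) J J') (i : Fin I.n) : z.y J i ℓ = z.y J' i ℓ := by
  refine hz.y_identical ⟨ℓ, hℓ⟩ J J' (fun j hj => ?_) i
  have hj' : (j : ℕ) ≤ ℓ := hj
  have := h.day_eq' j.2 (τ_mono (by omega) hℓ.2)
  rw [Config.day_eq J j.2, Config.day_eq J' j.2] at this
  exact Subtype.ext this

lemma indist_of_identical {m t : ℕ} {J J' : I.Config m} (ℓ : Ico m I.L)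
    (h : ∀ j : Ico m I.L, (j : ℕ) < ℓ → J j = J' j) (ht : t ≤ min (J ℓ : ℕ) (J' ℓ)) :
    Indist t J J' := by
  intro j hj
  rw [Config.day_eq J hj, Config.day_eq J' hj]
  rcases lt_trichotomy j (ℓ : ℕ) with hlt | heq | hgt
  · rw [h ⟨j, hj⟩ hlt]
  · have : (⟨j, hj⟩ : Ico m I.L) = ℓ := Subtype.ext heq
    rw [this]; omega
  · have h1 := (J ⟨j, hj⟩).2.1
    have h2 := (J' ⟨j, hj⟩).2.1
    have h3 := (J ℓ).2.2
    have h4 := τ_mono (I := I) (show (ℓ : ℕ) + 1 ≤ j by omega) hj.2.le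
    simp only at h1 h2
    omega

lemma indist_of_identical' {m : ℕ} {J J' : I.Config m} (ℓ : Ico m I.L)
    (h : ∀ j : Ico m I.L, (j : ℕ) ≤ ℓ → J j = J' j) : Indist (I.τ (ℓ + 1)) J J' := by
  intro j hj
  rw [Config.day_eq J hj, Config.day_eq J' hj]
  by_cases hlt : j ≤ (ℓ : ℕ)
  · rw [h ⟨j, hj⟩ hlt]
  · have h1 := (J ⟨j, hj⟩).2.1
    have h2 := (J' ⟨j, hj⟩).2.1
    have h4 := τ_mono (I := I) (show (ℓ : ℕ) + 1 ≤ j by omega) hj.2.le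
    simp only at h1 h2
    omega

lemma LPVars.final_eq {m : ℕ} (S : StaffingState I.n) (z : I.LPVars m) (J : I.Config m) :
    z.final S J = ∑ i, S.hired i + z.toPlan.net J := by
  simp only [LPVars.final, Plan.net, Plan.hires, LPVars.toPlan]
  rw [Finset.sum_sub_distrib, Finset.sum_add_distrib, Finset.sum_comm (s := Finset.univ)
    (t := Finset.Ioc _ _), Finset.sum_comm (s := Finset.univ) (t := Finset.Ico _ _)]
  ring

lemma LPVars.IsFeasible.toPlan {m : ℕ} (hm : m ≤ I.L) {S : StaffingState I.n} {z : I.LPVars m}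
    (hz : z.IsFeasible S) (hS : S.lo = S.hi - I.Δ (I.τ m)) (hβ : S.budget ≠ ⊤) :
    z.toPlan.IsFeasible (fun i => S.supply i / I.ρ i (I.τ m)) S.budget.toReal
      (S.hi - ∑ i, S.hired i) := by
  have hx : ∀ J i, ∀ t ∈ Finset.Ioc (I.τ m) I.T, 0 ≤ z.x J i t :=
    fun J i t ht => hz.x_nonneg J i t (by simpa using ht)
  have hb := fun J => (budget_iff (hx J) (hz.y_nonneg J) hβ).1 (hz.budget J)
  refine ⟨hz.x_nonneg, fun J j hj => ?_,
    hz.lam_nonneg, hz.θ_nonneg, fun J J' t ht h i => hz.x_indist hm ht h i,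
    fun J J' j hj h => ?_,
    fun J i => (supply_iff i).1 (hz.supply J i), fun J => (hb J).1, fun J => (hb J).2, ?_, ?_⟩
  · show 0 ≤ ∑ i, z.y J i j
    exact Finset.sum_nonneg fun i _ => hz.y_nonneg J i j hj
  · show ∑ i, z.y J i j = ∑ i, z.y J' i j
    exact Finset.sum_congr rfl fun i _ => hz.y_indist hj h i
  · intro J
    have := hz.overstaffing J
    rw [z.final_eq, configInterval_fst_T J hm hS] at this
    show _ ≤ z.lam J
    linarith
  · intro J
    have := hz.understaffing J
    rw [z.final_eq, configInterval_snd_T J hm hS] at this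
    show _ ≤ z.θ J
    linarith

/-- Solutions of the linear program from nonanticipative, aggregately feasible variables. -/
lemma LPVars.isFeasible_of_toPlan {m : ℕ} (hm : m ≤ I.L) {S : StaffingState I.n} {z : I.LPVars m}
    (hz : z.toPlan.IsFeasible (fun i => S.supply i / I.ρ i (I.τ m)) S.budget.toReal
      (S.hi - ∑ i, S.hired i))
    (hS : S.lo = S.hi - I.Δ (I.τ m)) (hβ : S.budget ≠ ⊤)
    (y_nonneg : ∀ J i, ∀ j ∈ Ico m I.L, 0 ≤ z.y J i j)
    (y_indist : ∀ J J', ∀ j ∈ Ico m I.L, Indist (I.τ (j + 1)) J J' → ∀ i, z.y J i j = z.y J' i j)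
    (release : ∀ J i, ∀ ℓ ∈ Ico m I.L, ∑ j ∈ Finset.Icc m ℓ, z.y J i j
      ≤ S.hired i + ∑ t ∈ Finset.Ioc (I.τ m) (I.τ (ℓ + 1)), z.x J i t) : z.IsFeasible S := by
  have hx : ∀ J i, ∀ t ∈ Finset.Ioc (I.τ m) I.T, 0 ≤ z.x J i t :=
    fun J i t ht => hz.x_nonneg J i t (by simpa using ht)
  refine ⟨hz.x_nonneg, y_nonneg, hz.lam_nonneg, hz.θ_nonneg, ?_, ?_,
    fun J i => (supply_iff i).2 (hz.supply J i),
    fun J => (budget_iff (hx J) (y_nonneg J) hβ).2 ⟨hz.prohibited J, hz.budget J⟩,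
    release, ?_, ?_⟩
  · intro ℓ J J' h i t ht
    refine hz.x_indist J J' t ⟨ht.1, ?_⟩ (indist_of_identical ℓ h ht.2) i
    exact (ht.2.trans (min_le_left _ _)).trans ((J ℓ).2.2.trans (τ_le_T ℓ.2.2))
  · intro ℓ J J' h i
    exact y_indist J J' ℓ ℓ.2 (indist_of_identical' ℓ h) i
  · intro J
    have : _ ≤ z.lam J := hz.overstaffing J
    rw [z.final_eq, configInterval_fst_T J hm hS]
    linarith
  · intro J
    have : _ ≤ z.θ J := hz.understaffing J
    rw [z.final_eq, configInterval_snd_T J hm hS]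
    linarith

/-! ### Repairing plans -/

/-- The increase of `max · e` when the argument moves from `z` to `z + X`. -/
noncomputable def clip (z X e : ℝ) : ℝ := max (z + X) e - max z e

lemma clip_nonneg {z X e : ℝ} (hX : 0 ≤ X) : 0 ≤ clip z X e := by
  unfold clip
  have := max_le_max_right e (show z ≤ z + X by linarith)
  linarith

lemma clip_le {z X e : ℝ} (hX : 0 ≤ X) : clip z X e ≤ X := by
  unfold clip
  rcases max_cases (z + X) e with h | h <;> rcases max_cases z e with h' | h' <;> linarith

namespace Plan

variable {m : ℕ} (p : I.Plan m) (U hi : ℝ) (J : I.Config m)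

/-- Total releases of a day, when releases take place on the last days of the epochs. -/
noncomputable def daily (t : ℕ) : ℝ :=
  ∑ j ∈ Finset.Ico m I.L, if I.τ (j + 1) = t then p.Y J j else 0

/-- Number of workers at the end of day `t` (possibly negative). -/
noncomputable def stock (t : ℕ) : ℝ := U + ∑ s ∈ Finset.Ioc (I.τ m) t, (p.hires J s - p.daily J s)

/-- Number of workers on the first switching day. -/
noncomputable def base : ℝ := U + ∑ s ∈ Finset.Ioc (I.τ m) (Config.day J m), p.hires J s

/-- After the first switching day, the number of workers is kept above this level. -/
noncomputable def level : ℝ := min (p.base U J) (hi - I.Δ (Config.day J m))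

/-- Total hires of the repaired plan. -/
noncomputable def newHire (t : ℕ) : ℝ :=
  if t ≤ Config.day J m then p.hires J t
  else if t ≤ I.τ (m + 1) then
    clip (U + ∑ s ∈ Finset.Ioc (I.τ m) (t - 1), p.hires J s - p.Y J m) (p.hires J t) (p.base U J)
  else clip (p.stock U J (t - 1)) (p.hires J t) (p.level U hi J)

/-- Total releases of the repaired plan. -/
noncomputable def newRelease (j : ℕ) : ℝ :=
  if j = m then max (p.stock U J (I.τ (m + 1))) (p.base U J)
    - max (p.stock U J (I.τ (m + 1))) (p.level U hi J)
  else clip (p.stock U J (I.τ (j + 1))) (p.Y J j) (p.level U hi J)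

lemma daily_end {j : ℕ} (hj : j ∈ Ico m I.L) : p.daily J (I.τ (j + 1)) = p.Y J j := by
  unfold daily
  rw [Finset.sum_eq_single_of_mem j (by simpa using hj)]
  · simp
  · intro i hi hij
    rw [Finset.mem_Ico] at hi
    refine if_neg fun h => hij ?_
    exact epoch_unique (I := I) hi.2 hj.2 ⟨I.τ_lt i hi.2, le_rfl⟩
      ⟨by rw [h]; exact I.τ_lt j hj.2, h.le⟩

lemma daily_mid {j t : ℕ} (hj : j ∈ Ico m I.L) (ht : t ∈ Ioo (I.τ j) (I.τ (j + 1))) :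
    p.daily J t = 0 := by
  refine Finset.sum_eq_zero fun i hi => ?_
  rw [Finset.mem_Ico] at hi
  refine if_neg fun h => ?_
  have := epoch_unique (I := I) (t := t) hi.2 hj.2 (h ▸ ⟨I.τ_lt i hi.2, le_rfl⟩) ⟨ht.1, ht.2.le⟩
  subst this
  exact absurd h ht.2.ne'

lemma sum_daily {ℓ : ℕ} (hm : m ≤ ℓ) (hℓ : ℓ ≤ I.L) :
    ∑ t ∈ Finset.Ioc (I.τ m) (I.τ ℓ), p.daily J t = ∑ j ∈ Finset.Ico m ℓ, p.Y J j := by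
  rw [sum_epoch_ends _ hm hℓ]
  · refine Finset.sum_congr rfl fun j hj => ?_
    rw [Finset.mem_Ico] at hj
    exact p.daily_end J ⟨hj.1, by omega⟩
  · exact fun j hj t ht => p.daily_mid J ⟨hj.1, by have := hj.2; omega⟩ ht

lemma stock_τ {ℓ : ℕ} (hm : m ≤ ℓ) (hℓ : ℓ ≤ I.L) :
    p.stock U J (I.τ ℓ) = U + (∑ t ∈ Finset.Ioc (I.τ m) (I.τ ℓ), p.hires J t
      - ∑ j ∈ Finset.Ico m ℓ, p.Y J j) := by
  rw [stock, Finset.sum_sub_distrib, p.sum_daily J hm hℓ]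

lemma stock_T (hm : m ≤ I.L) : p.stock U J I.T = U + p.net J := by
  have := p.stock_τ U J hm le_rfl
  rwa [I.τ_last] at this

variable {p U hi J} {σ : Fin I.n → ℝ} {b g : ℝ}

lemma IsFeasible.hires_nonneg (hp : p.IsFeasible σ b g) {t : ℕ} (ht : t ∈ Ioc (I.τ m) I.T) :
    0 ≤ p.hires J t := Finset.sum_nonneg fun i _ => hp.x_nonneg J i t ht

lemma IsFeasible.base_nonneg (hp : p.IsFeasible σ b g) (hm : m < I.L) (hU : 0 ≤ U) :
    0 ≤ p.base U J := by
  refine add_nonneg hU (Finset.sum_nonneg fun t ht => hp.hires_nonneg ?_)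
  rw [Finset.mem_Ioc] at ht
  exact ⟨ht.1, ht.2.trans ((Config.day_le J ⟨le_rfl, hm⟩).trans (τ_le_T hm))⟩

lemma IsFeasible.newHire_nonneg (hp : p.IsFeasible σ b g) {t : ℕ} (ht : t ∈ Ioc (I.τ m) I.T) :
    0 ≤ p.newHire U hi J t := by
  unfold newHire
  split_ifs
  · exact hp.hires_nonneg ht
  · exact clip_nonneg (hp.hires_nonneg ht)
  · exact clip_nonneg (hp.hires_nonneg ht)

lemma IsFeasible.newHire_le (hp : p.IsFeasible σ b g) {t : ℕ} (ht : t ∈ Ioc (I.τ m) I.T) :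
    p.newHire U hi J t ≤ p.hires J t := by
  unfold newHire
  split_ifs
  · exact le_rfl
  · exact clip_le (hp.hires_nonneg ht)
  · exact clip_le (hp.hires_nonneg ht)

lemma level_le : p.level U hi J ≤ p.base U J := min_le_left _ _

lemma IsFeasible.newRelease_nonneg (hp : p.IsFeasible σ b g) {j : ℕ} (hj : j ∈ Ico m I.L) :
    0 ≤ p.newRelease U hi J j := by
  unfold newRelease
  split_ifs
  · exact sub_nonneg.2 (max_le_max_left _ level_le)
  · exact clip_nonneg (hp.Y_nonneg J j hj)

/-- The number of workers at the end of the first epoch. -/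
lemma stock_first (hm : m < I.L) :
    p.stock U J (I.τ (m + 1)) = p.base U J
      + ∑ t ∈ Finset.Ioc (Config.day J m) (I.τ (m + 1)), p.hires J t - p.Y J m := by
  have h0 : m ∈ Ico m I.L := ⟨le_rfl, hm⟩
  rw [p.stock_τ U J (Nat.le_succ m) hm, base,
    ← Finset.sum_Ioc_consecutive _ (Config.le_day J h0) (Config.day_le J h0)]
  simp
  ring

lemma IsFeasible.sum_after_nonneg (hp : p.IsFeasible σ b g) (hm : m < I.L) :
    0 ≤ ∑ t ∈ Finset.Ioc (Config.day J m) (I.τ (m + 1)), p.hires J t := by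
  refine Finset.sum_nonneg fun t ht => hp.hires_nonneg ?_
  rw [Finset.mem_Ioc] at ht
  exact ⟨(Config.le_day J ⟨le_rfl, hm⟩).trans_lt ht.1, ht.2.trans (τ_le_T hm)⟩

lemma IsFeasible.newRelease_le (hp : p.IsFeasible σ b g) {j : ℕ} (hj : j ∈ Ico m I.L) :
    p.newRelease U hi J j ≤ p.Y J j := by
  unfold newRelease
  split_ifs with h
  · subst h
    have h1 := stock_first (p := p) (U := U) (J := J) hj.2
    have h2 := hp.sum_after_nonneg (J := J) hj.2
    have h3 := hp.Y_nonneg J j hj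
    have h4 := level_le (p := p) (U := U) (hi := hi) (J := J)
    have h5 := le_max_left (p.stock U J (I.τ (j + 1))) (p.level U hi J)
    rcases max_cases (p.stock U J (I.τ (j + 1))) (p.base U J) with h | h <;> linarith
  · exact clip_le (hp.Y_nonneg J j hj)

/-- Taking the maximum with a fixed number is a contraction. This bound does not involve `Y`; it is
compared below with the workers that are certainly present on the switching day. -/
lemma newRelease_first_le : p.newRelease U hi J m ≤ p.base U J - p.level U hi J := by
  unfold newRelease
  rw [if_pos rfl]
  have h4 := level_le (p := p) (U := U) (hi := hi) (J := J)
  rcases max_cases (p.stock U J (I.τ (m + 1))) (p.base U J) with h | h <;>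
  rcases max_cases (p.stock U J (I.τ (m + 1))) (p.level U hi J) with h' | h' <;> linarith

/-- Releases of the repaired plan in the first epoch preclude hires after the switching day. -/
lemma IsFeasible.newHire_eq_zero (hp : p.IsFeasible σ b g) (hm : m < I.L)
    (h : p.newRelease U hi J m ≠ 0) {t : ℕ} (ht : t ∈ Ioc (Config.day J m) (I.τ (m + 1))) :
    p.newHire U hi J t = 0 := by
  have h0 : m ∈ Ico m I.L := ⟨le_rfl, hm⟩
  -- If the final stock of the epoch were at least `base`, both maxima defining the release would
  -- equal that stock.
  have hlt : p.stock U J (I.τ (m + 1)) < p.base U J := by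
    by_contra hge
    rw [not_lt] at hge
    apply h
    unfold newRelease
    rw [if_pos rfl, max_eq_left hge, max_eq_left (level_le.trans hge), sub_self]
  -- Hires are nonnegative, so with the releases of the epoch deducted in advance all partial totals
  -- stay below `base`, and clipping at `base` leaves no hires.
  have key : ∀ s, s ≤ I.τ (m + 1) → Config.day J m ≤ s →
      U + ∑ s ∈ Finset.Ioc (I.τ m) s, p.hires J s - p.Y J m ≤ p.stock U J (I.τ (m + 1)) := by
    intro s hs hks
    rw [p.stock_τ U J (Nat.le_succ m) hm]
    have : ∑ s ∈ Finset.Ioc (I.τ m) s, p.hires J s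
        ≤ ∑ s ∈ Finset.Ioc (I.τ m) (I.τ (m + 1)), p.hires J s := by
      refine Finset.sum_le_sum_of_subset_of_nonneg (Finset.Ioc_subset_Ioc_right hs) ?_
      intro t ht _
      rw [Finset.mem_Ioc] at ht
      exact hp.hires_nonneg ⟨ht.1, ht.2.trans (τ_le_T hm)⟩
    simp
    linarith
  unfold newHire
  rw [if_neg (not_le.2 ht.1), if_pos ht.2]
  unfold clip
  have h1 := key t ht.2 ht.1.le
  have h2 := key (t - 1) (by have := ht.2; omega) (by have := ht.1; omega)
  rw [sum_Ioc_pred ((Config.le_day J h0).trans_lt ht.1)] at h1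
  rw [max_eq_right (by linarith), max_eq_right (by linarith), sub_self]

/-- After the switching day, hires are set off in advance against the releases of the same epoch,
and only the excess over `base` is kept. Releases then take the total down to the maximum of the old
stock and the level. -/
lemma sum_newHire_first (hm : m < I.L) (hp : p.IsFeasible σ b g) :
    U + ∑ t ∈ Finset.Ioc (I.τ m) (I.τ (m + 1)), p.newHire U hi J t
      = max (p.stock U J (I.τ (m + 1))) (p.base U J) := by
  have h0 : m ∈ Ico m I.L := ⟨le_rfl, hm⟩
  rw [← Finset.sum_Ioc_consecutive _ (Config.le_day J h0) (Config.day_le J h0)]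
  have h1 : ∑ t ∈ Finset.Ioc (I.τ m) (Config.day J m), p.newHire U hi J t
      = ∑ t ∈ Finset.Ioc (I.τ m) (Config.day J m), p.hires J t := by
    refine Finset.sum_congr rfl fun t ht => ?_
    rw [Finset.mem_Ioc] at ht
    exact if_pos ht.2
  -- The clipped increments telescope. The path starts from `base - Y`, which is below `base` and is
  -- clipped to it.
  have h2 : ∑ t ∈ Finset.Ioc (Config.day J m) (I.τ (m + 1)), p.newHire U hi J t
      = max (p.stock U J (I.τ (m + 1))) (p.base U J) - max (p.base U J - p.Y J m) (p.base U J) := by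
    have := sum_Ioc_telescope (fun t => max (U + ∑ s ∈ Finset.Ioc (I.τ m) t, p.hires J s - p.Y J m)
      (p.base U J)) (Config.day_le J h0)
    rw [p.stock_τ U J (Nat.le_succ m) hm]
    simp only [Nat.Ico_succ_singleton, Finset.sum_singleton]
    rw [show U + (∑ t ∈ Finset.Ioc (I.τ m) (I.τ (m + 1)), p.hires J t - p.Y J m) =
      U + ∑ t ∈ Finset.Ioc (I.τ m) (I.τ (m + 1)), p.hires J t - p.Y J m by ring, base]
    rw [base] at this
    rw [← this]
    refine Finset.sum_congr rfl fun t ht => ?_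
    rw [Finset.mem_Ioc] at ht
    rw [newHire, if_neg (by omega), if_pos ht.2, clip, base,
      sum_Ioc_pred (f := p.hires J) ((Config.le_day J h0).trans_lt ht.1)]
    congr 2
    ring
  rw [h1, h2, max_eq_right (a := p.base U J - p.Y J m)
    (by have := hp.Y_nonneg J m h0; linarith), base]
  ring

/-- After the first epoch, the repaired plan keeps the number of workers above the level. -/
lemma newStock (hm : m < I.L) (hp : p.IsFeasible σ b g) {ℓ : ℕ} (hℓ : m + 1 ≤ ℓ) (hL : ℓ ≤ I.L) :
    U + (∑ t ∈ Finset.Ioc (I.τ m) (I.τ ℓ), p.newHire U hi J t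
      - ∑ j ∈ Finset.Ico m ℓ, p.newRelease U hi J j)
      = max (p.stock U J (I.τ ℓ)) (p.level U hi J) := by
  -- Releases are spread over days, vanishing except at ends of epochs, so that hires and releases
  -- can telescope together.
  have hrel : ∑ j ∈ Finset.Ico (m + 1) ℓ, p.newRelease U hi J j =
      ∑ t ∈ Finset.Ioc (I.τ (m + 1)) (I.τ ℓ),
        clip (p.stock U J t) (p.daily J t) (p.level U hi J) := by
    rw [sum_epoch_ends _ hℓ hL]
    · refine Finset.sum_congr rfl fun j hj => ?_
      rw [Finset.mem_Ico] at hj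
      rw [newRelease, if_neg (by omega), p.daily_end J ⟨by omega, by omega⟩]
    · intro j hj t ht
      have := hj.1
      have := hj.2
      rw [p.daily_mid J ⟨by omega, by omega⟩ ht]
      simp [clip]
  have hhire : ∑ t ∈ Finset.Ioc (I.τ (m + 1)) (I.τ ℓ), p.newHire U hi J t
      - ∑ j ∈ Finset.Ico (m + 1) ℓ, p.newRelease U hi J j
      = max (p.stock U J (I.τ ℓ)) (p.level U hi J)
        - max (p.stock U J (I.τ (m + 1))) (p.level U hi J) := by
    rw [hrel, ← Finset.sum_sub_distrib,
      ← sum_Ioc_telescope (fun t => max (p.stock U J t) (p.level U hi J)) (τ_mono hℓ hL)]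
    refine Finset.sum_congr rfl fun t ht => ?_
    rw [Finset.mem_Ioc] at ht
    have h1 := Config.day_le J (j := m) ⟨le_rfl, hm⟩
    have h2 := I.τ_lt m hm
    -- On each day the clipped stock first rises by the hires to `stock t + daily t` and then falls
    -- by the releases to `stock t`; the intermediate value cancels.
    rw [newHire, if_neg (by omega), if_neg (by omega), clip, clip,
      show p.stock U J (t - 1) + p.hires J t = p.stock U J t + p.daily J t by
        rw [stock, stock, sum_Ioc_pred (a := I.τ m) (t := t) (by omega)]; ring]
    ring
  rw [← Finset.sum_Ioc_consecutive _ (τ_mono (Nat.le_succ m) hm) (τ_mono hℓ hL),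
    Finset.sum_eq_sum_Ico_succ_bot (by omega : m < ℓ)]
  have h3 := sum_newHire_first (U := U) (hi := hi) (J := J) hm hp
  have h4 : p.newRelease U hi J m = max (p.stock U J (I.τ (m + 1))) (p.base U J)
    - max (p.stock U J (I.τ (m + 1))) (p.level U hi J) := if_pos rfl
  linarith

/-! ### Nonanticipativity of the repaired totals -/

section indist

variable {J' : I.Config m}

lemma IsFeasible.hires_congr (hp : p.IsFeasible σ b g) {t : ℕ} (ht : t ∈ Ioc (I.τ m) I.T)
    (h : Indist t J J') : p.hires J t = p.hires J' t :=
  Finset.sum_congr rfl fun i _ => hp.x_indist J J' t ht h i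

lemma IsFeasible.sum_hires_congr (hp : p.IsFeasible σ b g) {t : ℕ} (ht : t ≤ I.T)
    (h : Indist t J J') :
    ∑ s ∈ Finset.Ioc (I.τ m) t, p.hires J s = ∑ s ∈ Finset.Ioc (I.τ m) t, p.hires J' s := by
  refine Finset.sum_congr rfl fun s hs => ?_
  rw [Finset.mem_Ioc] at hs
  exact hp.hires_congr ⟨hs.1, hs.2.trans ht⟩ (h.mono hs.2)

lemma IsFeasible.stock_congr (hp : p.IsFeasible σ b g) {t : ℕ} (ht : t ≤ I.T)
    (h : Indist t J J') : p.stock U J t = p.stock U J' t := by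
  unfold stock
  rw [Finset.sum_sub_distrib, Finset.sum_sub_distrib, hp.sum_hires_congr ht h]
  congr 2
  refine Finset.sum_congr rfl fun s hs => Finset.sum_congr rfl fun j hj => ?_
  rw [Finset.mem_Ioc] at hs
  rw [Finset.mem_Ico] at hj
  split_ifs with h'
  · exact hp.Y_indist J J' j hj (h.mono (by omega))
  · rfl

lemma IsFeasible.base_congr (hp : p.IsFeasible σ b g) (hm : m < I.L)
    (h : Config.day J m = Config.day J' m) : p.base U J = p.base U J' := by
  have h0 : m ∈ Ico m I.L := ⟨le_rfl, hm⟩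
  unfold base
  rw [← h, hp.sum_hires_congr ((Config.day_le J h0).trans (τ_le_T hm))
    ((indist_of_day_eq h).mono (Config.day_le J h0))]

lemma IsFeasible.level_congr (hp : p.IsFeasible σ b g) (hm : m < I.L)
    (h : Config.day J m = Config.day J' m) : p.level U hi J = p.level U hi J' := by
  unfold level
  rw [hp.base_congr hm h, h]

/-- If `t` is not past the first switching day, nothing was changed. Otherwise indistinguishability
at `t` makes the first switching days equal, and all ingredients are determined by them and by the
past. -/
lemma IsFeasible.newHire_congr (hp : p.IsFeasible σ b g) (hm : m < I.L) {t : ℕ}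
    (ht : t ∈ Ioc (I.τ m) I.T) (h : Indist t J J') :
    p.newHire U hi J t = p.newHire U hi J' t := by
  have h0 : m ∈ Ico m I.L := ⟨le_rfl, hm⟩
  have hday := h m h0
  have ht1 : t - 1 ≤ I.T := by have := ht.2; omega
  by_cases h1 : t ≤ Config.day J m
  · rw [newHire, newHire, if_pos h1, if_pos (by omega), hp.hires_congr ht h]
  · have hk : Config.day J m = Config.day J' m := by omega
    rw [newHire, newHire, if_neg h1, if_neg (show ¬ t ≤ Config.day J' m by omega), hp.hires_congr ht h,
      hp.base_congr hm hk, hp.level_congr hm hk,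
      hp.stock_congr ht1 (h.mono (Nat.sub_le t 1)),
      hp.sum_hires_congr ht1 (h.mono (Nat.sub_le t 1)),
      hp.Y_indist J J' m h0 (indist_of_day_eq hk)]

lemma IsFeasible.newRelease_congr (hp : p.IsFeasible σ b g) (hm : m < I.L) {j : ℕ}
    (hj : j ∈ Ico m I.L) (h : Indist (I.τ (j + 1)) J J') :
    p.newRelease U hi J j = p.newRelease U hi J' j := by
  have h0 : m ∈ Ico m I.L := ⟨le_rfl, hm⟩
  have hmj := τ_mono (I := I) (show m + 1 ≤ j + 1 by have := hj.1; omega) hj.2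
  have hk := h.day_eq' h0 hmj
  rw [newRelease, newRelease, hp.base_congr hm hk, hp.level_congr hm hk,
    hp.Y_indist J J' j hj h, hp.stock_congr (τ_le_T hj.2) h,
    hp.stock_congr (τ_le_T hm) (h.mono hmj)]

end indist

end Plan

/-! ### Feasibility of the repaired plan and distribution over the pools -/

namespace Plan

variable {m : ℕ} {p : I.Plan m} {U hi : ℝ} {J : I.Config m} {σ : Fin I.n → ℝ} {b g : ℝ}

lemma IsFeasible.hires_eq_zero (hp : p.IsFeasible σ b g) {t : ℕ} (ht : t ∈ Ioc (I.τ m) I.T)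
    (h : p.hires J t = 0) (i : Fin I.n) : p.x J i t = 0 :=
  (Finset.sum_eq_zero_iff_of_nonneg fun i _ => hp.x_nonneg J i t ht).1 h i (Finset.mem_univ i)

/-- The repaired plan. -/
noncomputable def repair (p : I.Plan m) (U hi : ℝ) : I.Plan m where
  x := fun J i t => p.x J i t * (p.newHire U hi J t / p.hires J t)
  Y := fun J j => p.newRelease U hi J j
  lam := p.lam
  θ := p.θ

lemma IsFeasible.hires_repair (hp : p.IsFeasible σ b g) {t : ℕ} (ht : t ∈ Ioc (I.τ m) I.T) :
    (p.repair U hi).hires J t = p.newHire U hi J t := by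
  simp only [hires, repair]
  rw [← Finset.sum_mul]
  -- The ratio is then a division by zero, but the new hires are squeezed to zero as well.
  by_cases h : p.hires J t = 0
  · have h1 := hp.newHire_nonneg (U := U) (hi := hi) (J := J) ht
    have h2 := hp.newHire_le (U := U) (hi := hi) (J := J) ht
    have h3 : p.newHire U hi J t = 0 := by linarith
    rw [h3]; simp
  · exact mul_div_cancel₀ _ h

lemma IsFeasible.repair_x_mem (hp : p.IsFeasible σ b g) (i : Fin I.n) {t : ℕ}
    (ht : t ∈ Ioc (I.τ m) I.T) :
    0 ≤ (p.repair U hi).x J i t ∧ (p.repair U hi).x J i t ≤ p.x J i t := by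
  have h0 := hp.hires_nonneg (J := J) ht
  have h1 := hp.newHire_nonneg (U := U) (hi := hi) (J := J) ht
  have h2 := hp.newHire_le (U := U) (hi := hi) (J := J) ht
  exact ⟨mul_nonneg (hp.x_nonneg J i t ht) (div_nonneg h1 h0),
    mul_le_of_le_one_right (hp.x_nonneg J i t ht) (div_le_one_of_le₀ h2 h0)⟩

/-- The quantity `hi - Δ (τ m)` is the current lower endpoint, and the level uses the smaller `Δ` of
a later day. -/
lemma IsFeasible.level_nonneg (hp : p.IsFeasible σ b g) (hm : m < I.L) (hU : 0 ≤ U)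
    (hhi : 0 ≤ hi - I.Δ (I.τ m)) : 0 ≤ p.level U hi J := by
  have h0 : m ∈ Ico m I.L := ⟨le_rfl, hm⟩
  refine le_min (hp.base_nonneg hm hU) ?_
  have := Δ_anti (Config.le_day J h0) ((Config.day_le J h0).trans (τ_le_T hm))
  linarith

lemma IsFeasible.net_repair (hp : p.IsFeasible σ b g) (hm : m < I.L) :
    U + (p.repair U hi).net J = max (U + p.net J) (p.level U hi J) := by
  have := newStock (U := U) (hi := hi) (J := J) hm hp (ℓ := I.L) hm le_rfl
  rw [I.τ_last, stock_T _ _ _ hm.le] at this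
  rw [← this, net]
  congr 2
  refine Finset.sum_congr rfl fun t ht => hp.hires_repair ?_
  simpa using ht

/-- Hires and releases only shrink, and the final number of workers only grows. Overstaffing is the
one critical constraint: the number grows at most to the level, which is below `hi - Δ` of the first
switching day, and by `drop_add_le` the final lower endpoint is not smaller than that. -/
lemma IsFeasible.repair (hp : p.IsFeasible σ b g) (hm : m < I.L) (hg : g = hi - U) :
    (p.repair U hi).IsFeasible σ b g := by
  have hrel : ∀ J, ∀ j ∈ Ico m I.L, 0 ≤ (p.repair U hi).Y J j ∧ (p.repair U hi).Y J j ≤ p.Y J j :=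
    fun J j hj => ⟨hp.newRelease_nonneg hj, hp.newRelease_le hj⟩
  refine ⟨fun J i t ht => (hp.repair_x_mem i ht).1, fun J j hj => (hrel J j hj).1,
    hp.lam_nonneg, hp.θ_nonneg, ?_, fun J J' j hj h => hp.newRelease_congr hm hj h, ?_, ?_, ?_,
    ?_, ?_⟩
  · intro J J' t ht h i
    simp only [Plan.repair]
    rw [hp.x_indist J J' t ht h, hp.newHire_congr hm ht h, hp.hires_congr ht h]
  · refine fun J i => le_trans (Finset.sum_le_sum fun t ht => ?_) (hp.supply J i)
    exact mul_le_mul_of_nonneg_left (hp.repair_x_mem i (by simpa using ht)).2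
      (one_div_nonneg.2 (ρ_pos i t).le)
  · intro J j hj hf
    have h1 := hrel J j hj
    rw [hp.prohibited J j hj hf] at h1
    exact le_antisymm h1.2 h1.1
  · refine fun J => le_trans (add_le_add ?_ ?_) (hp.budget J)
    · exact Finset.sum_le_sum fun i _ => Finset.sum_le_sum fun t ht =>
        mul_le_mul_of_nonneg_left (hp.repair_x_mem i (by simpa using ht)).2 (I.wage_nonneg i t)
    · exact Finset.sum_le_sum fun j hj =>
        mul_le_mul_of_nonneg_left (hrel J j (by simpa using hj)).2 ENNReal.toReal_nonneg
  · intro J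
    have h1 := hp.net_repair (U := U) (hi := hi) (J := J) hm
    have h2 := hp.overstaffing J
    have h3 := drop_add_le hm J
    have h4 : p.level U hi J ≤ hi - I.Δ (Config.day J m) := min_le_right _ _
    have h5 := hp.lam_nonneg J
    show _ ≤ p.lam J
    rcases max_cases (U + p.net J) (p.level U hi J) with h | h <;> linarith
  · intro J
    have h1 := hp.net_repair (U := U) (hi := hi) (J := J) hm
    have h2 := hp.understaffing J
    have h3 := le_max_left (U + p.net J) (p.level U hi J)
    show _ ≤ p.θ J
    linarith

/-! ### Distributing releases over the pools -/

/-- Weights of the pools in the distribution of the releases of epoch `j`, when `cum` has been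
released before: `v` in the first epoch, and the number of workers in the later ones. -/
noncomputable def poolWeight (p : I.Plan m) (hired : Fin I.n → ℝ) (v : I.Config m → Fin I.n → ℝ)
    (J : I.Config m) (cum : Fin I.n → ℝ) (j : ℕ) (i : Fin I.n) : ℝ :=
  if j = m then v J i
  else hired i + ∑ t ∈ Finset.Ioc (I.τ m) (I.τ (j + 1)), p.x J i t - cum i

/-- Releases of the epochs before epoch `j`, distributed over the pools. -/
noncomputable def cumRelease (p : I.Plan m) (hired : Fin I.n → ℝ) (v : I.Config m → Fin I.n → ℝ)
    (J : I.Config m) : ℕ → Fin I.n → ℝ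
  | 0 => 0
  | j + 1 => fun i => if j < m then 0 else
      cumRelease p hired v J j i
        + p.poolWeight hired v J (cumRelease p hired v J j) j i
          * (p.Y J j / ∑ i', p.poolWeight hired v J (cumRelease p hired v J j) j i')

variable {hired : Fin I.n → ℝ} {v : I.Config m → Fin I.n → ℝ}

lemma cumRelease_self : p.cumRelease hired v J m = 0 := by
  cases m with
  | zero => rfl
  | succ m => funext i; simp [cumRelease]

lemma cumRelease_succ {j : ℕ} (hj : m ≤ j) (i : Fin I.n) :
    p.cumRelease hired v J (j + 1) i = p.cumRelease hired v J j i
      + p.poolWeight hired v J (p.cumRelease hired v J j) j i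
        * (p.Y J j / ∑ i', p.poolWeight hired v J (p.cumRelease hired v J j) j i') := by
  rw [cumRelease]
  exact if_neg (by omega)

/-- Each pool releases the fraction `Y / ∑ w` of its weight. The fraction is at most one because the
total number of workers stays nonnegative (`htot`; `hvY` in the first epoch), so no pool releases
more than it holds, and the induction continues. -/
lemma IsFeasible.cumRelease_aux (hp : p.IsFeasible σ b g) (hhired : ∀ i, 0 ≤ hired i)
    (hv : ∀ i, 0 ≤ v J i)
    (hv' : ∀ i, v J i ≤ hired i + ∑ t ∈ Finset.Ioc (I.τ m) (I.τ (m + 1)), p.x J i t)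
    (hvY : p.Y J m ≤ ∑ i, v J i)
    (htot : ∀ ℓ ∈ Ico m I.L, ∑ j ∈ Finset.Ico m (ℓ + 1), p.Y J j
      ≤ ∑ i, hired i + ∑ t ∈ Finset.Ioc (I.τ m) (I.τ (ℓ + 1)), p.hires J t)
    {j : ℕ} (hmj : m ≤ j) (hj : j ≤ I.L) :
    (∀ i, p.cumRelease hired v J j i ≤ hired i + ∑ t ∈ Finset.Ioc (I.τ m) (I.τ j), p.x J i t) ∧
    (∑ i, p.cumRelease hired v J j i = ∑ j ∈ Finset.Ico m j, p.Y J j) ∧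
    (j < I.L → (∀ i, 0 ≤ p.poolWeight hired v J (p.cumRelease hired v J j) j i) ∧
      p.Y J j ≤ ∑ i, p.poolWeight hired v J (p.cumRelease hired v J j) j i) := by
  have weights : ∀ j, m ≤ j → j < I.L →
      (∀ i, p.cumRelease hired v J j i ≤ hired i + ∑ t ∈ Finset.Ioc (I.τ m) (I.τ j), p.x J i t) →
      (∑ i, p.cumRelease hired v J j i = ∑ j ∈ Finset.Ico m j, p.Y J j) →
      ((∀ i, 0 ≤ p.poolWeight hired v J (p.cumRelease hired v J j) j i) ∧
      (∀ i, p.poolWeight hired v J (p.cumRelease hired v J j) j i ≤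
        hired i + ∑ t ∈ Finset.Ioc (I.τ m) (I.τ (j + 1)), p.x J i t
          - p.cumRelease hired v J j i) ∧
      p.Y J j ≤ ∑ i, p.poolWeight hired v J (p.cumRelease hired v J j) j i) := by
    intro j hmj hjL h1 h2
    by_cases h : j = m
    · subst h
      simp only [poolWeight, if_true]
      refine ⟨hv, fun i => ?_, hvY⟩
      rw [cumRelease_self]
      simpa using hv' i
    · simp only [poolWeight, if_neg h]
      refine ⟨fun i => ?_, fun i => le_rfl, ?_⟩
      · have : ∑ t ∈ Finset.Ioc (I.τ m) (I.τ j), p.x J i t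
            ≤ ∑ t ∈ Finset.Ioc (I.τ m) (I.τ (j + 1)), p.x J i t := by
          refine Finset.sum_le_sum_of_subset_of_nonneg
            (Finset.Ioc_subset_Ioc_right (I.τ_lt j hjL).le) fun t ht _ => ?_
          rw [Finset.mem_Ioc] at ht
          exact hp.x_nonneg J i t ⟨ht.1, ht.2.trans (τ_le_T hjL)⟩
        linarith [h1 i]
      · have := htot j ⟨hmj, hjL⟩
        rw [Finset.sum_Ico_succ_top hmj] at this
        rw [Finset.sum_sub_distrib, Finset.sum_add_distrib, h2, Finset.sum_comm]
        simp only [hires] at this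
        linarith
  have main : (∀ i, p.cumRelease hired v J j i
        ≤ hired i + ∑ t ∈ Finset.Ioc (I.τ m) (I.τ j), p.x J i t) ∧
      (∑ i, p.cumRelease hired v J j i = ∑ j ∈ Finset.Ico m j, p.Y J j) := by
    induction j, hmj using Nat.le_induction with
    | base => rw [cumRelease_self]; simp [hhired]
    | succ j hmj ih =>
      obtain ⟨h1, h2⟩ := ih (by omega)
      obtain ⟨w0, w1, wY⟩ := weights j hmj (by omega) h1 h2
      have hY := hp.Y_nonneg J j ⟨hmj, by omega⟩
      set w := p.poolWeight hired v J (p.cumRelease hired v J j) j with hw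
      have hW : 0 ≤ ∑ i, w i := Finset.sum_nonneg fun i _ => w0 i
      constructor
      · intro i
        rw [cumRelease_succ hmj]
        have h3 : w i * (p.Y J j / ∑ i', w i') ≤ w i :=
          mul_le_of_le_one_right (w0 i) (div_le_one_of_le₀ wY hW)
        have := w1 i
        rw [← hw]
        linarith
      · simp only [cumRelease_succ hmj]
        rw [Finset.sum_add_distrib, ← hw, ← Finset.sum_mul, h2, Finset.sum_Ico_succ_top hmj]
        congr 1
        -- Zero total weight forces zero releases, so the division by zero does no harm.
        by_cases h : ∑ i, w i = 0
        · have : p.Y J j = 0 := by linarith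
          rw [this]; simp
        · exact mul_div_cancel₀ _ h
  refine ⟨main.1, main.2, fun hjL => ?_⟩
  obtain ⟨w0, w1, wY⟩ := weights j hmj hjL main.1 main.2
  exact ⟨w0, wY⟩

lemma IsFeasible.cumRelease_congr (hp : p.IsFeasible σ b g) (hm : m < I.L)
    (hv : ∀ J J', Config.day J m = Config.day J' m → v J = v J') {J' : I.Config m}
    {j : ℕ} (hmj : m ≤ j) (hj : j ≤ I.L) (h : Indist (I.τ j) J J') :
    p.cumRelease hired v J j = p.cumRelease hired v J' j := by
  induction j, hmj using Nat.le_induction with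
  | base => rw [cumRelease_self, cumRelease_self]
  | succ j hmj ih =>
    have ih := ih (by omega) (h.mono (I.τ_lt j hj).le)
    have hw : p.poolWeight hired v J (p.cumRelease hired v J j) j
        = p.poolWeight hired v J' (p.cumRelease hired v J' j) j := by
      funext i
      unfold poolWeight
      rw [hv J J' (h.day_eq' ⟨le_rfl, hm⟩ (τ_mono (by omega) hj)), ih]
      congr 3
      refine Finset.sum_congr rfl fun t ht => ?_
      rw [Finset.mem_Ioc] at ht
      exact hp.x_indist J J' t ⟨ht.1, ht.2.trans (τ_le_T hj)⟩ (h.mono ht.2) i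
    funext i
    rw [cumRelease_succ hmj, cumRelease_succ hmj, hw, ih, hp.Y_indist J J' j ⟨hmj, hj⟩ h]

/-- The releases of an aggregated plan that keeps the number of workers nonnegative can be
distributed over the pools. -/
lemma IsFeasible.exists_distribution (hp : p.IsFeasible σ b g) (hm : m < I.L)
    (hhired : ∀ i, 0 ≤ hired i) (hv : ∀ J i, 0 ≤ v J i)
    (hv' : ∀ J i, v J i ≤ hired i + ∑ t ∈ Finset.Ioc (I.τ m) (I.τ (m + 1)), p.x J i t)
    (hvY : ∀ J, p.Y J m ≤ ∑ i, v J i)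
    (hvc : ∀ J J', Config.day J m = Config.day J' m → v J = v J')
    (htot : ∀ J, ∀ ℓ ∈ Ico m I.L, ∑ j ∈ Finset.Ico m (ℓ + 1), p.Y J j
      ≤ ∑ i, hired i + ∑ t ∈ Finset.Ioc (I.τ m) (I.τ (ℓ + 1)), p.hires J t) :
    ∃ y : I.Config m → Fin I.n → ℕ → ℝ, (∀ J i, ∀ j ∈ Ico m I.L, 0 ≤ y J i j) ∧
      (∀ J, ∀ j ∈ Ico m I.L, ∑ i, y J i j = p.Y J j) ∧
      (∀ J J', ∀ j ∈ Ico m I.L, Indist (I.τ (j + 1)) J J' → ∀ i, y J i j = y J' i j) ∧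
      (∀ J i, ∀ ℓ ∈ Ico m I.L, ∑ j ∈ Finset.Icc m ℓ, y J i j
        ≤ hired i + ∑ t ∈ Finset.Ioc (I.τ m) (I.τ (ℓ + 1)), p.x J i t) ∧
      ∀ J i, y J i m ≤ v J i := by
  have aux := fun J j (hmj : m ≤ j) (hj : j ≤ I.L) =>
    hp.cumRelease_aux hhired (hv J) (hv' J) (hvY J) (htot J) hmj hj
  refine ⟨fun J i j => p.cumRelease hired v J (j + 1) i - p.cumRelease hired v J j i,
    ?_, ?_, ?_, ?_, ?_⟩
  · intro J i j hj
    obtain ⟨w0, wY⟩ := (aux J j hj.1 hj.2.le).2.2 hj.2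
    simp only
    rw [cumRelease_succ hj.1, add_sub_cancel_left]
    exact mul_nonneg (w0 i) (div_nonneg (hp.Y_nonneg J j hj) (Finset.sum_nonneg fun i _ => w0 i))
  · intro J j hj
    rw [Finset.sum_sub_distrib, (aux J j hj.1 hj.2.le).2.1, (aux J (j + 1) (hj.1.trans
      (Nat.le_succ j)) hj.2).2.1, Finset.sum_Ico_succ_top hj.1]
    ring
  · intro J J' j hj h i
    simp only
    rw [hp.cumRelease_congr hm hvc (hj.1.trans (Nat.le_succ j)) hj.2 h,
      hp.cumRelease_congr hm hvc hj.1 hj.2.le (h.mono (I.τ_lt j hj.2).le)]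
  · intro J i ℓ hℓ
    have : ∑ j ∈ Finset.Icc m ℓ,
        (p.cumRelease hired v J (j + 1) i - p.cumRelease hired v J j i)
        = p.cumRelease hired v J (ℓ + 1) i := by
      rw [← Finset.Ico_succ_right_eq_Icc]
      show ∑ j ∈ Finset.Ico m (ℓ + 1), _ = _
      rw [Finset.sum_Ico_sub (fun j => p.cumRelease hired v J j i) (hℓ.1.trans (Nat.le_succ ℓ)),
        cumRelease_self]
      simp
    rw [this]
    exact (aux J (ℓ + 1) (hℓ.1.trans (Nat.le_succ ℓ)) hℓ.2).1 i
  · intro J i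
    obtain ⟨w0, wY⟩ := (aux J m le_rfl hm.le).2.2 hm
    have h1 : p.poolWeight hired v J (p.cumRelease hired v J m) m i = v J i := if_pos rfl
    simp only
    rw [cumRelease_succ le_rfl, add_sub_cancel_left, h1]
    exact mul_le_of_le_one_right (hv J i)
      (div_le_one_of_le₀ wY (Finset.sum_nonneg fun i _ => w0 i))

lemma IsFeasible.congr {p' : I.Plan m} (hp : p.IsFeasible σ b g) (hx : p'.x = p.x)
    (hY : ∀ J, ∀ j ∈ Ico m I.L, p'.Y J j = p.Y J j) (hl : p'.lam = p.lam) (hθ : p'.θ = p.θ) :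
    p'.IsFeasible σ b g := by
  have hY' : ∀ J, ∀ j ∈ Finset.Ico m I.L, p'.Y J j = p.Y J j :=
    fun J j hj => hY J j (by simpa using hj)
  have hnet : ∀ J, p'.net J = p.net J := by
    intro J
    simp only [net, hires, hx]
    rw [Finset.sum_congr rfl (hY' J)]
  have hspend : ∀ J, p'.spend J = p.spend J := by
    intro J
    simp only [spend, hx]
    congr 1
    exact Finset.sum_congr rfl fun j hj => by rw [hY' J j hj]
  refine ⟨by rw [hx]; exact hp.x_nonneg, fun J j hj => by rw [hY J j hj]; exact hp.Y_nonneg J j hj,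
    by rw [hl]; exact hp.lam_nonneg, by rw [hθ]; exact hp.θ_nonneg, by rw [hx]; exact hp.x_indist,
    fun J J' j hj h => by rw [hY J j hj, hY J' j hj]; exact hp.Y_indist J J' j hj h,
    by rw [hx]; exact hp.supply,
    fun J j hj h => by rw [hY J j hj]; exact hp.prohibited J j hj h,
    fun J => by rw [hspend]; exact hp.budget J,
    fun J => by rw [hnet, hl]; exact hp.overstaffing J,
    fun J => by rw [hnet, hθ]; exact hp.understaffing J⟩

end Plan

/-! ### The oracle -/

/-- Hires cancelled by the oracle on the days up to `t`, when the canonical total hires are `X` and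
the upper endpoint has decreased by `D t` since day `t₀`. -/
noncomputable def cancelled (X D : ℕ → ℝ) (t₀ : ℕ) : ℕ → ℝ
  | 0 => 0
  | t + 1 => if t + 1 ≤ t₀ then 0 else min (cancelled X D t₀ t + X (t + 1)) (D (t + 1))

/-- The fraction of the canonical hires of day `t` that is kept by the oracle. -/
noncomputable def fill (X D : ℕ → ℝ) (t₀ t : ℕ) : ℝ :=
  1 - (cancelled X D t₀ t - cancelled X D t₀ (t - 1)) / X t

section oracle

variable {X D D' : ℕ → ℝ} {t₀ t₁ t : ℕ}

lemma cancelled_self : cancelled X D t₀ t₀ = 0 := by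
  cases t₀ with
  | zero => rfl
  | succ t => simp [cancelled]

lemma cancelled_succ (h : t₀ ≤ t) :
    cancelled X D t₀ (t + 1) = min (cancelled X D t₀ t + X (t + 1)) (D (t + 1)) := by
  rw [cancelled, if_neg (by omega)]

lemma cancelled_le (hD₀ : D t₀ = 0) (h : t₀ ≤ t) : cancelled X D t₀ t ≤ D t := by
  induction t, h using Nat.le_induction with
  | base => rw [cancelled_self, hD₀]
  | succ t ht _ => rw [cancelled_succ ht]; exact min_le_right _ _

lemma cancelled_sub_nonneg (hX : ∀ t ∈ Ioc t₀ t₁, 0 ≤ X t) (hD₀ : D t₀ = 0)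
    (hD : ∀ t, t₀ ≤ t → t < t₁ → D t ≤ D (t + 1)) (ht : t ∈ Ioc t₀ t₁) :
    0 ≤ cancelled X D t₀ t - cancelled X D t₀ (t - 1) := by
  obtain ⟨u, rfl⟩ : ∃ u, t = u + 1 := ⟨t - 1, by have := ht.1; omega⟩
  have h0 : t₀ ≤ u := by have := ht.1; omega
  rw [cancelled_succ h0, Nat.add_sub_cancel, sub_nonneg]
  refine le_min (by linarith [hX _ ht]) ((cancelled_le hD₀ h0).trans (hD u h0 ?_))
  have := ht.2; omega

lemma cancelled_sub_le (ht : t₀ < t) :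
    cancelled X D t₀ t - cancelled X D t₀ (t - 1) ≤ X t := by
  obtain ⟨u, rfl⟩ : ∃ u, t = u + 1 := ⟨t - 1, by omega⟩
  rw [cancelled_succ (by omega), Nat.add_sub_cancel]
  linarith [min_le_left (cancelled X D t₀ u + X (u + 1)) (D (u + 1))]

lemma fill_nonneg (hX : ∀ t ∈ Ioc t₀ t₁, 0 ≤ X t) (ht : t ∈ Ioc t₀ t₁) : 0 ≤ fill X D t₀ t :=
  sub_nonneg.2 (div_le_one_of_le₀ (cancelled_sub_le ht.1) (hX t ht))

lemma fill_le_one (hX : ∀ t ∈ Ioc t₀ t₁, 0 ≤ X t) (hD₀ : D t₀ = 0)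
    (hD : ∀ t, t₀ ≤ t → t < t₁ → D t ≤ D (t + 1)) (ht : t ∈ Ioc t₀ t₁) : fill X D t₀ t ≤ 1 :=
  sub_le_self _ (div_nonneg (cancelled_sub_nonneg hX hD₀ hD ht) (hX t ht))

lemma mul_fill (hX : ∀ t ∈ Ioc t₀ t₁, 0 ≤ X t) (hD₀ : D t₀ = 0)
    (hD : ∀ t, t₀ ≤ t → t < t₁ → D t ≤ D (t + 1)) (ht : t ∈ Ioc t₀ t₁) :
    X t * fill X D t₀ t = X t - (cancelled X D t₀ t - cancelled X D t₀ (t - 1)) := by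
  unfold fill
  -- Without canonical hires the cancellation lies between zero and `X t = 0`.
  by_cases h : X t = 0
  · have h1 := cancelled_sub_nonneg hX hD₀ hD ht
    have h2 := cancelled_sub_le (X := X) (D := D) ht.1
    rw [h] at h2 ⊢
    linarith
  · field_simp

/-- The oracle cancels more hires on each day if the upper endpoint decreases faster. -/
lemma fill_anti (hX : ∀ t ∈ Ioc t₀ t₁, 0 ≤ X t) (hD₀ : D t₀ = 0) (hD₀' : D' t₀ = 0)
    (hDD' : ∀ t, t₀ ≤ t → t < t₁ → D (t + 1) - D t ≤ D' (t + 1) - D' t) (ht : t ∈ Ioc t₀ t₁) :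
    fill X D' t₀ t ≤ fill X D t₀ t := by
  -- The unused allowance `D - cancelled` is ordered in the same way as the increments of `D`. The
  -- hires cancelled on a day are the smaller of the canonical hires and the allowance carried over
  -- plus the new increment, so they are ordered too.
  have key : ∀ t, t₀ ≤ t → t ≤ t₁ → D t - cancelled X D t₀ t ≤ D' t - cancelled X D' t₀ t := by
    intro t h
    induction t, h using Nat.le_induction with
    | base => intro _; simp [cancelled_self, hD₀, hD₀']
    | succ t h ih =>
      intro h1
      have ih := ih (by omega)
      have := hDD' t h (by omega)
      rw [cancelled_succ h, cancelled_succ h]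
      rcases min_cases (cancelled X D t₀ t + X (t + 1)) (D (t + 1)) with h | h <;>
      rcases min_cases (cancelled X D' t₀ t + X (t + 1)) (D' (t + 1)) with h' | h' <;> linarith
  refine sub_le_sub_left (div_le_div_of_nonneg_right ?_ (hX t ht)) _
  obtain ⟨u, rfl⟩ : ∃ u, t = u + 1 := ⟨t - 1, by have := ht.1; omega⟩
  have h0 : t₀ ≤ u := by have := ht.1; omega
  have h1 : u < t₁ := by have := ht.2; omega
  have h2 := key u h0 h1.le
  have h3 := hDD' u h0 h1
  rw [cancelled_succ h0, cancelled_succ h0, Nat.add_sub_cancel]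
  rcases min_cases (cancelled X D t₀ u + X (u + 1)) (D (u + 1)) with h | h <;>
  rcases min_cases (cancelled X D' t₀ u + X (u + 1)) (D' (u + 1)) with h' | h' <;> linarith

lemma cancelled_congr (hD : ∀ s ∈ Ioc t₀ t, D s = D' s) :
    cancelled X D t₀ t = cancelled X D' t₀ t := by
  induction t with
  | zero => rfl
  | succ t ih =>
    rw [cancelled, cancelled]
    split_ifs with h
    · rfl
    · rw [ih fun s hs => hD s ⟨hs.1, hs.2.trans (Nat.le_succ t)⟩, hD (t + 1) ⟨by omega, le_rfl⟩]

end oracle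

/-! ### Tie-breaking -/

/-- The canonical hires that survive in epoch `m` even if the upper endpoint decreases as fast as
possible. -/
noncomputable def LPVars.secureHire {m : ℕ} (z : I.LPVars m) (hm : m < I.L) (i : Fin I.n)
    (t : ℕ) : ℝ :=
  z.canonicalHire hm i t * fill (fun t => ∑ i, z.canonicalHire hm i t)
    (fun t => I.Δ (I.τ m) - I.Δ t) (I.τ m) t

/-- A solution whose canonical releases can be implemented for all predictions, and which does
not hire after a switching day if it releases workers in the same epoch. -/
structure LPVars.TieBroken {m : ℕ} (S : StaffingState I.n) (z : I.LPVars m) (hm : m < I.L) :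
    Prop where
  no_waste : ∀ k, (∃ i, z.canonicalRelease k i ≠ 0) →
    ∀ i, ∀ t ∈ Ioc (k : ℕ) (I.τ (m + 1)), z.x (I.switchAt m k) i t = 0
  implementable : ∀ k i, z.canonicalRelease k i
    ≤ S.hired i + ∑ t ∈ Finset.Ioc (I.τ m) k, z.secureHire hm i t

/-- The state satisfies the sign conditions and its interval has the maximal length. -/
structure IsRegularState (m : ℕ) (S : StaffingState I.n) : Prop where
  hired_nonneg : ∀ i, 0 ≤ S.hired i
  supply_nonneg : ∀ i, 0 ≤ S.supply i
  budget_ne_top : S.budget ≠ ⊤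
  lo_eq : S.lo = S.hi - I.Δ (I.τ m)
  lo_nonneg : 0 ≤ S.lo

/-- The plan is repaired and its releases are distributed, those of the first epoch within the
workers that survive even the fastest possible fall of the upper endpoint. The errors `lam` and `θ`
are untouched, so the objective does not change. -/
theorem Plan.IsFeasible.exists_tieBroken {m : ℕ} (hm : m < I.L) {S : StaffingState I.n}
    (hS : I.IsRegularState m S) {p : I.Plan m}
    (hp : p.IsFeasible (fun i => S.supply i / I.ρ i (I.τ m)) S.budget.toReal
      (S.hi - ∑ i, S.hired i)) :
    ∃ z : I.LPVars m, z.IsFeasible S ∧ z.lam = p.lam ∧ z.θ = p.θ ∧ z.TieBroken S hm := by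
  have h0 : m ∈ Ico m I.L := ⟨le_rfl, hm⟩
  set U := ∑ i, S.hired i with hU
  have hU0 : 0 ≤ U := Finset.sum_nonneg fun i _ => hS.hired_nonneg i
  have hlo := hS.lo_nonneg
  rw [hS.lo_eq] at hlo
  set q := p.repair U S.hi with hq
  have hqf := hp.repair (hi := S.hi) hm rfl
  rw [← hq] at hqf
  set Jl := I.switchAt m ⟨I.τ (m + 1), (I.τ_lt m hm).le, le_rfl⟩ with hJl
  have hJlday : Config.day Jl m = I.τ (m + 1) := Config.day_switchAt hm _
  set X : ℕ → ℝ := fun t => ∑ i, q.x Jl i t with hX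
  set D : ℕ → ℝ := fun t => I.Δ (I.τ m) - I.Δ t with hD
  have hXn : ∀ t ∈ Ioc (I.τ m) (I.τ (m + 1)), 0 ≤ X t :=
    fun t ht => hqf.hires_nonneg (J := Jl) ⟨ht.1, ht.2.trans (τ_le_T hm)⟩
  have hD0 : D (I.τ m) = 0 := sub_self _
  have hDm : ∀ t, I.τ m ≤ t → t < I.τ (m + 1) → D t ≤ D (t + 1) := by
    intro t _ ht
    have := I.Δ_succ_le t (ht.trans_le (τ_le_T hm))
    simp only [hD]; linarith
  have hxeq : ∀ (J : I.Config m) i, ∀ t ∈ Ioc (I.τ m) (Config.day J m), q.x Jl i t = q.x J i t := by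
    intro J i t ht
    have hle := ht.2.trans (Config.day_le J h0)
    exact hqf.x_indist _ _ t ⟨ht.1, hle.trans (τ_le_T hm)⟩
      (indist_of_le_day hm (hle.trans hJlday.ge) ht.2) i
  have hmem : ∀ J : I.Config m, ∀ t ∈ Finset.Ioc (I.τ m) (Config.day J m),
      t ∈ Ioc (I.τ m) (I.τ (m + 1)) := by
    intro J t ht
    rw [Finset.mem_Ioc] at ht
    exact ⟨ht.1, ht.2.trans (Config.day_le J h0)⟩
  have hxnn : ∀ i, ∀ t ∈ Ioc (I.τ m) (I.τ (m + 1)), 0 ≤ q.x Jl i t :=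
    fun i t ht => hqf.x_nonneg Jl i t ⟨ht.1, ht.2.trans (τ_le_T hm)⟩
  -- Workers of each pool that are certain to be present on the switching day: initial workers and
  -- secure hires. The canonical hires may be used since they agree with those of `J` up to its
  -- switching day.
  let v : I.Config m → Fin I.n → ℝ := fun J i =>
    S.hired i + ∑ t ∈ Finset.Ioc (I.τ m) (Config.day J m), q.x Jl i t * fill X D (I.τ m) t
  have hv0 : ∀ J i, 0 ≤ v J i := fun J i => add_nonneg (hS.hired_nonneg i)
    (Finset.sum_nonneg fun t ht => mul_nonneg (hxnn i t (hmem J t ht))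
      (fill_nonneg hXn (hmem J t ht)))
  have hv1 : ∀ J i, v J i ≤ S.hired i + ∑ t ∈ Finset.Ioc (I.τ m) (I.τ (m + 1)), q.x J i t := by
    intro J i
    refine add_le_add le_rfl (le_trans (Finset.sum_le_sum (g := fun t => q.x J i t)
      fun t ht => ?_) ?_)
    · rw [← hxeq J i t (by simpa using ht)]
      exact mul_le_of_le_one_right (hxnn i t (hmem J t ht)) (fill_le_one hXn hD0 hDm (hmem J t ht))
    · refine Finset.sum_le_sum_of_subset_of_nonneg
        (Finset.Ioc_subset_Ioc_right (Config.day_le J h0)) fun t ht _ => ?_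
      rw [Finset.mem_Ioc] at ht
      exact hqf.x_nonneg J i t ⟨ht.1, ht.2.trans (τ_le_T hm)⟩
  -- At most `Δ (τ m) - Δ k` hires can be cancelled by the switching day `k`, while the release is
  -- at most `base - level`. When the level is `hi - Δ k`, the former leaves enough workers because
  -- the lower endpoint `hi - Δ (τ m)` is nonnegative; otherwise the release bound is zero.
  have hv2 : ∀ J, q.Y J m ≤ ∑ i, v J i := by
    intro J
    have hXJ : ∀ t ∈ Finset.Ioc (I.τ m) (Config.day J m), X t = p.hires J t := by
      intro t ht
      have h1 := hmem J t ht
      have htT : t ∈ Ioc (I.τ m) I.T := ⟨h1.1, h1.2.trans (τ_le_T hm)⟩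
      rw [Finset.mem_Ioc] at ht
      rw [show X t = q.hires J t from Finset.sum_congr rfl fun i _ => hxeq J i t ht, hq,
        hp.hires_repair htT]
      exact if_pos ht.2
    have hsum : ∑ i, v J i = p.base U J - cancelled X D (I.τ m) (Config.day J m) := by
      have h2 := sum_Ioc_telescope (cancelled X D (I.τ m)) (Config.le_day J h0)
      rw [cancelled_self, sub_zero] at h2
      simp only [v]
      rw [Finset.sum_add_distrib, Finset.sum_comm, ← h2, Plan.base, add_sub_assoc,
        ← Finset.sum_sub_distrib]
      congr 1
      refine Finset.sum_congr rfl fun t ht => ?_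
      rw [← Finset.sum_mul, ← hXJ t ht]
      exact mul_fill hXn hD0 hDm (hmem J t ht)
    have h1 : q.Y J m ≤ p.base U J - p.level U S.hi J := Plan.newRelease_first_le
    refine h1.trans ?_
    have h3 := cancelled_le (X := X) hD0 (Config.le_day J h0)
    have h4 : 0 ≤ ∑ i, v J i := Finset.sum_nonneg fun i _ => hv0 J i
    rw [hsum] at h4 ⊢
    simp only [hD] at h3
    rw [Plan.level]
    rcases min_cases (p.base U J) (S.hi - I.Δ (Config.day J m)) with h | h <;> linarith
  have hv3 : ∀ J J', Config.day J m = Config.day J' m → v J = v J' := by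
    intro J J' h
    simp only [v, h]
  -- The repaired total is at least the level at the end of every epoch, and the level is
  -- nonnegative.
  have hv4 : ∀ J, ∀ ℓ ∈ Ico m I.L, ∑ j ∈ Finset.Ico m (ℓ + 1), q.Y J j
      ≤ ∑ i, S.hired i + ∑ t ∈ Finset.Ioc (I.τ m) (I.τ (ℓ + 1)), q.hires J t := by
    intro J ℓ hℓ
    have h1 := Plan.newStock (U := U) (hi := S.hi) (J := J) hm hp
      (show m + 1 ≤ ℓ + 1 by have := hℓ.1; omega) hℓ.2
    have h2 := hp.level_nonneg (J := J) hm hU0 hlo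
    have h3 := le_max_right (p.stock U J (I.τ (ℓ + 1))) (p.level U S.hi J)
    have h4 : ∑ t ∈ Finset.Ioc (I.τ m) (I.τ (ℓ + 1)), q.hires J t
        = ∑ t ∈ Finset.Ioc (I.τ m) (I.τ (ℓ + 1)), p.newHire U S.hi J t := by
      refine Finset.sum_congr rfl fun t ht => ?_
      rw [Finset.mem_Ioc] at ht
      exact hp.hires_repair ⟨ht.1, ht.2.trans (τ_le_T hℓ.2)⟩
    rw [h4]
    show ∑ j ∈ Finset.Ico m (ℓ + 1), p.newRelease U S.hi J j ≤ _
    linarith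
  obtain ⟨y, y_nonneg, y_sum, y_indist, y_release, y_le⟩ := hqf.exists_distribution hm
    (hired := S.hired) (v := v) hS.hired_nonneg hv0 hv1 hv2 hv3 hv4
  refine ⟨⟨q.x, y, p.lam, p.θ⟩, ?_, rfl, rfl, ?_⟩
  · refine LPVars.isFeasible_of_toPlan hm.le ?_ hS.lo_eq hS.budget_ne_top y_nonneg y_indist
      y_release
    exact hqf.congr rfl y_sum rfl rfl
  · refine ⟨?_, ?_⟩
    · rintro k ⟨i, hi⟩ i' t ht
      have hk : Config.day (I.switchAt m k) m = k := Config.day_switchAt hm k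
      have hne : q.Y (I.switchAt m k) m ≠ 0 := by
        intro h
        have := y_sum (I.switchAt m k) m h0
        rw [h] at this
        exact hi ((Finset.sum_eq_zero_iff_of_nonneg
          fun i _ => y_nonneg (I.switchAt m k) i m h0).1 this i (Finset.mem_univ i))
      have htT : t ∈ Ioc (I.τ m) I.T := ⟨k.2.1.trans_lt ht.1, ht.2.trans (τ_le_T hm)⟩
      refine hqf.hires_eq_zero htT ?_ i'
      rw [hq, hp.hires_repair htT]
      exact hp.newHire_eq_zero hm hne (by rwa [hk])
    · intro k i
      have := y_le (I.switchAt m k) i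
      simp only [v, Config.day_switchAt hm k] at this
      exact this

/-! ### Costs -/

lemma convexOn_comp_max {f : ℝ → ℝ} (hf : ConvexOn ℝ (Ici 0) f) (hf' : MonotoneOn f (Ici 0)) :
    ConvexOn ℝ univ fun x => f (max 0 x) := by
  have himg : (fun x : ℝ => max 0 x) '' univ ⊆ Ici 0 := by
    rintro _ ⟨x, -, rfl⟩
    exact mem_Ici.2 (le_max_left (0 : ℝ) x)
  have hid : ConvexOn ℝ univ (fun x : ℝ => max 0 x) :=
    (convexOn_const (0 : ℝ) convex_univ).sup (convexOn_id convex_univ)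
  have himg' : (fun x : ℝ => max 0 x) '' univ = Ici 0 := by
    refine himg.antisymm fun x hx => ⟨x, mem_univ x, max_eq_right hx⟩
  refine ConvexOn.comp (g := f) ?_ hid ?_
  · rwa [himg']
  · rwa [himg']

/-- Convexity on the half line alone would permit a jump at zero, which monotonicity excludes. After
composition with the positive part the function is convex on the whole line, where convexity implies
continuity. -/
lemma continuous_comp_max {f : ℝ → ℝ} (hf : ConvexOn ℝ (Ici 0) f) (hf' : MonotoneOn f (Ici 0)) :
    Continuous fun x => f (max 0 x) := by
  rw [← continuousOn_univ]
  exact (convexOn_comp_max hf hf').continuousOn isOpen_univ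

lemma c_nonneg {x : ℝ} (hx : 0 ≤ x) : 0 ≤ I.c x := by
  have := I.c_mono (mem_Ici.2 le_rfl) (mem_Ici.2 hx) hx
  rwa [I.c_zero] at this

lemma C_nonneg {x : ℝ} (hx : 0 ≤ x) : 0 ≤ I.C x := by
  have := I.C_mono (mem_Ici.2 le_rfl) (mem_Ici.2 hx) hx
  rwa [I.C_zero] at this

instance (m : ℕ) : Finite (I.Config m) := inferInstanceAs
  (Finite ((j : Ico m I.L) → Icc (I.τ j) (I.τ (j + 1))))

instance (m : ℕ) : Nonempty (I.Config m) := ⟨fun j => ⟨I.τ j, le_rfl, (I.τ_lt j j.2.2).le⟩⟩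

lemma LPVars.le_objective {m : ℕ} (z : I.LPVars m) (J : I.Config m) :
    max (I.c (z.θ J)) (I.C (z.lam J)) ≤ z.objective :=
  le_ciSup (f := fun J => max (I.c (z.θ J)) (I.C (z.lam J))) (Set.finite_range _).bddAbove J

lemma LPVars.objective_le {m : ℕ} {z : I.LPVars m} {v : ℝ}
    (h : ∀ J, max (I.c (z.θ J)) (I.C (z.lam J)) ≤ v) : z.objective ≤ v := ciSup_le h

/-! ### Optimal solutions -/

/-- Hires and releases for all configurations. -/
abbrev Decisions (I : StaffingInstance) (m : ℕ) : Type :=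
  (I.Config m → Fin I.n → ℕ → ℝ) × (I.Config m → Fin I.n → ℕ → ℝ)

/-- Hires and releases, completed with the least possible over- and understaffing. -/
noncomputable def LPVars.complete {m : ℕ} (S : StaffingState I.n)
    (w : I.Decisions m) : I.LPVars m where
  x := w.1
  y := w.2
  lam := fun J => max 0 (LPVars.final S ⟨w.1, w.2, 0, 0⟩ J - (I.configInterval S J I.T).1)
  θ := fun J => max 0 ((I.configInterval S J I.T).2 - LPVars.final S ⟨w.1, w.2, 0, 0⟩ J)

/-- A compactness argument: supplies bound the hires, and hires bound the releases. The variables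
`lam` and `θ` are unbounded, so they are eliminated by taking their least admissible values, which
keeps the objective continuous in the decisions. -/
theorem exists_isOptimal {m : ℕ} {S : StaffingState I.n}
    (hS : I.IsRegularState m S) : ∃ z : I.LPVars m, z.IsOptimal S := by
  set M : Fin I.n → ℕ → ℝ := fun i t => S.supply i * (I.ρ i t / I.ρ i (I.τ m)) with hM
  have hM0 : ∀ i t, 0 ≤ M i t := fun i t =>
    mul_nonneg (hS.supply_nonneg i) (div_nonneg (ρ_pos i t).le (ρ_pos i _).le)
  set M' : Fin I.n → ℝ := fun i => S.hired i + ∑ t ∈ Finset.Ioc (I.τ m) I.T, M i t with hM'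
  have hM'0 : ∀ i, 0 ≤ M' i := fun i =>
    add_nonneg (hS.hired_nonneg i) (Finset.sum_nonneg fun t _ => hM0 i t)
  let box : Set (I.Decisions m) := (univ.pi fun _ => univ.pi fun i => univ.pi fun t => Icc 0 (M i t)) ×ˢ
    (univ.pi fun _ => univ.pi fun i => univ.pi fun _ => Icc 0 (M' i))
  have hbox : IsCompact box :=
    (isCompact_univ_pi fun _ => isCompact_univ_pi fun i => isCompact_univ_pi fun t =>
      isCompact_Icc).prod
    (isCompact_univ_pi fun _ => isCompact_univ_pi fun i => isCompact_univ_pi fun t =>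
      isCompact_Icc)
  have hmem : ∀ w : I.Decisions m, w ∈ box ↔ (∀ J i t, 0 ≤ w.1 J i t ∧ w.1 J i t ≤ M i t) ∧
      (∀ J i j, 0 ≤ w.2 J i j ∧ w.2 J i j ≤ M' i) := by
    intro w
    simp only [box, Set.mem_prod, Set.mem_univ_pi, Set.mem_Icc]
  let K1 : Set (I.Decisions m) := {w | ∀ (ℓ : Ico m I.L) (J J' : I.Config m),
    (∀ j : Ico m I.L, (j : ℕ) < ℓ → J j = J' j) →
    ∀ i, ∀ t ∈ Ioc (I.τ m) (min (J ℓ : ℕ) (J' ℓ)), w.1 J i t = w.1 J' i t}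
  let K2 : Set (I.Decisions m) := {w | ∀ (ℓ : Ico m I.L) (J J' : I.Config m),
    (∀ j : Ico m I.L, (j : ℕ) ≤ ℓ → J j = J' j) → ∀ i, w.2 J i ℓ = w.2 J' i ℓ}
  let K3 : Set (I.Decisions m) := {w | ∀ J i,
    ∑ t ∈ Finset.Ioc (I.τ m) I.T, 1 / (I.ρ i t / I.ρ i (I.τ m)) * w.1 J i t ≤ S.supply i}
  let K4 : Set (I.Decisions m) := {w | ∀ J, ∀ j ∈ Ico m I.L, I.epochFee j = ⊤ → ∑ i, w.2 J i j = 0}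
  let K5 : Set (I.Decisions m) := {w | ∀ J, ∑ i, ∑ t ∈ Finset.Ioc (I.τ m) I.T, I.wage i t * w.1 J i t
        + ∑ j ∈ Finset.Ico m I.L, (I.epochFee j).toReal * ∑ i, w.2 J i j ≤ S.budget.toReal}
  let K6 : Set (I.Decisions m) := {w | ∀ J i, ∀ ℓ ∈ Ico m I.L, ∑ j ∈ Finset.Icc m ℓ, w.2 J i j
    ≤ S.hired i + ∑ t ∈ Finset.Ioc (I.τ m) (I.τ (ℓ + 1)), w.1 J i t}
  have c1 : IsClosed K1 := by
    simp only [K1, ofPred_forall]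
    refine isClosed_iInter fun _ => isClosed_iInter fun _ => isClosed_iInter fun _ =>
      isClosed_iInter fun _ => isClosed_iInter fun _ => isClosed_iInter fun _ =>
      isClosed_iInter fun _ => isClosed_eq (by fun_prop) (by fun_prop)
  have c2 : IsClosed K2 := by
    simp only [K2, ofPred_forall]
    refine isClosed_iInter fun _ => isClosed_iInter fun _ => isClosed_iInter fun _ =>
      isClosed_iInter fun _ => isClosed_iInter fun _ => isClosed_eq (by fun_prop) (by fun_prop)
  have c3 : IsClosed K3 := by
    simp only [K3, ofPred_forall]
    exact isClosed_iInter fun _ => isClosed_iInter fun _ =>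
      isClosed_le (by fun_prop) (by fun_prop)
  have c4 : IsClosed K4 := by
    simp only [K4, ofPred_forall]
    exact isClosed_iInter fun _ => isClosed_iInter fun _ => isClosed_iInter fun _ =>
      isClosed_iInter fun _ => isClosed_eq (by fun_prop) (by fun_prop)
  have c5 : IsClosed K5 := by
    simp only [K5, ofPred_forall]
    exact isClosed_iInter fun _ => isClosed_le (by fun_prop) (by fun_prop)
  have c6 : IsClosed K6 := by
    simp only [K6, ofPred_forall]
    exact isClosed_iInter fun _ => isClosed_iInter fun _ => isClosed_iInter fun _ =>
      isClosed_iInter fun _ => isClosed_le (by fun_prop) (by fun_prop)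
  set K := box ∩ (K1 ∩ K2 ∩ K3 ∩ K4 ∩ K5 ∩ K6) with hK
  have hKc : IsCompact K := hbox.inter_right
    (((((c1.inter c2).inter c3).inter c4).inter c5).inter c6)
  have hKf : ∀ w ∈ K, (LPVars.complete S w).IsFeasible S := by
    rintro w ⟨hb, ⟨⟨⟨⟨h1, h2⟩, h3⟩, h4⟩, h5⟩, h6⟩
    obtain ⟨hx, hy⟩ := (hmem w).1 hb
    refine ⟨fun J i t _ => (hx J i t).1, fun J i j _ => (hy J i j).1, fun J => le_max_left _ _,
      fun J => le_max_left _ _, h1, h2, h3, fun J => ?_, h6, fun J => ?_, fun J => ?_⟩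
    · exact (budget_iff (fun i t _ => (hx J i t).1) (fun i j _ => (hy J i j).1)
        hS.budget_ne_top).2 ⟨h4 J, h5 J⟩
    · have : _ ≤ (LPVars.complete S w).lam J := le_max_right _ _
      have h : (LPVars.complete S w).final S J = LPVars.final S ⟨w.1, w.2, 0, 0⟩ J := rfl
      rw [h]; linarith
    · have : _ ≤ (LPVars.complete S w).θ J := le_max_right _ _
      have h : (LPVars.complete S w).final S J = LPVars.final S ⟨w.1, w.2, 0, 0⟩ J := rfl
      rw [h]; linarith
  have hfK : ∀ z : I.LPVars m, z.IsFeasible S →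
      ∃ w ∈ K, (LPVars.complete S w).objective ≤ z.objective := by
    intro z hz
    -- The program does not constrain coordinates outside its days and epochs; they are set to zero
    -- to land in the box.
    let w : I.Decisions m := (fun J i t => if t ∈ Ioc (I.τ m) I.T then z.x J i t else 0,
      fun J i j => if j ∈ Ico m I.L then z.y J i j else 0)
    have hwx : ∀ J i, ∀ t ∈ Ioc (I.τ m) I.T, w.1 J i t = z.x J i t := fun J i t ht => if_pos ht
    have hwy : ∀ J i, ∀ j ∈ Ico m I.L, w.2 J i j = z.y J i j := fun J i j hj => if_pos hj
    have hwx' : ∀ J i, ∀ t ∈ Finset.Ioc (I.τ m) I.T, w.1 J i t = z.x J i t :=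
      fun J i t ht => hwx J i t (by simpa using ht)
    have hwy' : ∀ J i, ∀ j ∈ Finset.Ico m I.L, w.2 J i j = z.y J i j :=
      fun J i t ht => hwy J i t (by simpa using ht)
    have hzx : ∀ J i, ∀ t ∈ Finset.Ioc (I.τ m) I.T, 0 ≤ z.x J i t :=
      fun J i t ht => hz.x_nonneg J i t (by simpa using ht)
    have hb := fun J => (budget_iff (hzx J) (hz.y_nonneg J) hS.budget_ne_top).1 (hz.budget J)
    have hxM : ∀ J i, ∀ t ∈ Ioc (I.τ m) I.T, z.x J i t ≤ M i t := by
      intro J i t ht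
      have hr : 0 < I.ρ i t / I.ρ i (I.τ m) := div_pos (ρ_pos i t) (ρ_pos i _)
      have h := (Finset.single_le_sum
        (f := fun t => 1 / (I.ρ i t / I.ρ i (I.τ m)) * z.x J i t) (fun s hs => ?_)
        (Finset.mem_Ioc.2 ht)).trans (hz.supply J i)
      · simp only [one_div] at h
        rwa [inv_mul_le_iff₀ hr, mul_comm] at h
      · exact mul_nonneg (one_div_nonneg.2 (div_pos (ρ_pos i s) (ρ_pos i _)).le) (hzx J i s hs)
    have hyM : ∀ J i, ∀ j ∈ Ico m I.L, z.y J i j ≤ M' i := by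
      intro J i j hj
      refine (Finset.single_le_sum (f := fun j => z.y J i j) (fun k hk => ?_)
        (Finset.mem_Icc.2 ⟨hj.1, le_rfl⟩)).trans ((hz.release J i j hj).trans ?_)
      · rw [Finset.mem_Icc] at hk
        exact hz.y_nonneg J i k ⟨hk.1, hk.2.trans_lt hj.2⟩
      · refine add_le_add le_rfl ((Finset.sum_le_sum fun t ht => hxM J i t ?_).trans
          (Finset.sum_le_sum_of_subset_of_nonneg
            (Finset.Ioc_subset_Ioc_right (τ_le_T hj.2)) fun t _ _ => hM0 i t))
        rw [Finset.mem_Ioc] at ht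
        exact ⟨ht.1, ht.2.trans (τ_le_T hj.2)⟩
    refine ⟨w, ⟨(hmem w).2 ⟨?_, ?_⟩, ⟨⟨⟨⟨?_, ?_⟩, ?_⟩, ?_⟩, ?_⟩, ?_⟩, ?_⟩
    · intro J i t
      by_cases ht : t ∈ Ioc (I.τ m) I.T
      · rw [hwx J i t ht]; exact ⟨hz.x_nonneg J i t ht, hxM J i t ht⟩
      · simp only [w, if_neg ht]; exact ⟨le_rfl, hM0 i t⟩
    · intro J i j
      by_cases hj : j ∈ Ico m I.L
      · rw [hwy J i j hj]; exact ⟨hz.y_nonneg J i j hj, hyM J i j hj⟩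
      · simp only [w, if_neg hj]; exact ⟨le_rfl, hM'0 i⟩
    · intro ℓ J J' h i t ht
      have htT : t ∈ Ioc (I.τ m) I.T := ⟨ht.1, ht.2.trans ((min_le_left _ _).trans
        ((J ℓ).2.2.trans (τ_le_T ℓ.2.2)))⟩
      rw [hwx J i t htT, hwx J' i t htT]
      exact hz.x_identical ℓ J J' h i t ht
    · intro ℓ J J' h i
      rw [hwy J i ℓ ℓ.2, hwy J' i ℓ ℓ.2]
      exact hz.y_identical ℓ J J' h i
    · intro J i
      refine le_of_eq_of_le (Finset.sum_congr rfl fun t ht => ?_) (hz.supply J i)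
      rw [hwx' J i t ht]
    · intro J j hj hf
      refine Eq.trans (Finset.sum_congr rfl fun i _ => ?_) ((hb J).1 j hj hf)
      rw [hwy J i j hj]
    · intro J
      refine le_of_eq_of_le ?_ (hb J).2
      congr 1
      · exact Finset.sum_congr rfl fun i _ => Finset.sum_congr rfl fun t ht => by
          rw [hwx' J i t ht]
      · exact Finset.sum_congr rfl fun j hj => by
          rw [Finset.sum_congr rfl fun i _ => hwy' J i j hj]
    · intro J i ℓ hℓ
      refine le_of_eq_of_le ?_ ((hz.release J i ℓ hℓ).trans_eq ?_)
      · refine Finset.sum_congr rfl fun j hj => ?_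
        rw [Finset.mem_Icc] at hj
        exact hwy J i j ⟨hj.1, hj.2.trans_lt hℓ.2⟩
      · congr 1
        refine Finset.sum_congr rfl fun t ht => ?_
        rw [Finset.mem_Ioc] at ht
        exact (hwx J i t ⟨ht.1, ht.2.trans (τ_le_T hℓ.2)⟩).symm
    · have hfin : ∀ J, LPVars.final S ⟨w.1, w.2, 0, 0⟩ J = z.final S J := by
        intro J
        simp only [LPVars.final]
        refine Finset.sum_congr rfl fun i _ => ?_
        rw [Finset.sum_congr rfl (hwx' J i), Finset.sum_congr rfl (hwy' J i)]
      refine LPVars.objective_le fun J => le_trans (max_le_max ?_ ?_) (z.le_objective J)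
      · refine I.c_mono (mem_Ici.2 (le_max_left _ _)) (mem_Ici.2 (hz.θ_nonneg J))
          (max_le (hz.θ_nonneg J) ?_)
        have := hz.understaffing J
        rw [hfin]; linarith
      · refine I.C_mono (mem_Ici.2 (le_max_left _ _)) (mem_Ici.2 (hz.lam_nonneg J))
          (max_le (hz.lam_nonneg J) ?_)
        have := hz.overstaffing J
        rw [hfin]; linarith
  have hne : K.Nonempty := by
    refine ⟨0, (hmem 0).2 ⟨fun J i t => ⟨le_rfl, hM0 i t⟩, fun J i j => ⟨le_rfl, hM'0 i⟩⟩,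
      ⟨⟨⟨⟨?_, ?_⟩, ?_⟩, ?_⟩, ?_⟩, ?_⟩
    · intro _ _ _ _ _ _ _; rfl
    · intro _ _ _ _ _; rfl
    · intro J i; simpa using hS.supply_nonneg i
    · intro J j _ _; simp
    · intro J; simp
    · intro J i ℓ _; simpa using hS.hired_nonneg i
  have hcont : Continuous fun w : I.Decisions m => (LPVars.complete S w).objective := by
    have hfin : ∀ J, Continuous fun w : I.Decisions m => LPVars.final S ⟨w.1, w.2, 0, 0⟩ J := by
      intro J
      simp only [LPVars.final]
      fun_prop
    have hJ : ∀ J, Continuous fun w : I.Decisions m =>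
        max (I.c ((LPVars.complete S w).θ J)) (I.C ((LPVars.complete S w).lam J)) := by
      intro J
      exact ((continuous_comp_max I.c_convex I.c_mono).comp (continuous_const.sub (hfin J))).max
        ((continuous_comp_max I.C_convex I.C_mono).comp ((hfin J).sub continuous_const))
    have : Fintype (I.Config m) := Fintype.ofFinite _
    simp only [LPVars.objective, ← Finset.sup'_univ_eq_ciSup]
    exact Continuous.finset_sup'_apply _ fun J _ => hJ J
  obtain ⟨w, hw, hmin⟩ := hKc.exists_isMinOn hne hcont.continuousOn
  refine ⟨LPVars.complete S w, hKf w hw, fun z hz => ?_⟩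
  obtain ⟨w', hw', hle⟩ := hfK z hz
  exact (hmin hw').trans hle

/-- There is an optimal solution that obeys the tie-breaking rule. -/
theorem exists_isOptimal_tieBroken {m : ℕ} (hm : m < I.L) {S : StaffingState I.n}
    (hS : I.IsRegularState m S) : ∃ z : I.LPVars m, z.IsOptimal S ∧ z.TieBroken S hm := by
  obtain ⟨z, hz, hopt⟩ := exists_isOptimal hS
  obtain ⟨z', hz', hl, hθ, ht⟩ :=
    (hz.toPlan hm.le hS.lo_eq hS.budget_ne_top).exists_tieBroken hm hS
  refine ⟨z', ⟨hz', fun z'' hz'' => le_trans (le_of_eq ?_) (hopt z'' hz'')⟩, ht⟩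
  simp only [LPVars.objective, hl, hθ]
  rfl

lemma isRegularState_initialState : I.IsRegularState 0 I.initialState where
  hired_nonneg := fun _ => le_rfl
  supply_nonneg := I.supply_nonneg
  budget_ne_top := ENNReal.coe_ne_top
  lo_eq := by simp only [initialState, I.τ_zero, I.Δ_zero]; ring
  lo_nonneg := I.L₀_nonneg

lemma lpValue_eq {z : I.LPVars 0} (hz : z.IsOptimal I.initialState) : I.lpValue = z.objective := by
  apply le_antisymm
  · exact csInf_le ⟨z.objective, by rintro _ ⟨z', hz', rfl⟩; exact hz.2 z' hz'⟩ ⟨z, hz.1, rfl⟩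
  · exact le_csInf ⟨_, z, hz.1, rfl⟩ (by rintro _ ⟨z', hz', rfl⟩; exact hz.2 z' hz')

/-! ### Continuing plans after the first epoch -/

namespace Plan

variable {m : ℕ} {p : I.Plan m} {σ σ' : Fin I.n → ℝ} {b b' g : ℝ}

/-- The part of a plan after epoch `m`, for the switching day `k` in epoch `m`. -/
noncomputable def tail (p : I.Plan m) (k : Icc (I.τ m) (I.τ (m + 1))) : I.Plan (m + 1) where
  x := fun J => p.x (Config.cons k J)
  Y := fun J => p.Y (Config.cons k J)
  lam := fun J => p.lam (Config.cons k J)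
  θ := fun J => p.θ (Config.cons k J)

lemma IsFeasible.x_cons (hp : p.IsFeasible σ b g) (hm : m < I.L) (k : Icc (I.τ m) (I.τ (m + 1)))
    (J : I.Config (m + 1)) {t : ℕ} (ht : t ∈ Finset.Ioc (I.τ m) (I.τ (m + 1))) (i : Fin I.n) :
    p.x (Config.cons k J) i t = p.x (I.switchAt m k) i t := by
  rw [Finset.mem_Ioc] at ht
  refine hp.x_indist _ _ t ⟨ht.1, ht.2.trans (τ_le_T hm)⟩ ((indist_of_day_eq ?_).mono ht.2) i
  rw [Config.day_cons_self hm, Config.day_switchAt hm]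

lemma IsFeasible.Y_cons (hp : p.IsFeasible σ b g) (hm : m < I.L) (k : Icc (I.τ m) (I.τ (m + 1)))
    (J : I.Config (m + 1)) : p.Y (Config.cons k J) m = p.Y (I.switchAt m k) m := by
  refine hp.Y_indist _ _ m ⟨le_rfl, hm⟩ (indist_of_day_eq ?_)
  rw [Config.day_cons_self hm, Config.day_switchAt hm]

lemma IsFeasible.net_tail (hp : p.IsFeasible σ b g) (hm : m < I.L)
    (k : Icc (I.τ m) (I.τ (m + 1))) (J : I.Config (m + 1)) :
    p.net (Config.cons k J) = ∑ t ∈ Finset.Ioc (I.τ m) (I.τ (m + 1)), p.hires (I.switchAt m k) t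
      - p.Y (I.switchAt m k) m + (p.tail k).net J := by
  rw [net, Ioc_union_τ hm, Finset.sum_eq_sum_Ico_succ_bot hm, hp.Y_cons hm, net]
  have : ∑ t ∈ Finset.Ioc (I.τ m) (I.τ (m + 1)), p.hires (Config.cons k J) t
      = ∑ t ∈ Finset.Ioc (I.τ m) (I.τ (m + 1)), p.hires (I.switchAt m k) t :=
    Finset.sum_congr rfl fun t ht => Finset.sum_congr rfl fun i _ => hp.x_cons hm k J ht i
  rw [this]
  simp only [hires, tail]
  ring

/-- Normalized supply of pool `i` used by the plan in epoch `m`. -/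
noncomputable def epochSupply (p : I.Plan m) (k : Icc (I.τ m) (I.τ (m + 1))) (i : Fin I.n) : ℝ :=
  ∑ t ∈ Finset.Ioc (I.τ m) (I.τ (m + 1)), 1 / I.ρ i t * p.x (I.switchAt m k) i t

/-- Money spent by the plan in epoch `m`. -/
noncomputable def epochSpend (p : I.Plan m) (k : Icc (I.τ m) (I.τ (m + 1))) : ℝ :=
  ∑ i, ∑ t ∈ Finset.Ioc (I.τ m) (I.τ (m + 1)), I.wage i t * p.x (I.switchAt m k) i t
    + (I.epochFee m).toReal * p.Y (I.switchAt m k) m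

/-- Total hires minus total releases of the plan in epoch `m`. -/
noncomputable def epochNet (p : I.Plan m) (k : Icc (I.τ m) (I.τ (m + 1))) : ℝ :=
  ∑ t ∈ Finset.Ioc (I.τ m) (I.τ (m + 1)), p.hires (I.switchAt m k) t - p.Y (I.switchAt m k) m

/-- All continuations of a switch on day `k` look alike during epoch `m`, so they share the
resources used there. The new gap subtracts the fall of the upper endpoint and the net intake of
that epoch. -/
lemma IsFeasible.tail (hp : p.IsFeasible σ b g) (hm : m < I.L) (k : Icc (I.τ m) (I.τ (m + 1)))
    (hσ : ∀ i, σ i - p.epochSupply k i ≤ σ' i) (hb : b - p.epochSpend k ≤ b') :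
    (p.tail k).IsFeasible σ' b' (g - (I.Δ k - I.Δ (I.τ (m + 1))) - p.epochNet k) := by
  have hτ := I.τ_lt m hm
  have hday : ∀ t ∈ Ioc (I.τ (m + 1)) I.T, t ∈ Ioc (I.τ m) I.T :=
    fun t ht => ⟨hτ.trans ht.1, ht.2⟩
  have hep : ∀ j ∈ Ico (m + 1) I.L, j ∈ Ico m I.L :=
    fun j hj => ⟨(Nat.le_succ m).trans hj.1, hj.2⟩
  refine ⟨fun J i t ht => hp.x_nonneg _ i t (hday t ht), fun J j hj => hp.Y_nonneg _ j (hep j hj),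
    fun J => hp.lam_nonneg _, fun J => hp.θ_nonneg _,
    fun J J' t ht h => hp.x_indist _ _ t (hday t ht) (h.cons k),
    fun J J' j hj h => hp.Y_indist _ _ j (hep j hj) (h.cons k), ?_,
    fun J j hj => hp.prohibited _ j (hep j hj), ?_, ?_, ?_⟩
  · intro J i
    have h1 := hp.supply (Config.cons k J) i
    rw [Ioc_union_τ hm] at h1
    have h2 : ∑ t ∈ Finset.Ioc (I.τ m) (I.τ (m + 1)), 1 / I.ρ i t * p.x (Config.cons k J) i t
        = p.epochSupply k i :=
      Finset.sum_congr rfl fun t ht => by rw [hp.x_cons hm k J ht]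
    rw [h2] at h1
    have := hσ i
    simp only [Plan.tail]
    linarith
  · intro J
    have h1 := hp.budget (Config.cons k J)
    rw [spend] at h1
    simp only [Ioc_union_τ hm] at h1
    rw [Finset.sum_add_distrib, Finset.sum_eq_sum_Ico_succ_bot hm, hp.Y_cons hm] at h1
    have h2 : ∑ i, ∑ t ∈ Finset.Ioc (I.τ m) (I.τ (m + 1)),
          I.wage i t * p.x (Config.cons k J) i t
        = ∑ i, ∑ t ∈ Finset.Ioc (I.τ m) (I.τ (m + 1)), I.wage i t * p.x (I.switchAt m k) i t :=
      Finset.sum_congr rfl fun i _ => Finset.sum_congr rfl fun t ht => by rw [hp.x_cons hm k J ht]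
    rw [h2] at h1
    rw [epochSpend] at hb
    simp only [spend, Plan.tail]
    linarith
  · intro J
    have h1 := hp.overstaffing (Config.cons k J)
    rw [hp.net_tail hm, drop_cons hm] at h1
    rw [epochNet]
    show _ ≤ p.lam (Config.cons k J)
    linarith
  · intro J
    have h1 := hp.understaffing (Config.cons k J)
    rw [hp.net_tail hm, drop_cons hm] at h1
    rw [epochNet]
    show _ ≤ p.θ (Config.cons k J)
    linarith

/-- Convex combination of plans. -/
noncomputable def combine (μ : ℝ) (p q : I.Plan m) : I.Plan m where
  x := fun J i t => (1 - μ) * p.x J i t + μ * q.x J i t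
  Y := fun J j => (1 - μ) * p.Y J j + μ * q.Y J j
  lam := fun J => (1 - μ) * p.lam J + μ * q.lam J
  θ := fun J => (1 - μ) * p.θ J + μ * q.θ J

lemma sum_combine {ι : Type*} (s : Finset ι) (μ : ℝ) (w f f' : ι → ℝ) :
    ∑ t ∈ s, w t * ((1 - μ) * f t + μ * f' t)
      = (1 - μ) * ∑ t ∈ s, w t * f t + μ * ∑ t ∈ s, w t * f' t := by
  rw [Finset.mul_sum, Finset.mul_sum, ← Finset.sum_add_distrib]
  exact Finset.sum_congr rfl fun t _ => by ring

lemma combine_le {μ a b c : ℝ} (h0 : 0 ≤ μ) (h1 : μ ≤ 1) (ha : a ≤ c) (hb : b ≤ c) :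
    (1 - μ) * a + μ * b ≤ c := by
  nlinarith [mul_le_mul_of_nonneg_left ha (sub_nonneg.2 h1), mul_le_mul_of_nonneg_left hb h0]

lemma net_combine (μ : ℝ) (p q : I.Plan m) (J : I.Config m) :
    (combine μ p q).net J = (1 - μ) * p.net J + μ * q.net J := by
  have h1 : ∀ t, (combine μ p q).hires J t = (1 - μ) * p.hires J t + μ * q.hires J t := by
    intro t
    have := sum_combine Finset.univ μ (fun _ => 1) (fun i => p.x J i t) (fun i => q.x J i t)
    simpa [hires, combine] using this
  have h2 := sum_combine (Finset.Ioc (I.τ m) I.T) μ (fun _ => 1) (p.hires J) (q.hires J)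
  have h3 := sum_combine (Finset.Ico m I.L) μ (fun _ => 1) (p.Y J) (q.Y J)
  simp only [one_mul] at h2 h3
  simp only [net, h1, h2]
  simp only [combine, h3]
  ring

lemma spend_combine (μ : ℝ) (p q : I.Plan m) (J : I.Config m) :
    (combine μ p q).spend J = (1 - μ) * p.spend J + μ * q.spend J := by
  simp only [spend, combine, sum_combine, Finset.sum_add_distrib, ← Finset.mul_sum]
  ring

/-- The gap enters both error constraints linearly. Mixing plans therefore mixes their gaps, which
allows an intermediate gap to be reached from two extreme ones. -/
lemma IsFeasible.combine {q : I.Plan m} {g' μ : ℝ} (hp : p.IsFeasible σ b g)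
    (hq : q.IsFeasible σ b g') (h0 : 0 ≤ μ) (h1 : μ ≤ 1) :
    (combine μ p q).IsFeasible σ b ((1 - μ) * g + μ * g') := by
  have h1' : 0 ≤ 1 - μ := sub_nonneg.2 h1
  refine ⟨fun J i t ht => add_nonneg (mul_nonneg h1' (hp.x_nonneg J i t ht))
      (mul_nonneg h0 (hq.x_nonneg J i t ht)),
    fun J j hj => add_nonneg (mul_nonneg h1' (hp.Y_nonneg J j hj))
      (mul_nonneg h0 (hq.Y_nonneg J j hj)),
    fun J => add_nonneg (mul_nonneg h1' (hp.lam_nonneg J)) (mul_nonneg h0 (hq.lam_nonneg J)),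
    fun J => add_nonneg (mul_nonneg h1' (hp.θ_nonneg J)) (mul_nonneg h0 (hq.θ_nonneg J)),
    ?_, ?_, ?_, ?_, ?_, ?_, ?_⟩
  · intro J J' t ht h i
    simp only [Plan.combine]
    rw [hp.x_indist J J' t ht h, hq.x_indist J J' t ht h]
  · intro J J' j hj h
    simp only [Plan.combine]
    rw [hp.Y_indist J J' j hj h, hq.Y_indist J J' j hj h]
  · intro J i
    simp only [Plan.combine]
    rw [sum_combine]
    exact combine_le h0 h1 (hp.supply J i) (hq.supply J i)
  · intro J j hj h
    simp only [Plan.combine]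
    rw [hp.prohibited J j hj h, hq.prohibited J j hj h]
    ring
  · intro J
    rw [spend_combine]
    exact combine_le h0 h1 (hp.budget J) (hq.budget J)
  · intro J
    rw [net_combine]
    have h2 := mul_le_mul_of_nonneg_left (hp.overstaffing J) h1'
    have h3 := mul_le_mul_of_nonneg_left (hq.overstaffing J) h0
    show _ ≤ (1 - μ) * p.lam J + μ * q.lam J
    linarith
  · intro J
    rw [net_combine]
    have h2 := mul_le_mul_of_nonneg_left (hp.understaffing J) h1'
    have h3 := mul_le_mul_of_nonneg_left (hq.understaffing J) h0
    show _ ≤ (1 - μ) * p.θ J + μ * q.θ J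
    linarith

/-- The cost of every configuration is at most `v`. -/
def CostLE (p : I.Plan m) (v : ℝ) : Prop := ∀ J, I.c (p.θ J) ≤ v ∧ I.C (p.lam J) ≤ v

lemma CostLE.tail {v : ℝ} (h : p.CostLE v) (k : Icc (I.τ m) (I.τ (m + 1))) :
    (p.tail k).CostLE v := fun J => h (Config.cons k J)

lemma CostLE.combine {q : I.Plan m} {g' μ v : ℝ} (hp : p.IsFeasible σ b g)
    (hq : q.IsFeasible σ b g') (h0 : 0 ≤ μ) (h1 : μ ≤ 1) (hpv : p.CostLE v) (hqv : q.CostLE v) :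
    (Plan.combine μ p q).CostLE v := by
  intro J
  constructor
  · exact (I.c_convex.2 (hp.θ_nonneg J) (hq.θ_nonneg J) (sub_nonneg.2 h1) h0 (by ring)).trans
      (combine_le h0 h1 (hpv J).1 (hqv J).1)
  · exact (I.C_convex.2 (hp.lam_nonneg J) (hq.lam_nonneg J) (sub_nonneg.2 h1) h0 (by ring)).trans
      (combine_le h0 h1 (hpv J).2 (hqv J).2)

/-- Plans can be turned into solutions of the linear program. -/
theorem IsFeasible.exists_solution {v : ℝ} (hm : m ≤ I.L) {S : StaffingState I.n}
    (hS : I.IsRegularState m S) (hp : p.IsFeasible (fun i => S.supply i / I.ρ i (I.τ m))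
      S.budget.toReal (S.hi - ∑ i, S.hired i)) (hv : p.CostLE v) :
    ∃ z : I.LPVars m, z.IsFeasible S ∧ z.objective ≤ v := by
  rcases hm.lt_or_eq with hlt | heq
  · obtain ⟨z, hz, hl, hθ, -⟩ := hp.exists_tieBroken hlt hS
    refine ⟨z, hz, LPVars.objective_le fun J => ?_⟩
    rw [hl, hθ]
    exact max_le (hv J).1 (hv J).2
  -- With no epoch left there is neither a repair nor a release to distribute; all constraints on
  -- releases are vacuous.
  · have hempty : ∀ j, j ∉ Ico m I.L := by
      intro j hj
      have := hj.1; have := hj.2; omega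
    refine ⟨⟨p.x, fun _ _ _ => 0, p.lam, p.θ⟩, ?_, LPVars.objective_le fun J =>
      max_le (hv J).1 (hv J).2⟩
    exact LPVars.isFeasible_of_toPlan hm
      (hp.congr rfl (fun J j hj => absurd hj (hempty j)) rfl rfl) hS.lo_eq hS.budget_ne_top
      (fun _ _ j hj => absurd hj (hempty j)) (fun _ _ j hj => absurd hj (hempty j))
      (fun _ _ j hj => absurd hj (hempty j))

end Plan

/-! ### One epoch of the emulator -/

/-- The constraints on a profile, as far as they concern the days up to `D`. -/
structure FeasibleUpTo (I : StaffingInstance) (a : Profile I.n) (D : ℕ) : Prop where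
  x_nonneg : ∀ i, ∀ t ∈ Icc 1 D, 0 ≤ a.x i t
  y_nonneg : ∀ i, ∀ t ∈ Icc 1 D, 0 ≤ a.y i t
  supply : ∀ i, ∑ t ∈ Finset.Icc 1 D, 1 / I.ρ i t * a.x i t ≤ I.supply i
  budget : I.spent a D ≤ I.B
  release : ∀ i, ∀ k ∈ Icc 1 D,
    ∑ t ∈ Finset.Icc 1 k, a.y i t ≤ ∑ t ∈ Finset.Icc 1 k, a.x i t

lemma feasibleUpTo_T {a : Profile I.n} (h : I.FeasibleUpTo a I.T) : I.IsFeasible a :=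
  ⟨h.x_nonneg, h.y_nonneg, h.supply, h.budget, h.release⟩

lemma feasibleUpTo_zero (a : Profile I.n) : I.FeasibleUpTo a 0 where
  x_nonneg := by simp
  y_nonneg := by simp
  supply := by simpa using I.supply_nonneg
  budget := by simp [spent]
  release := by simp

lemma net_nonneg {a : Profile I.n} {D : ℕ} (h : I.FeasibleUpTo a D) (i : Fin I.n) :
    0 ≤ I.net a i D := by
  rw [net, Finset.sum_sub_distrib, sub_nonneg]
  rcases Nat.eq_zero_or_pos D with rfl | hD
  · simp
  · exact h.release i D ⟨hD, le_rfl⟩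

lemma lo_nonneg {P : Prediction} (hP : I.IsPrediction P) {t : ℕ} (ht : t ≤ I.T) : 0 ≤ P.lo t := by
  induction t with
  | zero => rw [hP.lo_zero]; exact I.L₀_nonneg
  | succ t ih => exact (ih (by omega)).trans (hP.lo_mono t (by omega))

lemma lo_mono {P : Prediction} (hP : I.IsPrediction P) {s t : ℕ} (hst : s ≤ t) (ht : t ≤ I.T) :
    P.lo s ≤ P.lo t := by
  induction t, hst using Nat.le_induction with
  | base => exact le_rfl
  | succ k hk ih => exact (ih (by omega)).trans (hP.lo_mono k (by omega))

/-- A prediction sequence whose intervals have the maximal length. -/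
structure IsFullPrediction (I : StaffingInstance) (P : Prediction) : Prop extends
    I.IsPrediction P where
  length : ∀ t ≤ I.T, P.hi t - P.lo t = I.Δ t

lemma isRegularState_stateAt {P : Prediction} (hP : I.IsFullPrediction P) {a : Profile I.n} {m : ℕ}
    (hm : m ≤ I.L) (ha : I.FeasibleUpTo a (I.τ m)) : I.IsRegularState m (I.stateAt P a m) where
  hired_nonneg := net_nonneg ha
  supply_nonneg := fun i => mul_nonneg (ρ_pos i _).le (sub_nonneg.2 (ha.supply i))
  budget_ne_top := ne_top_of_le_ne_top ENNReal.coe_ne_top tsub_le_self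
  lo_eq := rfl
  lo_nonneg := by
    have h1 := hP.length (I.τ m) (τ_le_T hm)
    have h2 := lo_nonneg hP.toIsPrediction (τ_le_T hm)
    show 0 ≤ P.hi (I.τ m) - I.Δ (I.τ m)
    linarith

lemma sum_Icc_split {M : Type*} [AddCommMonoid M] (f : ℕ → M) {s t : ℕ} (hst : s ≤ t) :
    ∑ u ∈ Finset.Icc 1 t, f u = ∑ u ∈ Finset.Icc 1 s, f u + ∑ u ∈ Finset.Ioc s t, f u := by
  have h : ∀ t, Finset.Icc 1 t = Finset.Ioc 0 t := fun t => by ext; simp; omega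
  rw [h, h, Finset.sum_Ioc_consecutive f (Nat.zero_le s) hst]

lemma net_succ {a : Profile I.n} {m : ℕ} (hm : m < I.L)
    (hy : ∀ t ∈ Ioo (I.τ m) (I.τ (m + 1)), ∀ i, a.y i t = 0) (i : Fin I.n) :
    I.net a i (I.τ (m + 1)) = I.net a i (I.τ m)
      + ∑ t ∈ Finset.Ioc (I.τ m) (I.τ (m + 1)), a.x i t - a.y i (I.τ (m + 1)) := by
  have h := sum_epoch_ends (I := I) (fun t => a.y i t) (Nat.le_succ m) hm (fun j hj t ht => by
    obtain rfl : j = m := by have := hj.1; have := hj.2; omega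
    exact hy t ht i)
  have h' : Finset.Ico m m.succ = {m} := by simp
  rw [h', Finset.sum_singleton] at h
  rw [net, sum_Icc_split _ (I.τ_lt m hm).le, Finset.sum_sub_distrib (s := Finset.Ioc _ _), h, net]
  ring

lemma spent_succ {a : Profile I.n} {m : ℕ} (hm : m < I.L)
    (hx : ∀ i, ∀ t ∈ Ioc (I.τ m) (I.τ (m + 1)), 0 ≤ a.x i t)
    (hy : ∀ t ∈ Ioo (I.τ m) (I.τ (m + 1)), ∀ i, a.y i t = 0)
    (hy' : ∀ i, 0 ≤ a.y i (I.τ (m + 1))) :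
    I.spent a (I.τ (m + 1)) = I.spent a (I.τ m) +
      (ENNReal.ofReal (∑ i, ∑ t ∈ Finset.Ioc (I.τ m) (I.τ (m + 1)), I.wage i t * a.x i t)
        + I.epochFee m * ENNReal.ofReal (∑ i, a.y i (I.τ (m + 1)))) := by
  -- Releases are extended by zero to the other epochs so that the general aggregation formula
  -- applies to a single epoch.
  have h1 := sum_spend_eq (m := m) (I := I) (Finset.Ioc (I.τ m) (I.τ (m + 1))) (x := a.x)
    (y := fun i j => if j = m then a.y i (I.τ (m + 1)) else 0)
    (fun i t ht => hx i t (by simpa using ht)) (fun i j hj => by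
      by_cases h : j = m
      · simp [h, hy' i]
      · simp [h])
  have hmm : m ∈ Finset.Ico m I.L := by simpa using hm
  rw [spent, spent]
  simp only [sum_Icc_split _ (I.τ_lt m hm).le]
  rw [Finset.sum_add_distrib]
  congr 1
  have e1 : ∀ f : ℕ → ℝ≥0∞, (∑ j ∈ Finset.Ico m I.L, f j * ENNReal.ofReal
      (∑ i, if j = m then a.y i (I.τ (m + 1)) else 0))
      = f m * ENNReal.ofReal (∑ i, a.y i (I.τ (m + 1))) := by
    intro f
    rw [Finset.sum_eq_single_of_mem m hmm]
    · simp
    · intro j _ hj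
      simp [hj]
  rw [e1] at h1
  rw [← h1]
  refine Finset.sum_congr rfl fun i _ => ?_
  rw [Finset.sum_add_distrib]
  congr 1
  have h := sum_epoch_ends (I := I) (fun t => I.fee i t * ENNReal.ofReal (a.y i t))
    (Nat.le_succ m) hm (fun j hj t ht => by
      obtain rfl : j = m := by have := hj.1; have := hj.2; omega
      simp [hy t ht i])
  have h' : Finset.Ico m m.succ = {m} := by simp
  rw [h', Finset.sum_singleton] at h
  rw [h, Finset.sum_eq_single_of_mem m hmm]
  · simp
  · intro j _ hj
    simp [hj]

/-! ### Oracle hires and the critical day -/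

section oracle

variable {P : Prediction} {a : Profile I.n} {m : ℕ} {xt : Fin I.n → ℕ → ℝ}

lemma Ioo_eq_Ioc_pred {s t : ℕ} (h : s < t) : Finset.Ioo s t = Finset.Ioc s (t - 1) := by
  ext; simp; omega

/-- The positive part in the oracle rule can only raise hires, so the shortfall against the
canonical total never exceeds the fall of the upper endpoint. -/
lemma FollowsOracle.excess_le (h : FollowsOracle P a m xt) {t : ℕ}
    (ht : t ∈ Ioc (I.τ m) (I.τ (m + 1))) :
    ∑ s ∈ Finset.Ioc (I.τ m) t, ∑ i, xt i s - ∑ s ∈ Finset.Ioc (I.τ m) t, ∑ i, a.x i s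
      ≤ P.hi (I.τ m) - P.hi t := by
  have h1 := (h t ht).2
  rw [Ioo_eq_Ioc_pred ht.1] at h1
  have h2 := le_max_right 0 (∑ s ∈ Finset.Ioc (I.τ m) t, ∑ i, xt i s
      - ∑ s ∈ Finset.Ioc (I.τ m) (t - 1), ∑ i, a.x i s - (P.hi (I.τ m) - P.hi t))
  rw [sum_Ioc_pred (f := fun s => ∑ i, a.x i s) ht.1]
  linarith

/-- There are no hires after the critical day. -/
lemma FollowsOracle.eq_zero_of_critical (h : FollowsOracle P a m xt)
    {k : Icc (I.τ m) (I.τ (m + 1))} (hk : IsCritical P a m xt k) {t : ℕ}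
    (ht : t ∈ Ioc (k : ℕ) (I.τ (m + 1))) (i : Fin I.n) : a.x i t = 0 := by
  have htm : t ∈ Ioc (I.τ m) (I.τ (m + 1)) := ⟨k.2.1.trans_lt ht.1, ht.2⟩
  have h1 := (h t htm).2
  have h0 : ∑ i, a.x i t = 0 := by
    -- Positive hires mean that the positive part is not active, hence the oracle equation is exact
    -- on day `t`. Then `t` satisfies the equation defining critical days, against the maximality of
    -- `k`.
    by_contra hne
    have hpos : ∑ i, a.x i t = ∑ s ∈ Finset.Ioc (I.τ m) t, ∑ i, xt i s
      - ∑ s ∈ Finset.Ioo (I.τ m) t, ∑ i, a.x i s - (P.hi (I.τ m) - P.hi t) := by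
      rcases max_cases 0 (∑ s ∈ Finset.Ioc (I.τ m) t, ∑ i, xt i s
        - ∑ s ∈ Finset.Ioo (I.τ m) t, ∑ i, a.x i s - (P.hi (I.τ m) - P.hi t)) with h2 | h2
      · exact absurd (h1.trans h2.1) hne
      · exact h1.trans h2.1
    have hmem : (⟨t, htm.1.le, htm.2⟩ : Icc (I.τ m) (I.τ (m + 1))) ≤ k := by
      refine hk.2 ?_
      show P.hi t - ∑ i, ∑ s ∈ Finset.Ioc (I.τ m) t, a.x i s
        = P.hi (I.τ m) - ∑ i, ∑ s ∈ Finset.Ioc (I.τ m) t, xt i s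
      rw [Finset.sum_comm, Finset.sum_comm (f := fun i s => xt i s),
        sum_Ioc_pred (f := fun s => ∑ i, a.x i s) htm.1, hpos, Ioo_eq_Ioc_pred htm.1]
      ring
    exact absurd ht.1 (not_lt.2 hmem)
  exact (Finset.sum_eq_zero_iff_of_nonneg fun i _ => ((h t htm).1 i).1).1 h0 i (Finset.mem_univ i)

/-- The last day before the epoch always qualifies, since both sums are empty there. -/
lemma exists_isCritical (P : Prediction) (a : Profile I.n) (hm : m < I.L)
    (xt : Fin I.n → ℕ → ℝ) : ∃ k, IsCritical (I := I) P a m xt k := by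
  have hfin := Set.toFinite {k : Icc (I.τ m) (I.τ (m + 1)) |
    P.hi k - ∑ i, ∑ t ∈ Finset.Ioc (I.τ m) k, a.x i t
      = P.hi (I.τ m) - ∑ i, ∑ t ∈ Finset.Ioc (I.τ m) k, xt i t}
  obtain ⟨k, hk, hmax⟩ := hfin.exists_maximal ⟨⟨I.τ m, le_rfl, (I.τ_lt m hm).le⟩, by simp⟩
  exact ⟨k, hk, fun k' hk' => (le_total k' k).elim id fun h => hmax hk' h⟩

end oracle

lemma exists_release {n : ℕ} {yt : Fin n → ℝ} (hy : ∀ i, 0 ≤ yt i) {r : ℝ} (h0 : 0 ≤ r)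
    (h1 : r ≤ ∑ i, yt i) :
    ∃ w : Fin n → ℝ, (∀ i, 0 ≤ w i ∧ w i ≤ yt i) ∧ ∑ i, (yt i - w i) = r := by
  rcases eq_or_lt_of_le (h0.trans h1) with hY | hY
  · refine ⟨yt, fun i => ⟨hy i, le_rfl⟩, ?_⟩
    simp
    linarith
  · have h2 : r / ∑ i, yt i ≤ 1 := (div_le_one hY).2 h1
    have h3 : 0 ≤ r / ∑ i, yt i := div_nonneg h0 hY.le
    refine ⟨fun i => yt i * (1 - r / ∑ i, yt i), fun i => ⟨mul_nonneg (hy i) (by linarith),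
      mul_le_of_le_one_right (hy i) (by linarith)⟩, ?_⟩
    rw [Finset.sum_sub_distrib, ← Finset.sum_mul]
    field_simp
    ring

lemma exists_combination {a b x : ℝ} (h1 : a ≤ x) (h2 : x ≤ b) :
    ∃ μ : ℝ, 0 ≤ μ ∧ μ ≤ 1 ∧ (1 - μ) * a + μ * b = x := by
  rcases eq_or_lt_of_le (h1.trans h2) with h | h
  · exact ⟨0, le_rfl, zero_le_one, by linarith⟩
  · have h0 : 0 < b - a := by linarith
    refine ⟨(x - a) / (b - a), div_nonneg (by linarith) h0.le, (div_le_one h0).2 (by linarith), ?_⟩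
    field_simp
    ring

/-- The decisions `a` in epoch `m` are those of the emulator, for the solution `z` and with the
critical day `k`. -/
structure EpochRun (P : Prediction) (a : Profile I.n) (m : ℕ) (hm : m < I.L) (z : I.LPVars m)
    (k : Icc (I.τ m) (I.τ (m + 1))) : Prop where
  hire : FollowsOracle P a m (z.canonicalHire hm)
  no_release : ∀ t ∈ Ioo (I.τ m) (I.τ (m + 1)), ∀ i, a.y i t = 0
  critical : IsCritical P a m (z.canonicalHire hm) k
  release : ReleaseCondition P a m (z.canonicalHire hm) k (z.canonicalRelease k)
      (fun i => a.y i (I.τ (m + 1))) ∨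
    (∀ i, a.y i (I.τ (m + 1)) = 0) ∧
      ¬ ∃ w, ReleaseCondition P a m (z.canonicalHire hm) k (z.canonicalRelease k) w
  no_waste : (∃ i, z.canonicalRelease k i ≠ 0) →
    ∀ i, ∀ t ∈ Ioc (k : ℕ) (I.τ (m + 1)), z.x (I.switchAt m k) i t = 0
  implementable : ∀ i, z.canonicalRelease k i
    ≤ I.net a i (I.τ m) + ∑ t ∈ Finset.Ioc (I.τ m) (I.τ (m + 1)), a.x i t

/-! ### Resources, feasibility and continuation after an emulator epoch -/

namespace EpochRun

variable {P : Prediction} {a : Profile I.n} {m : ℕ} {hm : m < I.L} {z : I.LPVars m}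
  {k : Icc (I.τ m) (I.τ (m + 1))}

lemma x_nonneg (h : EpochRun P a m hm z k) (i : Fin I.n) {t : ℕ}
    (ht : t ∈ Ioc (I.τ m) (I.τ (m + 1))) : 0 ≤ a.x i t := ((h.hire t ht).1 i).1

lemma release_mem (h : EpochRun P a m hm z k) {S : StaffingState I.n} (hz : z.IsFeasible S)
    (i : Fin I.n) :
    0 ≤ a.y i (I.τ (m + 1)) ∧ a.y i (I.τ (m + 1)) ≤ z.canonicalRelease k i := by
  rcases h.release with h1 | ⟨h1, -⟩
  · exact h1.1 i
  · rw [h1 i]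
    exact ⟨le_rfl, hz.y_nonneg _ i m ⟨le_rfl, hm⟩⟩

/-- Until the critical day, the canonical hires are those of the configurations that switch on
the critical day. -/
lemma canonicalHire_eq {S : StaffingState I.n} (hz : z.IsFeasible S) (i : Fin I.n) {t : ℕ}
    (ht : t ∈ Ioc (I.τ m) (k : ℕ)) : z.canonicalHire hm i t = z.x (I.switchAt m k) i t := by
  have hle := ht.2.trans k.2.2
  refine hz.x_indist hm.le ⟨ht.1, hle.trans (τ_le_T hm)⟩ (indist_of_le_day hm ?_ ?_) i
  · rw [Config.day_switchAt hm]; exact hle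
  · rw [Config.day_switchAt hm]; exact ht.2

/-- Up to the critical day the canonical hires are those of the branch `k`; afterwards nobody is
hired. -/
lemma x_le (h : EpochRun P a m hm z k) {S : StaffingState I.n} (hz : z.IsFeasible S) (i : Fin I.n)
    {t : ℕ} (ht : t ∈ Ioc (I.τ m) (I.τ (m + 1))) : a.x i t ≤ z.x (I.switchAt m k) i t := by
  by_cases hk : t ≤ k
  · rw [← canonicalHire_eq (hm := hm) hz i ⟨ht.1, hk⟩]
    exact ((h.hire t ht).1 i).2
  · rw [h.hire.eq_zero_of_critical h.critical ⟨not_le.1 hk, ht.2⟩]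
    exact hz.x_nonneg _ i t ⟨ht.1, ht.2.trans (τ_le_T hm)⟩

/-- Normalized supply of pool `i` used by the profile in epoch `m`. -/
noncomputable def usedSupply (a : Profile I.n) (m : ℕ) (i : Fin I.n) : ℝ :=
  ∑ t ∈ Finset.Ioc (I.τ m) (I.τ (m + 1)), 1 / I.ρ i t * a.x i t

/-- Money spent by the profile in epoch `m`, for releases on the last day only. -/
noncomputable def usedBudget (a : Profile I.n) (m : ℕ) : ℝ :=
  ∑ i, ∑ t ∈ Finset.Ioc (I.τ m) (I.τ (m + 1)), I.wage i t * a.x i t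
    + (I.epochFee m).toReal * ∑ i, a.y i (I.τ (m + 1))

lemma usedSupply_le {p : I.Plan m} {k : Icc (I.τ m) (I.τ (m + 1))}
    (h : ∀ i, ∀ t ∈ Ioc (I.τ m) (I.τ (m + 1)), a.x i t ≤ p.x (I.switchAt m k) i t) (i : Fin I.n) :
    usedSupply a m i ≤ p.epochSupply k i :=
  Finset.sum_le_sum fun t ht =>
    mul_le_mul_of_nonneg_left (h i t (by simpa using ht)) (one_div_nonneg.2 (ρ_pos i t).le)

lemma usedBudget_le {p : I.Plan m} {k : Icc (I.τ m) (I.τ (m + 1))}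
    (h : ∀ i, ∀ t ∈ Ioc (I.τ m) (I.τ (m + 1)), a.x i t ≤ p.x (I.switchAt m k) i t)
    (hy : ∑ i, a.y i (I.τ (m + 1)) ≤ p.Y (I.switchAt m k) m) :
    usedBudget a m ≤ p.epochSpend k :=
  add_le_add (Finset.sum_le_sum fun i _ => Finset.sum_le_sum fun t ht =>
    mul_le_mul_of_nonneg_left (h i t (by simpa using ht)) (I.wage_nonneg i t))
    (mul_le_mul_of_nonneg_left hy ENNReal.toReal_nonneg)

lemma toPlan (hP : I.IsFullPrediction P) (hm : m < I.L) (ha : I.FeasibleUpTo a (I.τ m))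
    (hz : z.IsFeasible (I.stateAt P a m)) :
    z.toPlan.IsFeasible (fun i => I.supply i - ∑ t ∈ Finset.Icc 1 (I.τ m), 1 / I.ρ i t * a.x i t)
      (I.B - I.spent a (I.τ m)).toReal (P.hi (I.τ m) - ∑ i, I.net a i (I.τ m)) := by
  have hreg := isRegularState_stateAt hP hm.le ha
  have h := hz.toPlan hm.le hreg.lo_eq hreg.budget_ne_top
  have e : (fun i => (I.stateAt P a m).supply i / I.ρ i (I.τ m)) =
      fun i => I.supply i - ∑ t ∈ Finset.Icc 1 (I.τ m), 1 / I.ρ i t * a.x i t :=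
    funext fun i => mul_div_cancel_left₀ _ (ρ_pos i _).ne'
  rw [e] at h
  exact h

/-- The plan used by the emulator leaves enough supply and budget. -/
lemma resources (h : EpochRun P a m hm z k) (hP : I.IsFullPrediction P)
    (ha : I.FeasibleUpTo a (I.τ m)) (hz : z.IsFeasible (I.stateAt P a m)) :
    (∀ i, usedSupply a m i ≤ I.supply i - ∑ t ∈ Finset.Icc 1 (I.τ m), 1 / I.ρ i t * a.x i t) ∧
      usedBudget a m ≤ (I.B - I.spent a (I.τ m)).toReal := by
  have hp := toPlan hP hm ha hz
  have hx := fun i t ht => h.x_le hz i (t := t) ht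
  have hy : ∑ i, a.y i (I.τ (m + 1)) ≤ z.toPlan.Y (I.switchAt m k) m :=
    Finset.sum_le_sum fun i _ => (h.release_mem hz i).2
  -- Any continuation of the branch uses a nonnegative amount, so what the branch leaves is
  -- nonnegative.
  have ht := hp.tail hm k (fun i => le_rfl) le_rfl
  obtain ⟨J⟩ : Nonempty (I.Config (m + 1)) := inferInstance
  constructor
  · intro i
    have h1 := usedSupply_le (p := z.toPlan) hx i
    have h2 : 0 ≤ ∑ t ∈ Finset.Ioc (I.τ (m + 1)) I.T, 1 / I.ρ i t * (z.toPlan.tail k).x J i t :=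
      Finset.sum_nonneg fun t hh => mul_nonneg (one_div_nonneg.2 (ρ_pos i t).le)
        (ht.x_nonneg J i t (by simpa using hh))
    have h3 := ht.supply J i
    linarith
  · have h1 := usedBudget_le (p := z.toPlan) hx hy
    have h2 : 0 ≤ (z.toPlan.tail k).spend J :=
      add_nonneg (Finset.sum_nonneg fun i _ => Finset.sum_nonneg fun t hh =>
        mul_nonneg (I.wage_nonneg i t) (ht.x_nonneg J i t (by simpa using hh)))
        (Finset.sum_nonneg fun j hj => mul_nonneg ENNReal.toReal_nonneg
          (ht.Y_nonneg J j (by simpa using hj)))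
    have h3 := ht.budget J
    linarith

lemma spent_eq (h : EpochRun P a m hm z k) (hP : I.IsFullPrediction P)
    (ha : I.FeasibleUpTo a (I.τ m)) (hz : z.IsFeasible (I.stateAt P a m)) :
    I.spent a (I.τ (m + 1)) = I.spent a (I.τ m) + ENNReal.ofReal (usedBudget a m) := by
  have hp := toPlan hP hm ha hz
  have hW0 : 0 ≤ ∑ i, a.y i (I.τ (m + 1)) :=
    Finset.sum_nonneg fun i _ => (h.release_mem hz i).1
  have hfee : I.epochFee m * ENNReal.ofReal (∑ i, a.y i (I.τ (m + 1)))
      = ENNReal.ofReal ((I.epochFee m).toReal * ∑ i, a.y i (I.τ (m + 1))) := by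
    by_cases htop : I.epochFee m = ⊤
    · have h1 : ∑ i, a.y i (I.τ (m + 1)) ≤ z.toPlan.Y (I.switchAt m k) m :=
        Finset.sum_le_sum fun i _ => (h.release_mem hz i).2
      rw [hp.prohibited _ m ⟨le_rfl, hm⟩ htop] at h1
      rw [le_antisymm h1 hW0]
      simp
    · rw [ENNReal.ofReal_mul ENNReal.toReal_nonneg, ENNReal.ofReal_toReal htop]
  rw [spent_succ hm (fun i t ht => h.x_nonneg i ht) h.no_release
    (fun i => (h.release_mem hz i).1), hfee, ← ENNReal.ofReal_add _
    (mul_nonneg ENNReal.toReal_nonneg hW0), usedBudget]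
  exact Finset.sum_nonneg fun i _ => Finset.sum_nonneg fun t ht =>
    mul_nonneg (I.wage_nonneg i t) (h.x_nonneg i (by simpa using ht))

lemma feasibleUpTo (h : EpochRun P a m hm z k) (hP : I.IsFullPrediction P)
    (ha : I.FeasibleUpTo a (I.τ m)) (hz : z.IsFeasible (I.stateAt P a m)) :
    I.FeasibleUpTo a (I.τ (m + 1)) := by
  have hτ := I.τ_lt m hm
  have hsplit : ∀ t ∈ Icc 1 (I.τ (m + 1)), t ∉ Icc 1 (I.τ m) →
      t ∈ Ioc (I.τ m) (I.τ (m + 1)) := by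
    intro t ht ht'
    refine ⟨?_, ht.2⟩
    by_contra hcon
    exact ht' ⟨ht.1, not_lt.1 hcon⟩
  have hrel := fun i => h.release_mem hz i
  obtain ⟨hs, hb⟩ := h.resources hP ha hz
  refine ⟨?_, ?_, ?_, ?_, ?_⟩
  · intro i t ht
    by_cases ht' : t ∈ Icc 1 (I.τ m)
    · exact ha.x_nonneg i t ht'
    · exact h.x_nonneg i (hsplit t ht ht')
  · intro i t ht
    by_cases ht' : t ∈ Icc 1 (I.τ m)
    · exact ha.y_nonneg i t ht'
    · have h1 := hsplit t ht ht'
      rcases eq_or_lt_of_le h1.2 with rfl | h2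
      · exact (hrel i).1
      · rw [h.no_release t ⟨h1.1, h2⟩ i]
  · intro i
    rw [sum_Icc_split _ hτ.le]
    have := hs i
    rw [usedSupply] at this
    linarith
  · rw [h.spent_eq hP ha hz]
    refine add_le_of_le_tsub_left_of_le ha.budget ?_
    exact (ENNReal.ofReal_le_iff_le_toReal
      (ne_top_of_le_ne_top ENNReal.coe_ne_top tsub_le_self)).2 hb
  · intro i t ht
    by_cases ht' : t ∈ Icc 1 (I.τ m)
    · exact ha.release i t ht'
    · have h1 := hsplit t ht ht'
      rcases eq_or_lt_of_le h1.2 with h2 | h2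
      · subst h2
        -- The tie-breaking bound is needed here: canonical releases of a pool might otherwise
        -- exceed the workers left after cancelled hires.
        have h3 := net_succ hm h.no_release i
        have h4 := h.implementable i
        have h5 := (hrel i).2
        rw [net, Finset.sum_sub_distrib] at h3
        linarith
      · have h3 := net_nonneg ha i
        rw [net, Finset.sum_sub_distrib] at h3
        rw [sum_Icc_split _ h1.1.le, sum_Icc_split (a.x i) h1.1.le]
        have h4 : ∑ u ∈ Finset.Ioc (I.τ m) t, a.y i u = 0 := by
          refine Finset.sum_eq_zero fun u hu => ?_
          rw [Finset.mem_Ioc] at hu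
          exact h.no_release u ⟨hu.1, hu.2.trans_lt h2⟩ i
        have h5 : 0 ≤ ∑ u ∈ Finset.Ioc (I.τ m) t, a.x i u := by
          refine Finset.sum_nonneg fun u hu => ?_
          rw [Finset.mem_Ioc] at hu
          exact h.x_nonneg i ⟨hu.1, hu.2.trans h1.2⟩
        linarith

/-- After an epoch of the emulator, there is a plan for the remaining epochs that is not more
expensive. -/
theorem exists_next (h : EpochRun P a m hm z k) (hP : I.IsFullPrediction P)
    (ha : I.FeasibleUpTo a (I.τ m)) (hz : z.IsFeasible (I.stateAt P a m)) :
    ∃ z' : I.LPVars (m + 1), z'.IsFeasible (I.stateAt P a (m + 1)) ∧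
      z'.objective ≤ z.objective := by
  have hτ := I.τ_lt m hm
  have hp := toPlan hP hm ha hz
  set p := z.toPlan with hpdef
  have hcost : p.CostLE z.objective :=
    fun J => ⟨(le_max_left _ _).trans (z.le_objective J),
      (le_max_right _ _).trans (z.le_objective J)⟩
  have ha' := h.feasibleUpTo hP ha hz
  have hreg := isRegularState_stateAt hP hm ha'
  obtain ⟨hs, hb⟩ := h.resources hP ha hz
  have hrel := fun i => h.release_mem hz i
  have hσ' : ∀ i, (I.stateAt P a (m + 1)).supply i / I.ρ i (I.τ (m + 1)) =
      I.supply i - ∑ t ∈ Finset.Icc 1 (I.τ m), 1 / I.ρ i t * a.x i t - usedSupply a m i := by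
    intro i
    have e : (I.stateAt P a (m + 1)).supply i / I.ρ i (I.τ (m + 1)) =
      I.supply i - ∑ t ∈ Finset.Icc 1 (I.τ (m + 1)), 1 / I.ρ i t * a.x i t :=
      mul_div_cancel_left₀ _ (ρ_pos i _).ne'
    rw [e, sum_Icc_split _ hτ.le, usedSupply]
    ring
  have hb0 : 0 ≤ usedBudget a m :=
    add_nonneg (Finset.sum_nonneg fun i _ => Finset.sum_nonneg fun t ht =>
      mul_nonneg (I.wage_nonneg i t) (h.x_nonneg i (by simpa using ht)))
      (mul_nonneg ENNReal.toReal_nonneg (Finset.sum_nonneg fun i _ => (hrel i).1))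
  have hb' : (I.stateAt P a (m + 1)).budget.toReal
      = (I.B - I.spent a (I.τ m)).toReal - usedBudget a m := by
    have hne : (I.B : ℝ≥0∞) - I.spent a (I.τ m) ≠ ⊤ :=
      ne_top_of_le_ne_top ENNReal.coe_ne_top tsub_le_self
    show (I.B - I.spent a (I.τ (m + 1))).toReal = _
    rw [h.spent_eq hP ha hz, tsub_add_eq_tsub_tsub,
      ENNReal.toReal_sub_of_le ((ENNReal.ofReal_le_iff_le_toReal hne).2 hb) hne,
      ENNReal.toReal_ofReal hb0]
  have tailk := hp.tail (σ' := fun i => (I.stateAt P a (m + 1)).supply i / I.ρ i (I.τ (m + 1)))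
    (b' := (I.stateAt P a (m + 1)).budget.toReal) hm k
    (fun i => by
      have := usedSupply_le (p := p) (fun i t ht => h.x_le hz i (t := t) ht) i
      rw [hσ']; linarith)
    (by
      have := usedBudget_le (p := p) (fun i t ht => h.x_le hz i (t := t) ht)
        (Finset.sum_le_sum fun i _ => (hrel i).2)
      rw [hb']; linarith)
  -- gaps
  set gA := P.hi (I.τ m) - ∑ i, I.net a i (I.τ m) - (I.Δ k - I.Δ (I.τ (m + 1))) - p.epochNet k
    with hgA
  set W := ∑ i, a.y i (I.τ (m + 1)) with hW
  set Y := ∑ i, z.canonicalRelease k i with hY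
  set A₀ := ∑ t ∈ Finset.Ioc (I.τ m) (k : ℕ), ∑ i, z.canonicalHire hm i t with hA₀
  set A := ∑ t ∈ Finset.Ioc (I.τ m) (k : ℕ), ∑ i, a.x i t with hA
  set E := ∑ t ∈ Finset.Ioc (k : ℕ) (I.τ (m + 1)), ∑ i, z.x (I.switchAt m k) i t with hE
  have hE0 : 0 ≤ E := Finset.sum_nonneg fun t ht => Finset.sum_nonneg fun i _ => by
    rw [Finset.mem_Ioc] at ht
    exact hz.x_nonneg _ i t ⟨k.2.1.trans_lt ht.1, ht.2.trans (τ_le_T hm)⟩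
  have hnet : p.epochNet k = A₀ + E - Y := by
    rw [Plan.epochNet, ← Finset.sum_Ioc_consecutive _ k.2.1 k.2.2]
    have : ∑ t ∈ Finset.Ioc (I.τ m) (k : ℕ), p.hires (I.switchAt m k) t = A₀ :=
      Finset.sum_congr rfl fun t ht => Finset.sum_congr rfl fun i _ =>
        (canonicalHire_eq (hm := hm) hz i (by simpa using ht)).symm
    rw [this]
    rfl
  have hcrit : P.hi k - A = P.hi (I.τ m) - A₀ := by
    have : P.hi k - ∑ i, ∑ t ∈ Finset.Ioc (I.τ m) (k : ℕ), a.x i t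
      = P.hi (I.τ m) - ∑ i, ∑ t ∈ Finset.Ioc (I.τ m) (k : ℕ), z.canonicalHire hm i t :=
      h.critical.1
    rwa [Finset.sum_comm, Finset.sum_comm (f := fun i t => z.canonicalHire hm i t)] at this
  have hAall : ∑ t ∈ Finset.Ioc (I.τ m) (I.τ (m + 1)), ∑ i, a.x i t = A := by
    rw [← Finset.sum_Ioc_consecutive _ k.2.1 k.2.2]
    have : ∑ t ∈ Finset.Ioc (k : ℕ) (I.τ (m + 1)), ∑ i, a.x i t = 0 :=
      Finset.sum_eq_zero fun t ht => Finset.sum_eq_zero fun i _ =>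
        h.hire.eq_zero_of_critical h.critical (by simpa using ht) i
    rw [this, add_zero]
  have hgap : (I.stateAt P a (m + 1)).hi - ∑ i, (I.stateAt P a (m + 1)).hired i
      = P.hi (I.τ (m + 1)) - ∑ i, I.net a i (I.τ m) - A + W := by
    show P.hi (I.τ (m + 1)) - ∑ i, I.net a i (I.τ (m + 1)) = _
    simp only [net_succ hm h.no_release]
    rw [Finset.sum_sub_distrib, Finset.sum_add_distrib, Finset.sum_comm (t := Finset.Ioc _ _),
      hAall]
    ring
  set g' := (I.stateAt P a (m + 1)).hi - ∑ i, (I.stateAt P a (m + 1)).hired i with hg'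
  -- For intervals of full length, `r` is the rise of the lower endpoint after the critical day. The
  -- branch `k` assumed that the lower endpoint is frozen, so `r` of its releases should be
  -- withheld.
  set r := P.hi (I.τ (m + 1)) - (P.hi k - I.Δ k + I.Δ (I.τ (m + 1))) with hr
  have hr0 : 0 ≤ r := by
    have h1 := hP.length k (k.2.2.trans (τ_le_T hm))
    have h2 := hP.length (I.τ (m + 1)) (τ_le_T hm)
    have h3 := lo_mono hP.toIsPrediction k.2.2 (τ_le_T hm)
    linarith
  -- The critical-day equation eliminates the cancelled hires. The gaps differ by the rise `r`,
  -- minus the withheld releases `Y - W`, plus the hires `E` that the branch planned after day `k`.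
  have hdiff : g' - gA = r - (Y - W) + E := by
    rw [hgap, hgA, hnet, hr]; linarith
  have hcond : ∀ w : Fin I.n → ℝ, ∑ i, (∑ t ∈ Finset.Ioc (I.τ m) (k : ℕ),
      (z.canonicalHire hm i t - a.x i t) - (z.canonicalRelease k i - w i))
      = (A₀ - A) - ∑ i, (z.canonicalRelease k i - w i) := by
    intro w
    rw [Finset.sum_sub_distrib, Finset.sum_comm, hA₀, hA, ← Finset.sum_sub_distrib]
    simp only [Finset.sum_sub_distrib]
  -- either the plan for the critical day remains valid, or nobody is released
  have hcases : g' = gA ∨ ((∀ i, a.y i (I.τ (m + 1)) = 0) ∧ gA ≤ g') := by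
    rcases h.release with hc | ⟨h0, hc⟩
    · have h1 := hc.2
      rw [hcond, Finset.sum_sub_distrib] at h1
      have h2 : Y - W = r := by
        show Y - W = _
        rw [hr]; linarith
      -- The release condition says `Y - W = r`, leaving the discrepancy `E`. If the plan releases
      -- anyone, the tie-breaking rule gives `E = 0`; otherwise actual releases vanish too and only
      -- `E ≥ 0` is known.
      by_cases hY0 : ∃ i, z.canonicalRelease k i ≠ 0
      · left
        have : E = 0 := Finset.sum_eq_zero fun t ht => Finset.sum_eq_zero fun i _ =>
          h.no_waste hY0 i t (by simpa using ht)
        linarith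
      · right
        push Not at hY0
        refine ⟨fun i => le_antisymm ((hrel i).2.trans_eq (hY0 i)) (hrel i).1, by linarith⟩
    · right
      refine ⟨h0, ?_⟩
      have hW0 : W = 0 := Finset.sum_eq_zero fun i _ => h0 i
      -- Since `r` is nonnegative, it could be withheld if it were less than `Y`, and the release
      -- condition would have a solution.
      have h1 : Y ≤ r := by
        by_contra hlt
        obtain ⟨w, hw, hwsum⟩ := exists_release
          (fun i => hz.y_nonneg (I.switchAt m k) i m ⟨le_rfl, hm⟩) hr0 (not_le.1 hlt).le
        refine hc ⟨w, hw, ?_⟩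
        rw [hcond]
        have : ∑ i, (z.canonicalRelease k i - w i) = r := hwsum
        rw [this, hr]; linarith
      linarith
  rcases hcases with heq | ⟨hw0, hle⟩
  · rw [← heq] at tailk
    exact tailk.exists_solution hm hreg (hcost.tail k)
  · have hW0 : W = 0 := Finset.sum_eq_zero fun i _ => hw0 i
    -- Since nobody is released, the actual resource use is also dominated by the branch that
    -- switches on the last day, with the canonical hires.
    set l : Icc (I.τ m) (I.τ (m + 1)) := ⟨I.τ (m + 1), hτ.le, le_rfl⟩ with hl
    have hYl : 0 ≤ p.Y (I.switchAt m l) m := hp.Y_nonneg _ m ⟨le_rfl, hm⟩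
    have taill := hp.tail (σ' := fun i => (I.stateAt P a (m + 1)).supply i / I.ρ i (I.τ (m + 1)))
      (b' := (I.stateAt P a (m + 1)).budget.toReal) hm l
      (fun i => by
        have := usedSupply_le (p := p) (k := l) (fun i t ht => ((h.hire t ht).1 i).2) i
        rw [hσ']; linarith)
      (by
        have := usedBudget_le (p := p) (k := l) (fun i t ht => ((h.hire t ht).1 i).2)
          (by rw [← hW, hW0]; exact hYl)
        rw [hb']; linarith)
    have hex := h.hire.excess_le ⟨hτ, le_rfl⟩
    rw [hAall] at hex
    have hnetl : p.epochNet l = ∑ t ∈ Finset.Ioc (I.τ m) (I.τ (m + 1)),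
        ∑ i, z.canonicalHire hm i t - p.Y (I.switchAt m l) m := rfl
    -- By `excess_le`, the actual gap is at most the starting gap minus all canonical hires; the
    -- planned releases of the branch `l` only enlarge its gap.
    obtain ⟨μ, hμ0, hμ1, hμ⟩ := exists_combination hle (show g' ≤ P.hi (I.τ m)
      - ∑ i, I.net a i (I.τ m) - (I.Δ l - I.Δ (I.τ (m + 1))) - p.epochNet l by
        have : I.Δ l = I.Δ (I.τ (m + 1)) := rfl
        rw [hgap, hnetl]; linarith)
    have hcomb := tailk.combine taill hμ0 hμ1
    rw [hμ] at hcomb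
    exact hcomb.exists_solution hm hreg
      (Plan.CostLE.combine tailk taill hμ0 hμ1 (hcost.tail k) (hcost.tail l))

end EpochRun

/-! ### The guarantee of the emulator -/

lemma stateAt_zero {P : Prediction} (hP : I.IsPrediction P) (a : Profile I.n) :
    I.stateAt P a 0 = I.initialState := by
  simp only [stateAt, initialState, I.τ_zero, net, spent, ρ, hP.hi_zero, I.Δ_zero]
  simp

namespace Emulator

variable (E : I.Emulator) {P : Prediction}

lemma pad_full (hP : I.IsPrediction P) : I.IsFullPrediction (E.pad P) :=
  ⟨E.pad_isPrediction P hP, E.pad_length P hP⟩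

lemma run (hP : I.IsPrediction P) {m : ℕ} (hm : m < I.L) {k : Icc (I.τ m) (I.τ (m + 1))}
    (hk : IsCritical (E.pad P) (E.act P) m ((E.sol P m).canonicalHire hm) k) :
    EpochRun (E.pad P) (E.act P) m hm (E.sol P m) k :=
  ⟨E.hire P hP m hm, E.no_release P hP m hm, hk, E.release P hP m hm k hk,
    E.no_waste P hP m hm k hk, E.implementable P hP m hm k hk⟩

/-- Re-solving is at least as good as the continuation plan supplied by the previous epoch, so
values do not increase, whichever optimal solution is selected. -/
lemma invariant (hP : I.IsPrediction P) {m : ℕ} (hm : m ≤ I.L) :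
    I.FeasibleUpTo (E.act P) (I.τ m) ∧ ∃ z : I.LPVars m,
      z.IsFeasible (I.stateAt (E.pad P) (E.act P) m) ∧ z.objective ≤ I.lpValue := by
  induction m with
  | zero =>
    refine ⟨by rw [I.τ_zero]; exact feasibleUpTo_zero _, ?_⟩
    obtain ⟨z, hz⟩ := exists_isOptimal (isRegularState_initialState (I := I))
    rw [stateAt_zero (E.pad_full hP).toIsPrediction]
    exact ⟨z, hz.1, (lpValue_eq hz).ge⟩
  | succ m ih =>
    obtain ⟨ha, z, hz, hv⟩ := ih (by omega)
    obtain ⟨k, hk⟩ := exists_isCritical (E.pad P) (E.act P) hm ((E.sol P m).canonicalHire hm)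
    have hrun := E.run hP hm hk
    have hopt := E.resolve P hP m hm
    obtain ⟨z', hz', hv'⟩ := hrun.exists_next (E.pad_full hP) ha hopt.1
    exact ⟨hrun.feasibleUpTo (E.pad_full hP) ha hopt.1, z', hz',
      hv'.trans ((hopt.2 z hz).trans hv)⟩

lemma isFeasible (hP : I.IsPrediction P) : I.IsFeasible (E.act P) := by
  have := (E.invariant hP le_rfl).1
  rw [I.τ_last] at this
  exact feasibleUpTo_T this

lemma cost_le (hP : I.IsPrediction P) {d : ℝ} (hd : d ∈ Icc (P.lo I.T) (P.hi I.T)) :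
    I.cost (E.act P) d ≤ I.lpValue := by
  obtain ⟨-, z, hz, hv⟩ := E.invariant hP le_rfl
  obtain ⟨J⟩ : Nonempty (I.Config I.L) := inferInstance
  have hfinal : z.final (I.stateAt (E.pad P) (E.act P) I.L) J = ∑ i, I.net (E.act P) i I.T := by
    simp [LPVars.final, stateAt, I.τ_last]
  have h1 := hz.overstaffing J
  have h2 := hz.understaffing J
  -- With no epochs left, the interval of the configuration is the current one.
  rw [hfinal, configInterval_of_le _ J I.τ_last.ge] at h1 h2
  have hlen := E.pad_length P hP I.T le_rfl
  have h3 : (I.stateAt (E.pad P) (E.act P) I.L).lo = (E.pad P).lo I.T := by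
    simp only [stateAt, I.τ_last]; linarith
  have h4 : (I.stateAt (E.pad P) (E.act P) I.L).hi = (E.pad P).hi I.T := by
    simp only [stateAt, I.τ_last]
  rw [h3] at h1
  rw [h4] at h2
  obtain ⟨h5, h6⟩ := E.pad_contains P hP I.T le_rfl hd
  refine le_trans ?_ hv
  refine le_trans ?_ (z.le_objective J)
  unfold cost
  set N := ∑ i, I.net (E.act P) i I.T
  have hθ : I.c (max 0 (d - N)) ≤ I.c (z.θ J) :=
    I.c_mono (mem_Ici.2 (le_max_left _ _)) (mem_Ici.2 (hz.θ_nonneg J))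
      (max_le (hz.θ_nonneg J) (by simp only at h2; linarith))
  have hl : I.C (max 0 (N - d)) ≤ I.C (z.lam J) :=
    I.C_mono (mem_Ici.2 (le_max_left _ _)) (mem_Ici.2 (hz.lam_nonneg J))
      (max_le (hz.lam_nonneg J) (by simp only at h1; linarith))
  -- At most one of understaffing and overstaffing is positive, so the sum of the costs is bounded
  -- by their maximum.
  rcases le_total d N with h | h
  · rw [max_eq_left (show d - N ≤ 0 by linarith), I.c_zero, zero_add]
    exact hl.trans (le_max_right _ _)
  · rw [max_eq_left (show N - d ≤ 0 by linarith), I.C_zero, add_zero]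
    exact hθ.trans (le_max_left _ _)

lemma isOnlineAlgorithm : I.IsOnlineAlgorithm (fun _ : PUnit.{u + 1} => E.act) where
  measurable_x := fun _ _ _ _ _ => measurable_const
  measurable_y := fun _ _ _ _ _ => measurable_const
  online := fun _ P P' hP hP' t ht h i => E.act_online P P' hP hP' t ht h i
  feasible := fun _ _ hP => E.isFeasible hP

lemma costGuarantee_le :
    I.costGuarantee (Measure.dirac PUnit.unit) (fun _ : PUnit.{u + 1} => E.act)
      ≤ ENNReal.ofReal I.lpValue := by
  refine iSup_le fun P => iSup_le fun hP => iSup_le fun d => iSup_le fun hd => ?_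
  rw [lintegral_const, measure_univ, mul_one]
  exact ENNReal.ofReal_le_ofReal (E.cost_le hP hd)

end Emulator

/-! ### Enlarging the intervals -/

/-- Upper endpoints of the enlarged intervals. -/
noncomputable def padHi (I : StaffingInstance) (P : Prediction) : ℕ → ℝ
  | 0 => P.hi 0
  | t + 1 => min (padHi I P t) (P.lo (t + 1) + I.Δ (t + 1))

/-- Nested intervals of the maximal length that contain the given intervals. -/
noncomputable def padding (I : StaffingInstance) (P : Prediction) : Prediction :=
  ⟨fun t => I.padHi P t - I.Δ t, I.padHi P⟩

/-- Equivalently, the enlarged lower endpoint `padHi - Δ` does not exceed the revealed one. -/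
lemma padHi_le {P : Prediction} (hP : I.IsPrediction P) (t : ℕ) :
    I.padHi P t ≤ P.lo t + I.Δ t := by
  cases t with
  | zero => rw [padHi, hP.hi_zero, hP.lo_zero, I.Δ_zero]; linarith
  | succ t => exact min_le_right _ _

lemma le_padHi {P : Prediction} (hP : I.IsPrediction P) {t : ℕ} (ht : t ≤ I.T) :
    P.hi t ≤ I.padHi P t := by
  induction t with
  | zero => exact le_rfl
  | succ t ih =>
    have := hP.error (t + 1) ht
    exact le_min ((hP.hi_anti t (by omega)).trans (ih (by omega))) (by linarith)

lemma padding_full {P : Prediction} (hP : I.IsPrediction P) : I.IsFullPrediction (I.padding P) where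
  lo_zero := by simp only [padding, padHi, hP.hi_zero, I.Δ_zero]; ring
  hi_zero := hP.hi_zero
  lo_mono := by
    intro t ht
    simp only [padding, padHi]
    have h1 := padHi_le hP t
    have h2 := hP.lo_mono t ht
    have h3 := I.Δ_succ_le t ht
    rcases min_cases (I.padHi P t) (P.lo (t + 1) + I.Δ (t + 1)) with h | h <;> linarith
  hi_anti := fun t _ => min_le_left _ _
  lo_le_hi := fun t ht => by
    have := I.Δ_nonneg t ht
    simp only [padding]; linarith
  error := fun t _ => by simp [padding]
  length := fun t _ => by simp [padding]

lemma padHi_congr {P P' : Prediction} {t : ℕ} (h : P.AgreeUpTo t P') :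
    I.padHi P t = I.padHi P' t := by
  induction t with
  | zero => exact (h 0 le_rfl).2
  | succ t ih =>
    rw [padHi, padHi, ih fun s hs => h s (by omega), (h (t + 1) le_rfl).1]

lemma padding_agree {P P' : Prediction} {t : ℕ} (h : P.AgreeUpTo t P') :
    (I.padding P).AgreeUpTo t (I.padding P') := by
  intro s hs
  have := padHi_congr (I := I) (P := P) (P' := P') (t := s) fun r hr => h r (hr.trans hs)
  simp only [padding, this, and_self]

/-! ### Implementing the emulator -/

/-- The predictions up to day `t`, continued constantly. -/
def stopped (P : Prediction) (t : ℕ) : Prediction :=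
  ⟨fun s => P.lo (min s t), fun s => P.hi (min s t)⟩

lemma stopped_hi {P : Prediction} {s t : ℕ} (h : s ≤ t) : (stopped P t).hi s = P.hi s := by
  simp [stopped, min_eq_left h]

lemma stopped_eq {P P' : Prediction} {t : ℕ} (h : P.AgreeUpTo t P') :
    stopped P t = stopped P' t := by
  simp only [stopped]
  congr 1 <;> funext s
  · exact (h _ (min_le_right _ _)).1
  · exact (h _ (min_le_right _ _)).2

open Classical in
/-- An optimal solution that obeys the tie-breaking rule, if there is one. -/
noncomputable def tieBrokenSol (m : ℕ) (hm : m < I.L) (S : StaffingState I.n) : I.LPVars m :=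
  if h : ∃ z : I.LPVars m, z.IsOptimal S ∧ z.TieBroken S hm then h.choose else ⟨0, 0, 0, 0⟩

lemma tieBrokenSol_spec {m : ℕ} (hm : m < I.L) {S : StaffingState I.n}
    (hS : I.IsRegularState m S) :
    (tieBrokenSol m hm S).IsOptimal S ∧ (tieBrokenSol m hm S).TieBroken S hm := by
  have h := exists_isOptimal_tieBroken hm hS
  rw [tieBrokenSol, dif_pos h]
  exact h.choose_spec

/-- The hires of epoch `m`, proportional to the canonical ones on each day. -/
noncomputable def oracleHire (P : Prediction) (m : ℕ) (xt : Fin I.n → ℕ → ℝ) (i : Fin I.n)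
    (t : ℕ) : ℝ :=
  xt i t * fill (fun t => ∑ i, xt i t) (fun t => P.hi (I.τ m) - P.hi t) (I.τ m) t

/-- The critical day of epoch `m`. -/
noncomputable def criticalDay (P : Prediction) (m : ℕ) (hm : m < I.L) (xt : Fin I.n → ℕ → ℝ) :
    Icc (I.τ m) (I.τ (m + 1)) :=
  (exists_isCritical P ⟨oracleHire P m xt, 0⟩ hm xt).choose

open Classical in
/-- The releases at the end of epoch `m`. -/
noncomputable def oracleRelease (P : Prediction) (m : ℕ) (hm : m < I.L) (z : I.LPVars m) :
    Fin I.n → ℝ :=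
  if h : ∃ w, ReleaseCondition P ⟨oracleHire P m (z.canonicalHire hm), 0⟩ m (z.canonicalHire hm)
      (criticalDay P m hm (z.canonicalHire hm))
      (z.canonicalRelease (criticalDay P m hm (z.canonicalHire hm))) w
  then h.choose else 0

/-- Extend the decisions `a` of the epochs before epoch `m` to epoch `m`, when the predictions of
the days up to `τ (m + 1)` are known. -/
noncomputable def extendProfile (P : Prediction) (a : Profile I.n) (m : ℕ) : Profile I.n :=
  if hm : m < I.L then
    { x := fun i t => if t ≤ I.τ m then a.x i t
        else oracleHire P m ((tieBrokenSol m hm (I.stateAt P a m)).canonicalHire hm) i t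
      y := fun i t => if t ≤ I.τ m then a.y i t
        else if t = I.τ (m + 1) then oracleRelease P m hm (tieBrokenSol m hm (I.stateAt P a m)) i
        else 0 }
  else a

/-- The decisions of the epochs before epoch `m`. -/
noncomputable def buildProfile (I : StaffingInstance) (P : Prediction) : ℕ → Profile I.n
  | 0 => ⟨0, 0⟩
  | m + 1 => extendProfile (stopped P (I.τ (m + 1))) (buildProfile I P m) m

lemma buildProfile_agree {P P' : Prediction} {m : ℕ} (hm : m ≤ I.L)
    (h : P.AgreeUpTo (I.τ m) P') : I.buildProfile P m = I.buildProfile P' m := by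
  induction m with
  | zero => rfl
  | succ m ih =>
    rw [buildProfile, buildProfile, stopped_eq h,
      ih (by omega) fun s hs => h s (hs.trans (τ_mono (Nat.le_succ m) hm))]

lemma buildProfile_of_le (P : Prediction) {m m' t : ℕ} (hmm : m ≤ m') (hm' : m' ≤ I.L)
    (ht : t ≤ I.τ m) (i : Fin I.n) :
    (I.buildProfile P m').x i t = (I.buildProfile P m).x i t ∧
      (I.buildProfile P m').y i t = (I.buildProfile P m).y i t := by
  induction m', hmm using Nat.le_induction with
  | base => exact ⟨rfl, rfl⟩
  | succ k hk ih =>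
    have h := ht.trans (τ_mono hk (by omega))
    have ih := ih (by omega)
    rw [buildProfile, extendProfile, dif_pos (by omega : k < I.L)]
    simp only [if_pos h]
    exact ih

lemma stateAt_congr {P P' : Prediction} {a a' : Profile I.n} {m : ℕ}
    (hP : P.hi (I.τ m) = P'.hi (I.τ m))
    (ha : ∀ i, ∀ t ≤ I.τ m, a.x i t = a'.x i t ∧ a.y i t = a'.y i t) :
    I.stateAt P a m = I.stateAt P' a' m := by
  have hx : ∀ i, ∀ t ∈ Finset.Icc 1 (I.τ m), a.x i t = a'.x i t :=
    fun i t ht => (ha i t (Finset.mem_Icc.1 ht).2).1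
  have hy : ∀ i, ∀ t ∈ Finset.Icc 1 (I.τ m), a.y i t = a'.y i t :=
    fun i t ht => (ha i t (Finset.mem_Icc.1 ht).2).2
  have h1 : ∀ i, I.net a i (I.τ m) = I.net a' i (I.τ m) := fun i =>
    Finset.sum_congr rfl fun t ht => by rw [hx i t ht, hy i t ht]
  have h2 : I.spent a (I.τ m) = I.spent a' (I.τ m) :=
    Finset.sum_congr rfl fun i _ => Finset.sum_congr rfl fun t ht => by rw [hx i t ht, hy i t ht]
  have h3 : ∀ i, ∑ t ∈ Finset.Icc 1 (I.τ m), 1 / I.ρ i t * a.x i t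
      = ∑ t ∈ Finset.Icc 1 (I.τ m), 1 / I.ρ i t * a'.x i t := fun i =>
    Finset.sum_congr rfl fun t ht => by rw [hx i t ht]
  simp only [stateAt, h1, h2, h3, hP]

/-! ### Dependence on observed predictions and current decisions only -/

section congr

variable {P P' : Prediction} {a a' : Profile I.n} {m : ℕ} {xt : Fin I.n → ℕ → ℝ}
  {k : Icc (I.τ m) (I.τ (m + 1))}

lemma sum_hire_congr (ha : ∀ i, ∀ t ∈ Ioc (I.τ m) (I.τ (m + 1)), a.x i t = a'.x i t)
    (k : Icc (I.τ m) (I.τ (m + 1))) (i : Fin I.n) :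
    ∀ t ∈ Finset.Ioc (I.τ m) (k : ℕ), a.x i t = a'.x i t := fun t ht =>
  ha i t ⟨(Finset.mem_Ioc.1 ht).1, (Finset.mem_Ioc.1 ht).2.trans k.2.2⟩

lemma isCritical_congr (hm : m < I.L) (hP : ∀ t ≤ I.τ (m + 1), P.hi t = P'.hi t)
    (ha : ∀ i, ∀ t ∈ Ioc (I.τ m) (I.τ (m + 1)), a.x i t = a'.x i t) :
    IsCritical P a m xt k ↔ IsCritical P' a' m xt k := by
  have : {k : Icc (I.τ m) (I.τ (m + 1)) |
      P.hi k - ∑ i, ∑ t ∈ Finset.Ioc (I.τ m) k, a.x i t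
        = P.hi (I.τ m) - ∑ i, ∑ t ∈ Finset.Ioc (I.τ m) k, xt i t} =
    {k : Icc (I.τ m) (I.τ (m + 1)) |
      P'.hi k - ∑ i, ∑ t ∈ Finset.Ioc (I.τ m) k, a'.x i t
        = P'.hi (I.τ m) - ∑ i, ∑ t ∈ Finset.Ioc (I.τ m) k, xt i t} := by
    ext k
    simp only [mem_ofPred_eq]
    rw [hP k k.2.2, hP (I.τ m) (I.τ_lt m hm).le,
      Finset.sum_congr rfl fun i _ => Finset.sum_congr rfl (sum_hire_congr ha k i)]
  rw [IsCritical, IsCritical, this]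

lemma releaseCondition_congr {yt w : Fin I.n → ℝ} (hm : m < I.L)
    (hP : ∀ t ≤ I.τ (m + 1), P.hi t = P'.hi t)
    (ha : ∀ i, ∀ t ∈ Ioc (I.τ m) (I.τ (m + 1)), a.x i t = a'.x i t) :
    ReleaseCondition P a m xt k yt w ↔ ReleaseCondition P' a' m xt k yt w := by
  rw [ReleaseCondition, ReleaseCondition, hP (I.τ m) (I.τ_lt m hm).le, hP _ le_rfl]
  have : ∀ i, ∑ t ∈ Finset.Ioc (I.τ m) (k : ℕ), (xt i t - a.x i t)
      = ∑ t ∈ Finset.Ioc (I.τ m) (k : ℕ), (xt i t - a'.x i t) := fun i =>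
    Finset.sum_congr rfl fun t ht => by rw [sum_hire_congr ha k i t ht]
  simp only [this]

lemma oracleHire_congr {t : ℕ} (hP : ∀ s ≤ t, P.hi s = P'.hi s) (ht : I.τ m < t) (i : Fin I.n) :
    oracleHire P m xt i t = oracleHire P' m xt i t := by
  rw [oracleHire, oracleHire, fill, fill]
  have h : ∀ s ≤ t, P.hi (I.τ m) - P.hi s = P'.hi (I.τ m) - P'.hi s := fun s hs => by
    rw [hP s hs, hP _ ht.le]
  rw [cancelled_congr (D' := fun t => P'.hi (I.τ m) - P'.hi t) fun s hs => h s hs.2,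
    cancelled_congr (t := t - 1) (D' := fun t => P'.hi (I.τ m) - P'.hi t)
      fun s hs => h s (hs.2.trans (Nat.sub_le t 1))]

end congr

/-- The decisions of the implementation. -/
noncomputable def emulatorAct (I : StaffingInstance) (P : Prediction) : Profile I.n :=
  I.buildProfile P I.L

/-- The solution that the implementation selects for epoch `m`. -/
noncomputable def emulatorSol (P : Prediction) (m : ℕ) (hm : m < I.L) : I.LPVars m :=
  tieBrokenSol m hm (I.stateAt P (I.emulatorAct P) m)

/-! ### Correctness of the implementation -/

section act

variable {P : Prediction} {m : ℕ}

lemma stateAt_emulatorAct (hm : m < I.L) :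
    I.stateAt (stopped P (I.τ (m + 1))) (I.buildProfile P m) m
      = I.stateAt P (I.emulatorAct P) m := by
  refine stateAt_congr (stopped_hi (I.τ_lt m hm).le) fun i t ht => ?_
  obtain ⟨h1, h2⟩ := buildProfile_of_le P hm.le le_rfl ht i
  exact ⟨h1.symm, h2.symm⟩

lemma emulatorAct_x (hm : m < I.L) (i : Fin I.n) {t : ℕ} (ht : t ∈ Ioc (I.τ m) (I.τ (m + 1))) :
    (I.emulatorAct P).x i t = oracleHire P m ((emulatorSol P m hm).canonicalHire hm) i t := by
  rw [emulatorAct, (buildProfile_of_le P hm le_rfl ht.2 i).1, buildProfile, extendProfile,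
    dif_pos hm]
  simp only [if_neg (not_le.2 ht.1)]
  rw [stateAt_emulatorAct hm, emulatorSol]
  exact oracleHire_congr (fun s hs => stopped_hi (hs.trans ht.2)) ht.1 i

lemma emulatorAct_y (hm : m < I.L) (i : Fin I.n) {t : ℕ} (ht : t ∈ Ioc (I.τ m) (I.τ (m + 1))) :
    (I.emulatorAct P).y i t = if t = I.τ (m + 1)
      then oracleRelease (stopped P (I.τ (m + 1))) m hm (emulatorSol P m hm) i else 0 := by
  rw [emulatorAct, (buildProfile_of_le P hm le_rfl ht.2 i).2, buildProfile, extendProfile,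
    dif_pos hm]
  simp only [if_neg (not_le.2 ht.1)]
  rw [stateAt_emulatorAct hm, emulatorSol]

lemma emulatorSol_congr {P' : Prediction} (hm : m < I.L) (h : P.AgreeUpTo (I.τ m) P') :
    emulatorSol P m hm = emulatorSol P' m hm := by
  rw [emulatorSol, emulatorSol]
  congr 1
  refine stateAt_congr (h _ le_rfl).2 fun i t ht => ?_
  obtain ⟨h1, h2⟩ := buildProfile_of_le P hm.le le_rfl ht i
  obtain ⟨h3, h4⟩ := buildProfile_of_le P' hm.le le_rfl ht i
  rw [emulatorAct, emulatorAct, h1, h2, h3, h4, buildProfile_agree hm.le h]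
  exact ⟨rfl, rfl⟩

lemma emulatorAct_congr {P' : Prediction} {t : ℕ} (ht : t ∈ Icc 1 I.T) (h : P.AgreeUpTo t P')
    (i : Fin I.n) : (I.emulatorAct P).x i t = (I.emulatorAct P').x i t ∧
      (I.emulatorAct P).y i t = (I.emulatorAct P').y i t := by
  obtain ⟨m, hm, htm⟩ := exists_epoch (I := I) (m := 0) (Nat.zero_le _) (t := t)
    ⟨by rw [I.τ_zero]; exact ht.1, ht.2⟩
  have hsol := emulatorSol_congr hm.2 fun s hs => h s (hs.trans htm.1.le)
  rw [emulatorAct_x hm.2 i htm, emulatorAct_x hm.2 i htm, emulatorAct_y hm.2 i htm,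
    emulatorAct_y hm.2 i htm, hsol]
  refine ⟨oracleHire_congr (fun s hs => (h s hs).2) htm.1 i, ?_⟩
  split_ifs with ht'
  -- Releases are selected by choice. Having chosen them from the stopped sequence, equal histories
  -- give literally equal inputs and hence equal choices.
  · rw [stopped_eq (ht' ▸ h)]
  · rfl

/-- Written in terms of cancelled hires, the oracle rule is the recursion defining `cancelled`:
cancel as much as possible, subject to the current hires and to the total fall of the upper
endpoint. -/
lemma followsOracle_oracleHire (hP : I.IsFullPrediction P) (hm : m < I.L) {a : Profile I.n}
    {xt : Fin I.n → ℕ → ℝ} (hxt : ∀ i, ∀ t ∈ Ioc (I.τ m) (I.τ (m + 1)), 0 ≤ xt i t)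
    (ha : ∀ i, ∀ t ∈ Ioc (I.τ m) (I.τ (m + 1)), a.x i t = oracleHire P m xt i t) :
    FollowsOracle P a m xt := by
  set X : ℕ → ℝ := fun t => ∑ i, xt i t with hX
  set D : ℕ → ℝ := fun t => P.hi (I.τ m) - P.hi t with hD
  have hXn : ∀ t ∈ Ioc (I.τ m) (I.τ (m + 1)), 0 ≤ X t :=
    fun t ht => Finset.sum_nonneg fun i _ => hxt i t ht
  have hD0 : D (I.τ m) = 0 := sub_self _
  have hDm : ∀ t, I.τ m ≤ t → t < I.τ (m + 1) → D t ≤ D (t + 1) := by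
    intro t _ ht
    have := hP.hi_anti t (ht.trans_le (τ_le_T hm))
    simp only [hD]; linarith
  have hsum : ∀ t ∈ Ioc (I.τ m) (I.τ (m + 1)), ∑ i, a.x i t
      = X t - (cancelled X D (I.τ m) t - cancelled X D (I.τ m) (t - 1)) := by
    intro t ht
    rw [← mul_fill hXn hD0 hDm ht, hX, Finset.sum_mul]
    exact Finset.sum_congr rfl fun i _ => ha i t ht
  intro t ht
  refine ⟨fun i => ?_, ?_⟩
  · rw [ha i t ht]
    exact ⟨mul_nonneg (hxt i t ht) (fill_nonneg hXn ht),
      mul_le_of_le_one_right (hxt i t ht) (fill_le_one hXn hD0 hDm ht)⟩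
  · have h1 : ∑ s ∈ Finset.Ioo (I.τ m) t, ∑ i, a.x i s
        = ∑ s ∈ Finset.Ioc (I.τ m) (t - 1), X s - cancelled X D (I.τ m) (t - 1) := by
      have h2 := sum_Ioc_telescope (cancelled X D (I.τ m)) (show I.τ m ≤ t - 1 by
        have := ht.1; omega)
      rw [cancelled_self, sub_zero] at h2
      rw [Ioo_eq_Ioc_pred ht.1, ← h2, ← Finset.sum_sub_distrib]
      refine Finset.sum_congr rfl fun s hs => hsum s ?_
      rw [Finset.mem_Ioc] at hs
      have := ht.2
      exact ⟨hs.1, by omega⟩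
    obtain ⟨s, rfl⟩ : ∃ s, t = s + 1 := ⟨t - 1, by have := ht.1; omega⟩
    rw [hsum _ ht, h1, sum_Ioc_pred ht.1, cancelled_succ (by have := ht.1; omega),
      Nat.add_sub_cancel]
    show X (s + 1) - _ = max 0 (∑ s ∈ Finset.Ioc (I.τ m) s, X s + X (s + 1) - _ - D (s + 1))
    rcases min_cases (cancelled X D (I.τ m) s + X (s + 1)) (D (s + 1)) with h | h
    · rw [h.1, max_eq_left (by linarith)]; ring
    · rw [h.1, max_eq_right (by linarith)]; ring

lemma epochRun_emulatorAct (hP : I.IsFullPrediction P) (hm : m < I.L)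
    (ha : I.FeasibleUpTo (I.emulatorAct P) (I.τ m)) {k : Icc (I.τ m) (I.τ (m + 1))}
    (hk : IsCritical P (I.emulatorAct P) m ((emulatorSol P m hm).canonicalHire hm) k) :
    EpochRun P (I.emulatorAct P) m hm (emulatorSol P m hm) k := by
  have hτ := I.τ_lt m hm
  have hreg := isRegularState_stateAt hP hm.le ha
  obtain ⟨⟨hz, -⟩, htie⟩ : (emulatorSol P m hm).IsOptimal _ ∧
    (emulatorSol P m hm).TieBroken _ hm := tieBrokenSol_spec hm hreg
  set z := emulatorSol P m hm with hzdef
  have hxt : ∀ i, ∀ t ∈ Ioc (I.τ m) (I.τ (m + 1)), 0 ≤ z.canonicalHire hm i t :=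
    fun i t ht => hz.x_nonneg _ i t ⟨ht.1, ht.2.trans (τ_le_T hm)⟩
  have hx := fun i t (ht : t ∈ Ioc (I.τ m) (I.τ (m + 1))) => emulatorAct_x (P := P) hm i ht
  set Q := stopped P (I.τ (m + 1)) with hQ
  have hPQ : ∀ t ≤ I.τ (m + 1), P.hi t = Q.hi t := fun t ht => (stopped_hi ht).symm
  have hxQ : ∀ i, ∀ t ∈ Ioc (I.τ m) (I.τ (m + 1)), (I.emulatorAct P).x i t
      = (⟨oracleHire Q m (z.canonicalHire hm), 0⟩ : Profile I.n).x i t := fun i t ht =>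
    (hx i t ht).trans (oracleHire_congr (fun s hs => hPQ s (hs.trans ht.2)) ht.1 i)
  -- The critical day is a greatest element, hence unique, so the day chosen from the stopped
  -- sequence is the given one.
  have hkQ : criticalDay Q m hm (z.canonicalHire hm) = k :=
    ((exists_isCritical Q ⟨oracleHire Q m (z.canonicalHire hm), 0⟩ hm
      (z.canonicalHire hm)).choose_spec).unique ((isCritical_congr hm hPQ hxQ).1 hk)
  refine ⟨followsOracle_oracleHire hP hm hxt hx, ?_, hk, ?_, htie.no_waste k, ?_⟩
  · intro t ht i
    rw [emulatorAct_y hm i ⟨ht.1, ht.2.le⟩, if_neg ht.2.ne]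
  · have hy : ∀ i, (I.emulatorAct P).y i (I.τ (m + 1)) = oracleRelease Q m hm z i := fun i => by
      rw [emulatorAct_y hm i ⟨hτ, le_rfl⟩, if_pos rfl]
    have hfun : (fun i => (I.emulatorAct P).y i (I.τ (m + 1))) = oracleRelease Q m hm z :=
      funext hy
    rw [hfun]
    by_cases h : ∃ w, ReleaseCondition Q ⟨oracleHire Q m (z.canonicalHire hm), 0⟩ m
        (z.canonicalHire hm) (criticalDay Q m hm (z.canonicalHire hm))
        (z.canonicalRelease (criticalDay Q m hm (z.canonicalHire hm))) w
    · left
      have hs := h.choose_spec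
      rw [oracleRelease, dif_pos h]
      rw [releaseCondition_congr hm hPQ hxQ]
      simp only [hkQ] at hs ⊢
      exact hs
    · right
      refine ⟨fun i => ?_, ?_⟩
      · rw [hy, oracleRelease, dif_neg h]; rfl
      · rintro ⟨w, hw⟩
        apply h
        rw [releaseCondition_congr hm hPQ hxQ] at hw
        rw [hkQ]
        exact ⟨w, hw⟩
  · intro i
    refine (htie.implementable k i).trans (add_le_add le_rfl ?_)
    refine (Finset.sum_le_sum (g := fun t => (I.emulatorAct P).x i t) fun t ht => ?_).trans
      (Finset.sum_le_sum_of_subset_of_nonneg (Finset.Ioc_subset_Ioc_right k.2.2)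
        fun t ht _ => ?_)
    · rw [Finset.mem_Ioc] at ht
      have htm : t ∈ Ioc (I.τ m) (I.τ (m + 1)) := ⟨ht.1, ht.2.trans k.2.2⟩
      rw [hx i t htm]
      -- Lengths are exact and the lower endpoint never decreases, so the upper endpoint falls on
      -- each day by at most the decrease of `Δ`. Secure hires assume this extreme fall.
      refine mul_le_mul_of_nonneg_left (fill_anti (t₁ := I.τ (m + 1)) ?_ (sub_self _) (sub_self _)
        ?_ htm) (hxt i t htm)
      · exact fun t ht => Finset.sum_nonneg fun i _ => hxt i t ht
      · intro s _ hs
        have h0 := hs.trans_le (τ_le_T hm)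
        have h1 := hP.length s h0.le
        have h2 := hP.length (s + 1) h0
        have h3 := hP.lo_mono s h0
        linarith
    · rw [Finset.mem_Ioc] at ht
      exact ((followsOracle_oracleHire hP hm hxt hx t ht).1 i).1

/-- Feasibility and the validity of the selected solution are established alternately: an optimal
tie-broken solution is available for a regular state, which requires feasible past decisions. -/
lemma feasibleUpTo_emulatorAct (hP : I.IsFullPrediction P) (hm : m ≤ I.L) :
    I.FeasibleUpTo (I.emulatorAct P) (I.τ m) := by
  induction m with
  | zero => rw [I.τ_zero]; exact feasibleUpTo_zero _
  | succ m ih =>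
    have ha := ih (by omega)
    obtain ⟨k, hk⟩ := exists_isCritical P (I.emulatorAct P) hm
      ((emulatorSol P m hm).canonicalHire hm)
    exact (epochRun_emulatorAct hP hm ha hk).feasibleUpTo hP ha
      (tieBrokenSol_spec hm (isRegularState_stateAt hP (by omega) ha)).1.1

end act

open Classical in
/-- The emulator can be implemented. -/
theorem nonempty_emulator (I : StaffingInstance) : Nonempty I.Emulator := by
  have hrun : ∀ P, I.IsPrediction P → ∀ m, ∀ hm : m < I.L, ∀ k,
      IsCritical (I.padding P) (I.emulatorAct (I.padding P)) m
        ((emulatorSol (I.padding P) m hm).canonicalHire hm) k →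
      EpochRun (I.padding P) (I.emulatorAct (I.padding P)) m hm
        (emulatorSol (I.padding P) m hm) k := fun P hP m hm k hk =>
    epochRun_emulatorAct (padding_full hP) hm (feasibleUpTo_emulatorAct (padding_full hP) hm.le) hk
  have hcrit := fun P m (hm : m < I.L) => exists_isCritical (I.padding P)
    (I.emulatorAct (I.padding P)) hm ((emulatorSol (I.padding P) m hm).canonicalHire hm)
  have hsol : ∀ P m (hm : m < I.L), (if h : m < I.L then emulatorSol (I.padding P) m h
      else ⟨0, 0, 0, 0⟩) = emulatorSol (I.padding P) m hm := fun P m hm => dif_pos hm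
  refine ⟨{
    pad := I.padding
    sol := fun P m => if h : m < I.L then emulatorSol (I.padding P) m h else ⟨0, 0, 0, 0⟩
    act := fun P => I.emulatorAct (I.padding P)
    pad_isPrediction := fun P hP => (padding_full hP).toIsPrediction
    pad_length := fun P hP => (padding_full hP).length
    pad_contains := ?_
    pad_online := fun P P' _ _ t _ h => padding_agree h
    sol_online := ?_
    act_online := fun P P' _ _ t ht h i => emulatorAct_congr ht (padding_agree h) i
    resolve := ?_
    hire := ?_
    no_release := ?_
    release := ?_
    no_waste := ?_
    implementable := ?_ }⟩
  · intro P hP t ht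
    refine Icc_subset_Icc ?_ (le_padHi hP ht)
    have := padHi_le hP t
    simp only [padding]; linarith
  · intro P P' _ _ m hm h
    rw [hsol P m hm, hsol P' m hm]
    exact emulatorSol_congr hm (padding_agree h)
  · intro P hP m hm
    rw [hsol P m hm]
    exact (tieBrokenSol_spec hm (isRegularState_stateAt (padding_full hP) hm.le
      (feasibleUpTo_emulatorAct (padding_full hP) hm.le))).1
  · intro P hP m hm
    rw [hsol P m hm]
    obtain ⟨k, hk⟩ := hcrit P m hm
    exact (hrun P hP m hm k hk).hire
  · intro P hP m hm
    obtain ⟨k, hk⟩ := hcrit P m hm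
    exact (hrun P hP m hm k hk).no_release
  · intro P hP m hm k
    rw [hsol P m hm]
    exact fun hk => (hrun P hP m hm k hk).release
  · intro P hP m hm k
    rw [hsol P m hm]
    exact fun hk => (hrun P hP m hm k hk).no_waste
  · intro P hP m hm k
    rw [hsol P m hm]
    exact fun hk => (hrun P hP m hm k hk).implementable

/-! ### The lower bound -/

/-- `v` is the expectation of the integrable function `F`. -/
def IsMean {Ω : Type u} [MeasurableSpace Ω] (μ : Measure Ω) (F : Ω → ℝ) (v : ℝ) : Prop :=
  Integrable F μ ∧ ∫ ω, F ω ∂μ = v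

namespace IsMean

variable {Ω : Type u} [MeasurableSpace Ω] {μ : Measure Ω} {F G : Ω → ℝ} {v w : ℝ}

lemma add (hF : IsMean μ F v) (hG : IsMean μ G w) : IsMean μ (fun ω => F ω + G ω) (v + w) :=
  ⟨hF.1.add hG.1, by rw [integral_add hF.1 hG.1, hF.2, hG.2]⟩

lemma sub (hF : IsMean μ F v) (hG : IsMean μ G w) : IsMean μ (fun ω => F ω - G ω) (v - w) :=
  ⟨hF.1.sub hG.1, by rw [integral_sub hF.1 hG.1, hF.2, hG.2]⟩

lemma const_mul (hF : IsMean μ F v) (c : ℝ) : IsMean μ (fun ω => c * F ω) (c * v) :=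
  ⟨hF.1.const_mul c, by rw [integral_const_mul, hF.2]⟩

lemma sum {ι : Type*} {s : Finset ι} {F : ι → Ω → ℝ} {v : ι → ℝ}
    (h : ∀ i ∈ s, IsMean μ (F i) (v i)) : IsMean μ (fun ω => ∑ i ∈ s, F i ω) (∑ i ∈ s, v i) :=
  ⟨integrable_finsetSum _ fun i hi => (h i hi).1, by
    rw [integral_finsetSum _ fun i hi => (h i hi).1]
    exact Finset.sum_congr rfl fun i hi => (h i hi).2⟩

lemma const [IsProbabilityMeasure μ] (c : ℝ) : IsMean μ (fun _ => c) c :=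
  ⟨integrable_const c, by simp⟩

lemma mono (hF : IsMean μ F v) (hG : IsMean μ G w) (h : ∀ ω, F ω ≤ G ω) : v ≤ w := by
  rw [← hF.2, ← hG.2]
  exact integral_mono hF.1 hG.1 h

lemma le [IsProbabilityMeasure μ] (hF : IsMean μ F v) {c : ℝ} (h : ∀ ω, F ω ≤ c) : v ≤ c :=
  hF.mono (const c) h

lemma ge [IsProbabilityMeasure μ] (hF : IsMean μ F v) {c : ℝ} (h : ∀ ω, c ≤ F ω) : c ≤ v :=
  (const c).mono hF h

end IsMean

/-- The predictions of a configuration. -/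
noncomputable def configPrediction (J : I.Config 0) : Prediction :=
  ⟨fun t => (I.configInterval I.initialState J t).1,
    fun t => (I.configInterval I.initialState J t).2⟩

lemma configPrediction_isPrediction (J : I.Config 0) : I.IsPrediction (configPrediction J) := by
  have hS := (isRegularState_initialState (I := I)).lo_eq
  have hlen : ∀ t, (I.configInterval I.initialState J t).1
      = (I.configInterval I.initialState J t).2 - I.Δ t := fun t =>
    configInterval_fst J hS (by rw [I.τ_zero]; exact Nat.zero_le t)
  have hstep : ∀ t, ¬ t + 1 ≤ I.τ 0 := fun t => by rw [I.τ_zero]; omega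
  refine ⟨rfl, rfl, ?_, ?_, ?_, ?_⟩
  · intro t ht
    have h1 := hlen t
    have h2 := I.Δ_succ_le t ht
    simp only [configPrediction]
    rw [configInterval, if_neg (hstep t)]
    split_ifs
    · simp only; linarith
    · exact le_rfl
  · intro t ht
    have h1 := hlen t
    have h2 := I.Δ_succ_le t ht
    simp only [configPrediction]
    rw [configInterval, if_neg (hstep t)]
    split_ifs
    · exact le_rfl
    · simp only; linarith
  · intro t ht
    have h1 := hlen t
    have h2 := I.Δ_nonneg t ht
    simp only [configPrediction]; linarith
  · intro t _
    have h1 := hlen t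
    simp only [configPrediction]; linarith

lemma configPrediction_agree {J J' : I.Config 0} {t : ℕ} (ht : t ≤ I.T) (h : Indist t J J') :
    (configPrediction J).AgreeUpTo t (configPrediction J') := by
  have key : ∀ s ≤ t, I.configInterval I.initialState J s
      = I.configInterval I.initialState J' s := by
    intro s
    induction s with
    | zero => intro _; rfl
    | succ s ih =>
      intro hs
      obtain ⟨j, hj, hsj⟩ := exists_epoch (I := I) (m := 0) (Nat.zero_le _) (t := s + 1)
        ⟨by rw [I.τ_zero]; omega, hs.trans ht⟩
      have hiff : I.BeforeSwitch J (s + 1) ↔ I.BeforeSwitch J' (s + 1) := by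
        rw [beforeSwitch_iff J hj hsj, beforeSwitch_iff J' hj hsj]
        have := h j hj
        omega
      rw [configInterval, configInterval, ih (by omega)]
      by_cases hb : I.BeforeSwitch J' (s + 1)
      · rw [if_pos (hiff.2 hb), if_pos hb]
      · rw [if_neg (mt hiff.1 hb), if_neg hb]
  intro s hs
  simp only [configPrediction, key s hs, and_self]

lemma Ioc_τ_zero (t : ℕ) : Finset.Ioc (I.τ 0) t = Finset.Icc 1 t := by
  rw [I.τ_zero]; ext; simp; omega

lemma sum_epochs (f : ℕ → ℝ) {ℓ : ℕ} (hℓ : ℓ ≤ I.L) :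
    ∑ j ∈ Finset.Ico 0 ℓ, ∑ t ∈ Finset.Ioc (I.τ j) (I.τ (j + 1)), f t
      = ∑ t ∈ Finset.Icc 1 (I.τ ℓ), f t := by
  induction ℓ with
  | zero => simp [I.τ_zero]
  | succ ℓ ih =>
    rw [Finset.sum_Ico_succ_top (Nat.zero_le ℓ), ih (by omega),
      sum_Icc_split _ (I.τ_lt ℓ hℓ).le]

lemma IsFeasible.x_le {a : Profile I.n} (ha : I.IsFeasible a) (i : Fin I.n) {t : ℕ}
    (ht : t ∈ Icc 1 I.T) : a.x i t ≤ I.supply i * I.ρ i t := by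
  have h := (Finset.single_le_sum (f := fun t => 1 / I.ρ i t * a.x i t) (fun s hs =>
    mul_nonneg (one_div_nonneg.2 (ρ_pos i s).le) (ha.x_nonneg i s (by simpa using hs)))
    (Finset.mem_Icc.2 ht)).trans (ha.supply i)
  simp only [one_div] at h
  rwa [inv_mul_le_iff₀ (ρ_pos i t), mul_comm] at h

lemma IsFeasible.y_le {a : Profile I.n} (ha : I.IsFeasible a) (i : Fin I.n) {t : ℕ}
    (ht : t ∈ Icc 1 I.T) : a.y i t ≤ ∑ s ∈ Finset.Icc 1 t, I.supply i * I.ρ i s := by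
  refine (Finset.single_le_sum (f := fun t => a.y i t) (fun s hs => ?_)
    (Finset.mem_Icc.2 ⟨ht.1, le_rfl⟩)).trans ((ha.release i t ht).trans
    (Finset.sum_le_sum fun s hs => ?_))
  · rw [Finset.mem_Icc] at hs
    exact ha.y_nonneg i s ⟨hs.1, hs.2.trans ht.2⟩
  · rw [Finset.mem_Icc] at hs
    exact ha.x_le i ⟨hs.1, hs.2.trans ht.2⟩

/-- The releases of epoch `j`. -/
noncomputable def epochRelease (a : Profile I.n) (i : Fin I.n) (j : ℕ) : ℝ :=
  ∑ t ∈ Finset.Ioc (I.τ j) (I.τ (j + 1)), a.y i t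

lemma mem_Icc_of_epoch {j t : ℕ} (hj : j < I.L) (ht : t ∈ Finset.Ioc (I.τ j) (I.τ (j + 1))) :
    t ∈ Icc 1 I.T := by
  rw [Finset.mem_Ioc] at ht
  exact ⟨by omega, ht.2.trans (τ_le_T hj)⟩

/-- Fees are constant within an epoch, so releases on different days of an epoch can be merged, as
in the linear program. -/
lemma IsFeasible.budget_real {a : Profile I.n} (ha : I.IsFeasible a) :
    (∀ j ∈ Ico 0 I.L, I.epochFee j = ⊤ → ∑ i, epochRelease a i j = 0) ∧
      ∑ i, ∑ t ∈ Finset.Icc 1 I.T, I.wage i t * a.x i t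
        + ∑ j ∈ Finset.Ico 0 I.L, (I.epochFee j).toReal * ∑ i, epochRelease a i j ≤ I.B := by
  have h := (budget_iff (I := I) (m := 0) (D := Finset.Icc 1 I.T) (x := a.x) (y := epochRelease a)
    (fun i t ht => ha.x_nonneg i t (by simpa using ht))
    (fun i j hj => Finset.sum_nonneg fun t ht => ha.y_nonneg i t (mem_Icc_of_epoch hj.2 ht))
    (β := I.B) ENNReal.coe_ne_top).1 (le_of_eq_of_le ?_ ha.budget)
  · simpa using h
  · rw [spent]
    refine Finset.sum_congr rfl fun i _ => ?_
    rw [Finset.sum_add_distrib]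
    congr 1
    have key : ∀ ℓ ≤ I.L, ∑ j ∈ Finset.Ico 0 ℓ,
        I.fee i (I.τ (j + 1)) * ENNReal.ofReal (epochRelease a i j)
        = ∑ t ∈ Finset.Icc 1 (I.τ ℓ), I.fee i t * ENNReal.ofReal (a.y i t) := by
      intro ℓ
      induction ℓ with
      | zero => intro _; simp [I.τ_zero]
      | succ ℓ ih =>
        intro hℓ
        rw [Finset.sum_Ico_succ_top (Nat.zero_le ℓ), ih (by omega),
          sum_Icc_split _ (I.τ_lt ℓ hℓ).le]
        congr 1
        rw [epochRelease, ENNReal.ofReal_sum_of_nonneg fun t ht =>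
          ha.y_nonneg i t (mem_Icc_of_epoch hℓ ht), Finset.mul_sum]
        refine Finset.sum_congr rfl fun t ht => ?_
        rw [fee_last hℓ, fee_eq hℓ (by simpa using ht)]
    have := key I.L le_rfl
    rwa [I.τ_last] at this

/-! ### Averaging a randomized algorithm -/

section algorithm

variable {Ω : Type u} [MeasurableSpace Ω] {μ : Measure Ω} [IsProbabilityMeasure μ]
  {A : Ω → Prediction → Profile I.n}

/-- Feasibility for every seed bounds the hires by the supply, which gives integrability. -/
lemma isMean_x (hA : I.IsOnlineAlgorithm A) (J : I.Config 0) (i : Fin I.n) {t : ℕ}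
    (ht : t ∈ Icc 1 I.T) :
    IsMean μ (fun ω => (A ω (configPrediction J)).x i t)
      (∫ ω, (A ω (configPrediction J)).x i t ∂μ) := by
  have hJ := configPrediction_isPrediction J
  refine ⟨Integrable.of_mem_Icc 0 (I.supply i * I.ρ i t)
    (hA.measurable_x _ hJ i t ht).aemeasurable (Filter.Eventually.of_forall fun ω => ?_), rfl⟩
  exact ⟨(hA.feasible ω _ hJ).x_nonneg i t ht, (hA.feasible ω _ hJ).x_le i ht⟩

lemma isMean_y (hA : I.IsOnlineAlgorithm A) (J : I.Config 0) (i : Fin I.n) {t : ℕ}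
    (ht : t ∈ Icc 1 I.T) :
    IsMean μ (fun ω => (A ω (configPrediction J)).y i t)
      (∫ ω, (A ω (configPrediction J)).y i t ∂μ) := by
  have hJ := configPrediction_isPrediction J
  refine ⟨Integrable.of_mem_Icc 0 (∑ s ∈ Finset.Icc 1 t, I.supply i * I.ρ i s)
    (hA.measurable_y _ hJ i t ht).aemeasurable (Filter.Eventually.of_forall fun ω => ?_), rfl⟩
  exact ⟨(hA.feasible ω _ hJ).y_nonneg i t ht, (hA.feasible ω _ hJ).y_le i ht⟩

variable (μ A) in
/-- The expected final number of workers. -/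
noncomputable def meanNet (J : I.Config 0) : ℝ :=
  ∫ ω, ∑ i, I.net (A ω (configPrediction J)) i I.T ∂μ

variable (μ A) in
/-- The averages of the decisions of a randomized algorithm. -/
noncomputable def meanVars : I.LPVars 0 where
  x := fun J i t => ∫ ω, (A ω (configPrediction J)).x i t ∂μ
  y := fun J i j => ∑ t ∈ Finset.Ioc (I.τ j) (I.τ (j + 1)), ∫ ω, (A ω (configPrediction J)).y i t ∂μ
  lam := fun J => max 0 (meanNet μ A J - (I.configInterval I.initialState J I.T).1)
  θ := fun J => max 0 ((I.configInterval I.initialState J I.T).2 - meanNet μ A J)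

lemma isMean_epochRelease (hA : I.IsOnlineAlgorithm A) (J : I.Config 0) (i : Fin I.n) {j : ℕ}
    (hj : j < I.L) :
    IsMean μ (fun ω => epochRelease (A ω (configPrediction J)) i j) ((meanVars μ A).y J i j) :=
  IsMean.sum fun _ ht => isMean_y hA J i (mem_Icc_of_epoch hj ht)

lemma isMean_net (hA : I.IsOnlineAlgorithm A) (J : I.Config 0) :
    IsMean μ (fun ω => ∑ i, I.net (A ω (configPrediction J)) i I.T) (meanNet μ A J) := by
  have h : IsMean μ (fun ω => ∑ i, I.net (A ω (configPrediction J)) i I.T) _ :=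
    IsMean.sum fun i _ => IsMean.sum fun _ ht =>
      (isMean_x (μ := μ) hA J i (by simpa using ht)).sub (isMean_y hA J i (by simpa using ht))
  exact ⟨h.1, rfl⟩

lemma meanVars_final (hA : I.IsOnlineAlgorithm A) (J : I.Config 0) :
    (meanVars μ A).final I.initialState J = meanNet μ A J := by
  have h : IsMean μ (fun ω => ∑ i, I.net (A ω (configPrediction J)) i I.T) _ :=
    IsMean.sum fun i _ => IsMean.sum fun _ ht =>
      (isMean_x (μ := μ) hA J i (by simpa using ht)).sub (isMean_y hA J i (by simpa using ht))
  rw [meanNet, h.2, LPVars.final]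
  refine Finset.sum_congr rfl fun i _ => ?_
  have h2 := sum_epochs (I := I)
    (fun t => ∫ ω, (A ω (configPrediction J)).y i t ∂μ) le_rfl
  rw [I.τ_last] at h2
  rw [Finset.sum_sub_distrib, ← h2, Ioc_τ_zero]
  simp [initialState, meanVars]

/-- Every constraint holds for each seed and is linear, so it passes to expectations. Infinite fees
are first separated as prohibitions. Nonanticipativity holds because indistinguishable
configurations show equal predictions to the algorithm. -/
lemma meanVars_isFeasible (hA : I.IsOnlineAlgorithm A) :
    (meanVars μ A).IsFeasible I.initialState := by
  have hJ := fun J : I.Config 0 => configPrediction_isPrediction J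
  have hx : ∀ J i, ∀ t ∈ Icc 1 I.T, 0 ≤ (meanVars μ A).x J i t := fun J i t ht =>
    (isMean_x hA J i ht).ge fun ω => (hA.feasible ω _ (hJ J)).x_nonneg i t ht
  have hy : ∀ J i, ∀ j ∈ Ico 0 I.L, 0 ≤ (meanVars μ A).y J i j := fun J i j hj =>
    (isMean_epochRelease hA J i hj.2).ge fun ω => Finset.sum_nonneg fun t ht =>
      (hA.feasible ω _ (hJ J)).y_nonneg i t (mem_Icc_of_epoch hj.2 ht)
  have hday : ∀ t, t ∈ Ioc (I.τ 0) I.T ↔ t ∈ Icc 1 I.T := fun t => by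
    rw [I.τ_zero]; simp only [mem_Ioc, mem_Icc]; omega
  have honline : ∀ J J' : I.Config 0, ∀ t ∈ Icc 1 I.T, Indist t J J' → ∀ i,
      (meanVars μ A).x J i t = (meanVars μ A).x J' i t ∧
      ∫ ω, (A ω (configPrediction J)).y i t ∂μ = ∫ ω, (A ω (configPrediction J')).y i t ∂μ := by
    intro J J' t ht h i
    have := fun ω => hA.online ω _ _ (hJ J) (hJ J') t ht (configPrediction_agree ht.2 h) i
    constructor
    · exact integral_congr_ae (Filter.Eventually.of_forall fun ω => (this ω).1)
    · exact integral_congr_ae (Filter.Eventually.of_forall fun ω => (this ω).2)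
  refine ⟨fun J i t ht => hx J i t ((hday t).1 ht), hy, fun J => le_max_left _ _,
    fun J => le_max_left _ _, ?_, ?_, ?_, ?_, ?_, ?_, ?_⟩
  · intro ℓ J J' h i t ht
    refine (honline J J' t ((hday t).1 ⟨ht.1, ?_⟩) (indist_of_identical ℓ h ht.2) i).1
    exact (ht.2.trans (min_le_left _ _)).trans ((J ℓ).2.2.trans (τ_le_T ℓ.2.2))
  · intro ℓ J J' h i
    simp only [meanVars]
    refine Finset.sum_congr rfl fun t ht => ?_
    exact (honline J J' t (mem_Icc_of_epoch ℓ.2.2 ht)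
      ((indist_of_identical' ℓ h).mono (Finset.mem_Ioc.1 ht).2) i).2
  · intro J i
    have h0 : I.ρ i (I.τ 0) = 1 := by simp [I.τ_zero, ρ]
    rw [Ioc_τ_zero, h0]
    simp only [div_one]
    have := IsMean.sum (μ := μ) (s := Finset.Icc 1 I.T) fun t ht =>
      (isMean_x hA J i (Finset.mem_Icc.1 ht)).const_mul (1 / I.ρ i t)
    exact this.le fun ω => (hA.feasible ω _ (hJ J)).supply i
  · intro J
    have hb := fun ω => (hA.feasible ω _ (hJ J)).budget_real
    refine (budget_iff (fun i t ht => hx J i t ((hday t).1 (by simpa using ht))) (hy J)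
      (isRegularState_initialState (I := I)).budget_ne_top).2 ⟨?_, ?_⟩
    · intro j hj htop
      have := IsMean.sum (μ := μ) (s := Finset.univ) fun i _ => isMean_epochRelease hA J i hj.2
      exact le_antisymm (this.le fun ω => ((hb ω).1 j hj htop).le)
        (this.ge fun ω => ((hb ω).1 j hj htop).ge)
    · rw [Ioc_τ_zero]
      have h1 := IsMean.sum (μ := μ) (s := Finset.univ) fun i _ =>
        IsMean.sum (s := Finset.Icc 1 I.T) fun t ht =>
          (isMean_x hA J i (by simpa using ht)).const_mul (I.wage i t)
      have h2 := IsMean.sum (μ := μ) (s := Finset.Ico 0 I.L) fun j hj =>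
        (IsMean.sum (s := Finset.univ) fun i _ =>
          isMean_epochRelease hA J i (Finset.mem_Ico.1 hj).2).const_mul (I.epochFee j).toReal
      exact (h1.add h2).le fun ω => (hb ω).2
  · intro J i ℓ hℓ
    have hτ := I.τ_lt ℓ hℓ.2
    have e : Finset.Icc 0 ℓ = Finset.Ico 0 (ℓ + 1) := by ext; simp
    rw [e, Ioc_τ_zero]
    have h1 := sum_epochs (I := I) (fun t => ∫ ω, (A ω (configPrediction J)).y i t ∂μ) hℓ.2
    simp only [meanVars]
    rw [h1]
    have hmem : ∀ t ∈ Finset.Icc 1 (I.τ (ℓ + 1)), t ∈ Icc 1 I.T := fun t ht =>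
      ⟨(Finset.mem_Icc.1 ht).1, (Finset.mem_Icc.1 ht).2.trans (τ_le_T hℓ.2)⟩
    have h2 := IsMean.sum (μ := μ) fun t ht => isMean_y hA J i (hmem t ht)
    have h3 := IsMean.sum (μ := μ) fun t ht => isMean_x hA J i (hmem t ht)
    have := h2.mono h3 fun ω => (hA.feasible ω _ (hJ J)).release i (I.τ (ℓ + 1))
      ⟨by omega, τ_le_T hℓ.2⟩
    simpa [initialState] using this
  · intro J
    rw [meanVars_final hA]
    have : _ ≤ (meanVars μ A).lam J := le_max_right _ _
    linarith
  · intro J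
    rw [meanVars_final hA]
    have : _ ≤ (meanVars μ A).θ J := le_max_right _ _
    linarith

/-- Jensen's inequality for the positive part of a bounded random variable. -/
lemma jensen_max {f : ℝ → ℝ} (hf : ConvexOn ℝ (Ici 0) f) (hf' : MonotoneOn f (Ici 0))
    (hf0 : f 0 = 0) {F : Ω → ℝ} {v K : ℝ} (hF : IsMean μ F v) (hK : ∀ ω, F ω ≤ K) :
    ENNReal.ofReal (f (max 0 v)) ≤ ∫⁻ ω, ENNReal.ofReal (f (max 0 (F ω))) ∂μ := by
  have hcont := continuous_comp_max hf hf'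
  have hmono : ∀ a b : ℝ, a ≤ b → f (max 0 a) ≤ f (max 0 b) := fun a b hab =>
    hf' (mem_Ici.2 (le_max_left _ _)) (mem_Ici.2 (le_max_left _ _)) (max_le_max_left 0 hab)
  have hnn : ∀ a : ℝ, 0 ≤ f (max 0 a) := fun a => by
    have := hf' (mem_Ici.2 (le_refl (0 : ℝ))) (mem_Ici.2 (le_max_left 0 a)) (le_max_left 0 a)
    rwa [hf0] at this
  have hint : Integrable (fun ω => f (max 0 (F ω))) μ :=
    Integrable.of_mem_Icc 0 (f (max 0 K)) (hcont.measurable.comp_aemeasurable hF.1.aemeasurable)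
      (Filter.Eventually.of_forall fun ω => ⟨hnn _, hmono _ _ (hK ω)⟩)
  have hJ := (convexOn_comp_max hf hf').map_integral_le hcont.continuousOn isClosed_univ
    (Filter.Eventually.of_forall fun ω => mem_univ (F ω)) hF.1 hint
  rw [hF.2] at hJ
  rw [← ofReal_integral_eq_lintegral_ofReal hint (Filter.Eventually.of_forall fun ω => hnn _)]
  exact ENNReal.ofReal_le_ofReal hJ

/-- In each configuration the extreme demands are admissible: the upper endpoint charges
understaffing and the lower one overstaffing. Jensen's inequality moves the expectation inside each
cost, so the averaged solution costs no more than the guarantee. -/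
lemma lpValue_le_costGuarantee (hA : I.IsOnlineAlgorithm A) :
    ENNReal.ofReal I.lpValue ≤ I.costGuarantee μ A := by
  have hJ := fun J : I.Config 0 => configPrediction_isPrediction J
  have hle : ∀ (J : I.Config 0) d,
      d ∈ Icc ((configPrediction J).lo I.T) ((configPrediction J).hi I.T) →
      ∫⁻ ω, ENNReal.ofReal (I.cost (A ω (configPrediction J)) d) ∂μ ≤ I.costGuarantee μ A :=
    fun J d hd => le_iSup₂_of_le (configPrediction J) (hJ J)
      (le_iSup₂_of_le (f := fun d _ => ∫⁻ ω, ENNReal.ofReal (I.cost (A ω (configPrediction J)) d) ∂μ)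
        d hd le_rfl)
  have hbound : ∀ J : I.Config 0, ∃ K, ∀ ω,
      0 ≤ ∑ i, I.net (A ω (configPrediction J)) i I.T ∧
      ∑ i, I.net (A ω (configPrediction J)) i I.T ≤ K := by
    intro J
    refine ⟨∑ i, ∑ t ∈ Finset.Icc 1 I.T, I.supply i * I.ρ i t, fun ω => ?_⟩
    have hf := hA.feasible ω _ (hJ J)
    constructor
    · exact Finset.sum_nonneg fun i _ => net_nonneg (D := I.T)
        ⟨hf.x_nonneg, hf.y_nonneg, hf.supply, hf.budget, hf.release⟩ i
    · refine Finset.sum_le_sum fun i _ => Finset.sum_le_sum fun t ht => ?_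
      have h1 := hf.x_le i (t := t) (by simpa using ht)
      have h2 := hf.y_nonneg i t (by simpa using ht)
      linarith
  have hcost : ∀ J : I.Config 0, ENNReal.ofReal (max (I.c ((meanVars μ A).θ J))
      (I.C ((meanVars μ A).lam J))) ≤ I.costGuarantee μ A := by
    intro J
    obtain ⟨K, hK⟩ := hbound J
    have hnet := isMean_net (μ := μ) hA J
    rw [ENNReal.ofReal_max]
    refine max_le ?_ ?_
    · refine le_trans (jensen_max (μ := μ) I.c_convex I.c_mono I.c_zero
        ((IsMean.const ((configPrediction J).hi I.T)).sub hnet)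
        (K := (configPrediction J).hi I.T) fun ω => by linarith [(hK ω).1]) ?_
      refine le_trans (lintegral_mono fun ω => ENNReal.ofReal_le_ofReal ?_)
        (hle J ((configPrediction J).hi I.T) ⟨(hJ J).lo_le_hi I.T le_rfl, le_rfl⟩)
      exact le_add_of_nonneg_right (C_nonneg (le_max_left _ _))
    · refine le_trans (jensen_max (μ := μ) I.C_convex I.C_mono I.C_zero
        (hnet.sub (IsMean.const ((configPrediction J).lo I.T)))
        (K := K - (configPrediction J).lo I.T) fun ω => by linarith [(hK ω).2]) ?_
      refine le_trans (lintegral_mono fun ω => ENNReal.ofReal_le_ofReal ?_)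
        (hle J ((configPrediction J).lo I.T) ⟨le_rfl, (hJ J).lo_le_hi I.T le_rfl⟩)
      exact le_add_of_nonneg_left (c_nonneg (le_max_left _ _))
  by_cases htop : I.costGuarantee μ A = ⊤
  · rw [htop]; exact le_top
  · obtain ⟨z, hz⟩ := exists_isOptimal (isRegularState_initialState (I := I))
    rw [lpValue_eq hz]
    refine ENNReal.ofReal_le_of_le_toReal ((hz.2 _ (meanVars_isFeasible (μ := μ) hA)).trans
      (LPVars.objective_le fun J => ?_))
    exact (ENNReal.ofReal_le_iff_le_toReal htop).1 (hcost J)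

end algorithm

theorem minimaxCost_eq (I : StaffingInstance) :
    StaffingInstance.minimaxCost.{u} I = ENNReal.ofReal I.lpValue := by
  apply le_antisymm
  · obtain ⟨E⟩ := I.nonempty_emulator
    refine le_trans ?_ E.costGuarantee_le.{u}
    exact iInf_le_of_le PUnit.{u + 1} <| iInf_le_of_le inferInstance <|
      iInf_le_of_le (Measure.dirac PUnit.unit) <| iInf_le_of_le inferInstance <|
      iInf_le_of_le (fun _ => E.act) <| iInf_le_of_le E.isOnlineAlgorithm le_rfl
  · refine le_iInf fun Ω => le_iInf fun _ => le_iInf fun μ => le_iInf fun _ => le_iInf fun A =>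
      le_iInf fun hA => lpValue_le_costGuarantee hA

end StaffingInstance

theorem mainTheorem4 (I : StaffingInstance) :
    (∃ z : I.LPVars 0, z.IsOptimal I.initialState) ∧
    StaffingInstance.minimaxCost.{u} I = ENNReal.ofReal I.lpValue ∧
    Nonempty I.Emulator ∧
    ∀ E : I.Emulator,
      I.IsOnlineAlgorithm (fun _ : PUnit.{u + 1} => E.act) ∧
      I.costGuarantee (Measure.dirac PUnit.unit) (fun _ : PUnit.{u + 1} => E.act)
        = StaffingInstance.minimaxCost.{u} I := by
  refine ⟨StaffingInstance.exists_isOptimal StaffingInstance.isRegularState_initialState,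
    I.minimaxCost_eq, I.nonempty_emulator, fun E => ⟨E.isOnlineAlgorithm, ?_⟩⟩
  rw [I.minimaxCost_eq]
  exact le_antisymm E.costGuarantee_le
    (StaffingInstance.lpValue_le_costGuarantee E.isOnlineAlgorithm)
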